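/- Let $\nu$ be a probability measure on $\mathbb{Z}_{\ge -1}=\{-1,0,1,\dots\}$ with $\nu(-1)\neq 0$, finite first moment and mean $0$. Let $X, X_1,X_2,\dots$ be i.i.d. with law $\nu$ and $S_0=0$, $S_n=X_1+\dots+X_n$. A measurable function $L_1:[0,\infty)\to[0,\infty)$ is slowly varying if $L_1(cx)/L_1(x)\to 1$ as $x\to\infty$ for every $c>0$. For $\alpha\in[1,2]$ we say that $\nu$ satisfies $(\mathrm{H}_\alpha)$ if $\mathbb{P}(X\ge n)=n^{-\alpha}L_1(n)$ for all integers $n\ge1$, for some slowly varying $L_1$; the case where $X$ has finite variance is also included in $(\mathrm{H}_2)$. We say that $\nu$ satisfies $(\mathrm{H}_1^{\mathrm{loc}})$ if $\mathbb{P}(X=n)=n^{-2}L_1(n)$ for all integers $n\ge 1$, for some slowly varying $L_1$. Let $\mathrm{D}(\nu)$ be the set of all $A\subset\mathbb{Z}_{\ge-1}$ with $\nu(A)>0$ such that: $A$ is arbitrary if $\nu$ has finite variance; $A$ or $\mathbb{Z}_{\ge-1}\setminus A$ is finite if $\nu$ has infinite variance and satisfies $(\mathrm{H}_\alpha)$ for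 some $\alpha\in(1,2]$; and $A=\mathbb{Z}_{\ge-1}$ if $\nu$ satisfies $(\mathrm{H}_1)$ or $(\mathrm{H}_1^{\mathrm{loc}})$. Let $(a_n)_{n\ge1}$ be positive numbers such that: if $\nu$ satisfies $(\mathrm{H}_\alpha)$ with $\alpha\in(1,2]$, then $a_n^{-1}S_n$ converges in distribution to the law with Laplace transform $\mathbb{E}[e^{-t\mathscr{X}}]=e^{t^\alpha}$, $t>0$; if $\nu$ satisfies $(\mathrm{H}_1^{\mathrm{loc}})$, then for some real sequence $(b_n)$, $a_n^{-1}(S_n-b_n)$ converges in distribution to the law with Laplace transform $\mathbb{E}[e^{-t\mathscr{X}}]=e^{t\ln t}$, $t>0$. For an integer $\varrho\ge1$ let $W^{\varrho}$ be the path $S$ stopped when it first hits $-\varrho$. For a finite path $w$ let $\zeta(w)$ be its number of steps and, for $B\subset\mathbb{Z}_{\ge-1}$, let $J_B(w)=\#\{1\le i\le\zeta(w): w(i)-w(i-1)\in B\}$. Let $W^{\varrho}_{n,A}$ have the law of $W^{\varrho}$ conditioned on $J_A(W^{\varrho})=n$, and let $W_{\ge n}$ have the law of $S$ conditioned to stay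 non-negative at least up to time $n$ and stopped when it first hits $-1$. **Lemma.** Let $B\subset\mathbb{Z}_{\ge-1}$. 1. Suppose that $\nu$ satisfies $(\mathrm{H}_\alpha)$ for some $\alpha\in(1,2]$, or $(\mathrm{H}_1^{\mathrm{loc}})$. Let $A\in\mathrm{D}(\nu)$ and let $(\varrho_n)_{n\ge1}$ be positive integers with $\varrho_n=O(a_n)$. Below, $n$ is restricted to the set of integers $n\ge1$ with $\mathbb{P}(J_A(W^{\varrho_n})=n)>0$. Then, for every coupling of the paths $W^{\varrho_n}_{n,A}$ on one probability space, $$\frac1n J_B(W^{\varrho_n}_{n,A})\longrightarrow\frac{\nu(B)}{\nu(A)}\quad\text{almost surely as } n\to\infty.$$ Moreover, if $\nu(B)>0$, then for every $\delta>0$ there exist $c,C>0$ such that for all such $n$, $$\mathbb{P}\left(\left|\frac{n}{J_B(W^{\varrho_n}_{n,A})}-\frac{\nu(A)}{\nu(B)}\right|>\frac{\delta}{n^{1/4}}\right)\le C e^{-c n^{1/2}},$$ where $n/0=\infty$. 2. Suppose that $\nu$ satisfies $(\mathrm{H}_1)$. Then, for every coupling of the paths $W_{\ge n}$, $n\ge1$,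 on one probability space, $$\frac{J_B(W_{\ge n})}{\zeta(W_{\ge n})}\longrightarrow\nu(B)\quad\text{almost surely as } n\to\infty.$$ -/

import Mathlib

open MeasureTheory ProbabilityTheory Filter Topology Asymptotics
open scoped NNReal

noncomputable section

namespace LukaPath

/-! ### Jump distributions and their tail assumptions -/

/-- A slowly varying function `l : [0, ∞) → [0, ∞)`. -/
def SlowlyVarying (l : ℝ≥0 → ℝ≥0) : Prop :=
  Measurable l ∧
    ∀ c : ℝ≥0, 0 < c → Tendsto (fun x : ℝ≥0 => ((l (c * x) : ℝ) / (l x : ℝ))) atTop (𝓝 1)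

/-- `ν` is supported on `{-1, 0, 1, …}`, charges `-1`, and has a finite first moment and mean zero
(it is always used for a probability measure `ν`). -/
structure IsCentredJumpLaw (ν : Measure ℤ) : Prop where
  support : ν (Set.Iio (-1)) = 0
  charges : ν {-1} ≠ 0
  integrable : Integrable (fun k : ℤ => (k : ℝ)) ν
  mean_zero : ∫ k : ℤ, (k : ℝ) ∂ν = 0

/-- The jump law has a finite second moment. -/
def FiniteVariance (ν : Measure ℤ) : Prop :=
  MemLp (fun k : ℤ => (k : ℝ)) 2 ν

/-- Assumption `(H_α)`: `ν([n, ∞)) = n ^ (-α) L₁(n)` with `L₁` slowly varying; the finite variance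
case is included in `(H_2)`. -/
def HTail (α : ℝ) (ν : Measure ℤ) : Prop :=
  (∃ L₁ : ℝ≥0 → ℝ≥0, SlowlyVarying L₁ ∧
    ∀ n : ℕ, 1 ≤ n → ν.real (Set.Ici (n : ℤ)) = (n : ℝ) ^ (-α) * (L₁ (n : ℝ≥0) : ℝ)) ∨
  (α = 2 ∧ FiniteVariance ν)

/-- Assumption `(H_1^loc)`: `ν(n) = n ^ (-2) L₁(n)` with `L₁` slowly varying. -/
def HLoc (ν : Measure ℤ) : Prop :=
  ∃ L₁ : ℝ≥0 → ℝ≥0, SlowlyVarying L₁ ∧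
    ∀ n : ℕ, 1 ≤ n → ν.real {(n : ℤ)} = (n : ℝ) ^ (-2 : ℝ) * (L₁ (n : ℝ≥0) : ℝ)

/-- The admissible sets of jumps `D(ν)`: subsets `A` of `{-1, 0, 1, …}` with `ν(A) > 0`, which are
arbitrary if `ν` has finite variance; which are finite or cofinite in `{-1, 0, 1, …}` if `ν` has
infinite variance and satisfies `(H_α)` for some `α ∈ (1, 2]`; and which are the whole of
`{-1, 0, 1, …}` under `(H_1)` or `(H_1^loc)`. -/
def Admissible (ν : Measure ℤ) : Set (Set ℤ) :=
  {A | A ⊆ Set.Ici (-1) ∧ 0 < ν A ∧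
    ((¬ FiniteVariance ν ∧ ∃ α ∈ Set.Ioc (1 : ℝ) 2, HTail α ν) →
      A.Finite ∨ (Set.Ici (-1) \ A).Finite) ∧
    ((HTail 1 ν ∨ HLoc ν) → A = Set.Ici (-1))}

/-! ### The random walk and its scaling sequence -/

/-- The law of the i.i.d. sequence of jumps `X₁, X₂, …` (where `X_{i+1}` is `x i`). -/
abbrev jumpsLaw (ν : Measure ℤ) : Measure (ℕ → ℤ) :=
  Measure.infinitePi (fun _ : ℕ => ν)

/-- The walk `S_n = X₁ + ⋯ + X_n`. -/
def walk (x : ℕ → ℤ) (n : ℕ) : ℤ := ∑ i ∈ Finset.range n, x i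

/-- The law `μ` on the real line has Laplace transform `E[exp(-t 𝒳)] = exp (ψ t)` for `t > 0`. -/
def HasLaplaceExponent (μ : Measure ℝ) (ψ : ℝ → ℝ) : Prop :=
  ∀ t : ℝ, 0 < t → Integrable (fun y : ℝ => Real.exp (-t * y)) μ ∧
    ∫ y, Real.exp (-t * y) ∂μ = Real.exp (ψ t)

/-- `(S_n - b_n) / a_n` converges in distribution, with `a_n > 0`, to the law whose Laplace
transform is `exp (ψ t)`, `t > 0`. -/
def ScalesTo (ν : Measure ℤ) [IsProbabilityMeasure ν] (a b : ℕ → ℝ) (ψ : ℝ → ℝ) : Prop :=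
  (∀ n : ℕ, 1 ≤ n → 0 < a n) ∧
    ∃ (μ : Measure ℝ) (_ : IsProbabilityMeasure μ), HasLaplaceExponent μ ψ ∧
      TendstoInDistribution
        (fun (n : ℕ) (x : ℕ → ℤ) => ((walk x n : ℝ) - b n) / a n) atTop
        (id : ℝ → ℝ) (fun _ => jumpsLaw ν) μ

/-- `a` is a scaling sequence in the regime `α ∈ (1, 2]`: `S_n / a_n` converges in distribution to
`𝒳^(α)` with `E[exp(-t 𝒳^(α))] = exp(t ^ α)`. -/
def IsStableScaling (ν : Measure ℤ) [IsProbabilityMeasure ν] (α : ℝ) (a : ℕ → ℝ) : Prop :=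
  ScalesTo ν a 0 (fun t => t ^ α)

/-- `a` is a scaling sequence in the Cauchy regime: for some centring sequence `b`,
`(S_n - b_n) / a_n` converges in distribution to `𝒳^(1)` with
`E[exp(-t 𝒳^(1))] = exp(t log t)`. -/
def IsCauchyScaling (ν : Measure ℤ) [IsProbabilityMeasure ν] (a : ℕ → ℝ) : Prop :=
  ∃ b : ℕ → ℝ, ScalesTo ν a b (fun t => t * Real.log t)

/-! ### Finite paths, first-passage paths and their conditioned versions -/

/-- A finite integer-valued path `(w(0), …, w(ℓ))`, together with its number of steps `ℓ`. -/
abbrev FinPath : Type := Σ ℓ : ℕ, (Fin (ℓ + 1) → ℤ)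

/-- The number of steps `ζ(w)` of a path. -/
def FinPath.numSteps (w : FinPath) : ℕ := w.1

/-- `J_B(w)`: the number of steps of `w` whose increment lies in `B`. -/
def FinPath.jumpCount (B : Set ℤ) (w : FinPath) : ℕ :=
  {i : Fin w.1 | w.2 i.succ - w.2 i.castSucc ∈ B}.ncard

/-- The first hitting time `ζ(S, r) = inf {i ≥ 1 : S_i = -r}`; it is almost surely finite for the
walks considered here (it takes the value `0`, which is never a hitting time, when `-r` is not
hit). -/
def hitTime (r : ℕ) (x : ℕ → ℤ) : ℕ := sInf {i : ℕ | 1 ≤ i ∧ walk x i = -(r : ℤ)}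

/-- `W^r`: the walk stopped when first hitting `-r`. -/
def stoppedPath (r : ℕ) (x : ℕ → ℤ) : FinPath :=
  ⟨hitTime r x, fun i => walk x i⟩

lemma measurable_walk (n : ℕ) : Measurable (fun x : ℕ → ℤ => walk x n) := by
  unfold walk
  fun_prop

lemma measurable_hitTime (r : ℕ) : Measurable (hitTime r) := by
  have hset : ∀ i : ℕ, MeasurableSet {x : ℕ → ℤ | 1 ≤ i ∧ walk x i = -(r : ℤ)} := fun i =>
    (MeasurableSet.const (1 ≤ i)).inter (measurable_walk i (measurableSet_singleton (-(r : ℤ))))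
  refine measurable_to_countable' fun k => ?_
  have : hitTime r ⁻¹' {k} =
      {x | (1 ≤ k ∧ walk x k = -(r : ℤ)) ∧ ∀ j < k, ¬ (1 ≤ j ∧ walk x j = -(r : ℤ))} ∪
      {x | k = 0 ∧ ∀ j, ¬ (1 ≤ j ∧ walk x j = -(r : ℤ))} := by
    ext x
    simp only [Set.mem_preimage, Set.mem_singleton_iff, Set.mem_union, Set.mem_ofPred_eq]
    constructor
    · intro h
      by_cases hne : {i : ℕ | 1 ≤ i ∧ walk x i = -(r : ℤ)}.Nonempty
      · left
        subst h
        exact ⟨Nat.sInf_mem hne, fun j hj => Nat.notMem_of_lt_sInf hj⟩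
      · right
        rw [Set.not_nonempty_iff_eq_empty] at hne
        refine ⟨?_, fun j hj => (Set.ext_iff.1 hne j).1 hj⟩
        rw [← h, hitTime, hne, Nat.sInf_empty]
    · rintro (⟨h1, h2⟩ | ⟨rfl, h⟩)
      · refine le_antisymm (Nat.sInf_le h1) ?_
        by_contra hlt
        exact h2 _ (not_le.1 hlt) (Nat.sInf_mem (s := {i : ℕ | 1 ≤ i ∧ walk x i = -(r : ℤ)}) ⟨k, h1⟩)
      · have : {i : ℕ | 1 ≤ i ∧ walk x i = -(r : ℤ)} = ∅ := Set.eq_empty_of_forall_notMem h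
        rw [hitTime, this, Nat.sInf_empty]
  rw [this]
  refine MeasurableSet.union ?_ ?_
  · have h : MeasurableSet {x : ℕ → ℤ | ∀ j < k, ¬ (1 ≤ j ∧ walk x j = -(r : ℤ))} := by
      simp only [Set.ofPred_forall]
      exact MeasurableSet.iInter fun j => MeasurableSet.iInter fun _ => (hset j).compl
    exact (hset k).inter h
  · have h : MeasurableSet {x : ℕ → ℤ | ∀ j, ¬ (1 ≤ j ∧ walk x j = -(r : ℤ))} := by
      simp only [Set.ofPred_forall]
      exact MeasurableSet.iInter fun j => (hset j).compl
    exact (MeasurableSet.const (k = 0)).inter h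

lemma measurable_stoppedPath (r : ℕ) : Measurable (stoppedPath r) := by
  intro t ht
  have : stoppedPath r ⁻¹' t = ⋃ ℓ : ℕ, (hitTime r ⁻¹' {ℓ}) ∩
      (fun (x : ℕ → ℤ) (i : Fin (ℓ + 1)) => walk x i) ⁻¹' ((fun v => (⟨ℓ, v⟩ : FinPath)) ⁻¹' t) := by
    ext x
    simp [stoppedPath]
  rw [this]
  refine MeasurableSet.iUnion fun ℓ =>
    (measurable_hitTime r (measurableSet_singleton ℓ)).inter ?_
  have hm : Measurable (fun (x : ℕ → ℤ) (i : Fin (ℓ + 1)) => walk x i) :=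
    measurable_pi_lambda _ fun i => measurable_walk i
  exact hm ((iInf_le (fun ℓ : ℕ => MeasurableSpace.map
    (fun v : Fin (ℓ + 1) → ℤ => (⟨ℓ, v⟩ : FinPath)) inferInstance) ℓ) t ht)

/-- The event that `W^r` makes exactly `n` jumps with values in `A`. -/
def jumpEvent (A : Set ℤ) (r n : ℕ) : Set (ℕ → ℤ) :=
  {x | (stoppedPath r x).jumpCount A = n}

/-- The law of `W^r_{n,A}`: the path `W^r` conditioned to make `n` jumps with values in `A`. -/
def condLaw (ν : Measure ℤ) (A : Set ℤ) (r n : ℕ) : Measure FinPath :=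
  (cond (jumpsLaw ν) (jumpEvent A r n)).map (stoppedPath r)

/-- The values `n ≥ 1` for which the law of `W^{ϱ_n}_{n,A}` is well defined. -/
def validTimes (ν : Measure ℤ) (A : Set ℤ) (ϱ : ℕ → ℕ) : Set ℕ :=
  {n | 1 ≤ n ∧ jumpsLaw ν (jumpEvent A (ϱ n) n) ≠ 0}

/-- The law of `W_{≥n}`: the walk conditioned to stay non-negative at least up to time `n`, and
stopped when first hitting `-1`. -/
def tailLaw (ν : Measure ℤ) (n : ℕ) : Measure FinPath :=
  (cond (jumpsLaw ν) {x | ∀ i ≤ n, 0 ≤ walk x i}).map (stoppedPath 1)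

end LukaPath

end

noncomputable section

namespace LukaPath

/-! ### The Markov property of the jump sequence -/

/-! An estimate that fails with probability at most `exp(-c√n)` survives conditioning on an event of
probability `exp(-o(√n))`. At a fixed time `N`, the combination `ν(A) J_B - ν(B) J_A` is a sum of
`N` bounded centred i.i.d. variables. A relative error of order `n^(-1/4)` in the ratio of the
counts makes it of size `n^(3/4)`, which by Hoeffding costs `exp(-c√n)` for `N` of order `n`. A
union bound over `N ≤ 2n/ν(A)` handles the random hitting time, since a later hitting time would
require too few jumps in `A` (`exists_real_jumpEvent_inter_le`). The first Borel–Cantelli lemma then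
gives almost sure convergence, and it is indifferent to the coupling.

The substance is therefore the lower bound `SubexponentialJumpEvents` for `P(J_A(W^ϱ) = n)`. Half of
the cycle lemma (`real_state_le_mul_hitTime`) removes the first-passage constraint up to a
polynomial factor, leaving a truncated Green function of the planar walk `(S, J_A)` at `(-ϱ_n, n)`.
It is bounded below recursively: run for half of the remaining count, which uses up a fixed
proportion of it, and restart from the remaining displacement. Periodicity is carried along by
`Lat`, which is stable under subtraction of visited states.

With finite variance, the central limit theorem keeps the remaining height at the diffusive scale
with probability bounded below in each of `O(log n)` rounds, so the bound is polynomial. Otherwise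
put `K ≈ n^(1/4)`. The walk first goes below `-ϱ_n`; at most `K` rounds then bring the remaining
count down to about `K` while the walk does not rise, each at polynomial cost; at most `K/4` large
jumps, taken from dyadic blocks of polynomially large mass, refill the height; bounded heights are
finished at cost `p^K`. The total, `exp(-O(K log K))`, is `exp(-o(√n))`.

The scaling sequence enters through the left tail `P(S_n ≤ -C a_n) ≥ c`. It holds because the limit
law has a superlinear Laplace exponent, hence charges every left half-line. In the Cauchy regime one
also needs `b_n ≤ 0` eventually: comparison of `S_{2n}` with two independent halves gives `2 b_n ≤
b_{2n}`, and one positive `b_n` would then produce a linear drift, against the law of large numbers.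

For the walk conditioned to stay non-negative, a first jump of size at least `n` shows that the
conditioning event has polynomial probability, while deviations at times beyond `n` are
exponentially rare. -/

/-- The sequence that starts with the first `N` terms of `y` and continues with `z`. -/
def concat (N : ℕ) (y z : ℕ → ℤ) : ℕ → ℤ := fun i => if i < N then y i else z (i - N)

lemma measurable_concat (N : ℕ) :
    Measurable (fun p : (ℕ → ℤ) × (ℕ → ℤ) => concat N p.1 p.2) := by
  refine measurable_pi_lambda _ fun i => ?_
  unfold concat
  split_ifs <;> fun_prop

/-- Cylinders determine the law, and a cylinder factors into its coordinates below `N` and the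
shifted remaining ones. This is the Markov property at a deterministic time. -/
lemma map_concat (ν : Measure ℤ) [IsProbabilityMeasure ν] (N : ℕ) :
    ((jumpsLaw ν).prod (jumpsLaw ν)).map (fun p => concat N p.1 p.2) = jumpsLaw ν := by
  refine Measure.eq_infinitePi _ fun s t ht => ?_
  rw [Measure.map_apply (measurable_concat N) (.pi s.countable_toSet fun i _ => ht i)]
  have hpre : (fun p : (ℕ → ℤ) × (ℕ → ℤ) => concat N p.1 p.2) ⁻¹' (Set.pi s t) =
      (Set.pi ((s.filter (· < N) : Finset ℕ) : Set ℕ) t) ×ˢ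
        (Set.pi (((s.filter (¬ · < N)).image (· - N) : Finset ℕ) : Set ℕ) fun i => t (i + N)) := by
    ext ⟨y, z⟩
    simp only [Set.mem_preimage, Set.mem_pi, Set.mem_prod, concat, Finset.mem_coe,
      Finset.mem_filter, Finset.mem_image, not_lt]
    constructor
    · refine fun h => ⟨fun i hi => ?_, ?_⟩
      · simpa [hi.2] using h i hi.1
      · rintro _ ⟨i, ⟨hi, hN⟩, rfl⟩
        have := h i hi
        rw [if_neg (not_lt.2 hN)] at this
        rwa [Nat.sub_add_cancel hN]
    · rintro ⟨h1, h2⟩ i hi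
      split_ifs with hN
      · exact h1 i ⟨hi, hN⟩
      · have := h2 (i - N) ⟨i, ⟨hi, not_lt.1 hN⟩, rfl⟩
        rwa [Nat.sub_add_cancel (not_lt.1 hN)] at this
  rw [hpre, Measure.prod_prod, Measure.infinitePi_pi _ fun i _ => ht i,
    Measure.infinitePi_pi _ fun i _ => ht (i + N), Finset.prod_image,
    ← Finset.prod_filter_mul_prod_filter_not s (· < N)]
  · congr 1
    refine Finset.prod_congr rfl fun i hi => ?_
    rw [Nat.sub_add_cancel (not_lt.1 (Finset.mem_filter.1 hi).2)]
  · intro i hi j hj hij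
    simp only [Finset.coe_filter, Set.mem_ofPred_eq, not_lt] at hi hj
    dsimp only at hij
    omega

lemma jumpsLaw_apply_concat (ν : Measure ℤ) [IsProbabilityMeasure ν] (N : ℕ) {F : Set (ℕ → ℤ)}
    (hF : MeasurableSet F) :
    jumpsLaw ν F = ∫⁻ y, jumpsLaw ν {z | concat N y z ∈ F} ∂(jumpsLaw ν) := by
  conv_lhs => rw [← map_concat ν N]
  rw [Measure.map_apply (measurable_concat N) hF,
    Measure.prod_apply ((measurable_concat N) hF)]
  rfl

/-- Integrates over the first `N` jumps. The sum over `k` is the shape of a Green function, and `H`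
is only almost sure because reachability of the visited state is. -/
lemma le_sum_real_of_concat (ν : Measure ℤ) [IsProbabilityMeasure ν] (N : ℕ) {ι : Type*}
    (s : Finset ι) {F : ι → Set (ℕ → ℤ)} (hF : ∀ k ∈ s, MeasurableSet (F k)) {E : Set (ℕ → ℤ)}
    (hE : MeasurableSet E) {h : ℝ} (hh : 0 ≤ h)
    (H : ∀ᵐ y ∂(jumpsLaw ν), y ∈ E →
      h ≤ ∑ k ∈ s, (jumpsLaw ν).real {z | concat N y z ∈ F k}) :
    (jumpsLaw ν).real E * h ≤ ∑ k ∈ s, (jumpsLaw ν).real (F k) := by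
  have h1 : ∑ k ∈ s, (jumpsLaw ν).real (F k) = (∑ k ∈ s, jumpsLaw ν (F k)).toReal := by
    rw [ENNReal.toReal_sum fun k _ => measure_ne_top _ _]
    rfl
  have h2 : (jumpsLaw ν).real E * h = (jumpsLaw ν E * ENNReal.ofReal h).toReal := by
    rw [ENNReal.toReal_mul, ENNReal.toReal_ofReal hh]
    rfl
  rw [h1, h2]
  refine ENNReal.toReal_mono (ENNReal.sum_ne_top.2 fun k _ => measure_ne_top _ _) ?_
  have h3 : ∑ k ∈ s, jumpsLaw ν (F k) =
      ∫⁻ y, ∑ k ∈ s, jumpsLaw ν {z | concat N y z ∈ F k} ∂(jumpsLaw ν) := by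
    rw [lintegral_finsetSum']
    · exact Finset.sum_congr rfl fun k hk => jumpsLaw_apply_concat ν N (hF k hk)
    · intro k hk
      exact (measurable_measure_prodMk_left ((measurable_concat N) (hF k hk))).aemeasurable
  rw [h3, mul_comm, ← lintegral_indicator_const hE]
  refine lintegral_mono_ae ?_
  filter_upwards [H] with y hy
  by_cases hyE : y ∈ E
  · rw [Set.indicator_of_mem hyE]
    refine (ENNReal.ofReal_le_ofReal (hy hyE)).trans ?_
    rw [ENNReal.ofReal_sum_of_nonneg fun k _ => measureReal_nonneg]
    exact Finset.sum_le_sum fun k _ => (ofReal_measureReal (measure_ne_top _ _)).le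
  · simp [hyE]

lemma mul_le_real_of_concat (ν : Measure ℤ) [IsProbabilityMeasure ν] (N : ℕ)
    {F : Set (ℕ → ℤ)} (hF : MeasurableSet F) {E : Set (ℕ → ℤ)}
    (hE : MeasurableSet E) {h : ℝ} (hh : 0 ≤ h)
    (H : ∀ᵐ y ∂(jumpsLaw ν), y ∈ E → h ≤ (jumpsLaw ν).real {z | concat N y z ∈ F}) :
    (jumpsLaw ν).real E * h ≤ (jumpsLaw ν).real F := by
  simpa using le_sum_real_of_concat ν N {()} (F := fun _ => F) (fun _ _ => hF) hE hh
    (by simpa using H)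

/-! ### The joint walk of positions and jump counts -/

/-- The pair of a jump and the indicator that it belongs to `A`. -/
def step (A : Set ℤ) (k : ℤ) : ℤ × ℤ := (k, A.indicator 1 k)

/-- The position after `n` steps together with the number of jumps in `A`. -/
def state (A : Set ℤ) (x : ℕ → ℤ) (n : ℕ) : ℤ × ℤ := ∑ i ∈ Finset.range n, step A (x i)

lemma state_fst (A : Set ℤ) (x : ℕ → ℤ) (n : ℕ) : (state A x n).1 = walk x n := by
  simp [state, walk, step, Prod.fst_sum]

lemma state_snd (A : Set ℤ) (x : ℕ → ℤ) (n : ℕ) :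
    (state A x n).2 = ∑ i ∈ Finset.range n, A.indicator 1 (x i) := by
  simp [state, step, Prod.snd_sum]

lemma indicator_one_nonneg (A : Set ℤ) (k : ℤ) : 0 ≤ A.indicator (1 : ℤ → ℤ) k :=
  Set.indicator_nonneg (fun _ _ => zero_le_one) k

lemma indicator_one_le_one (A : Set ℤ) (k : ℤ) : A.indicator (1 : ℤ → ℤ) k ≤ 1 :=
  Set.indicator_le_self' (fun _ _ => zero_le_one) k

lemma state_snd_nonneg (A : Set ℤ) (x : ℕ → ℤ) (n : ℕ) : 0 ≤ (state A x n).2 := by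
  rw [state_snd]
  exact Finset.sum_nonneg fun i _ => indicator_one_nonneg A _

lemma state_snd_le (A : Set ℤ) (x : ℕ → ℤ) (n : ℕ) : (state A x n).2 ≤ n := by
  rw [state_snd]
  refine (Finset.sum_le_sum fun i _ => indicator_one_le_one A (x i)).trans ?_
  simp

lemma measurable_state (A : Set ℤ) (n : ℕ) : Measurable fun x => state A x n := by
  have : Measurable (step A) := measurable_of_countable _
  unfold state
  fun_prop

lemma sum_concat {E : Type*} [AddCommMonoid E] (f : ℤ → E) (N k : ℕ) (y z : ℕ → ℤ) :
    ∑ i ∈ Finset.range (N + k), f (concat N y z i) =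
      ∑ i ∈ Finset.range N, f (y i) + ∑ i ∈ Finset.range k, f (z i) := by
  rw [Finset.sum_range_add]
  congr 1
  · refine Finset.sum_congr rfl fun i hi => ?_
    rw [concat, if_pos (Finset.mem_range.1 hi)]
  · refine Finset.sum_congr rfl fun i _ => ?_
    rw [concat, if_neg (by omega), Nat.add_sub_cancel_left]

lemma state_concat (A : Set ℤ) (N k : ℕ) (y z : ℕ → ℤ) :
    state A (concat N y z) (N + k) = state A y N + state A z k :=
  sum_concat (step A) N k y z

lemma walk_concat (N k : ℕ) (y z : ℕ → ℤ) :
    walk (concat N y z) (N + k) = walk y N + walk z k :=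
  sum_concat id N k y z

/-- The truncated Green function of the joint walk. -/
def green (ν : Measure ℤ) [IsProbabilityMeasure ν] (A : Set ℤ) (M : ℕ) (t : ℤ × ℤ) : ℝ :=
  ∑ k ∈ Finset.range M, (jumpsLaw ν).real {x | state A x k = t}

lemma measurableSet_state_eq (A : Set ℤ) (n : ℕ) (t : ℤ × ℤ) :
    MeasurableSet {x | state A x n = t} :=
  measurable_state A n (measurableSet_singleton t)

lemma green_mono (ν : Measure ℤ) [IsProbabilityMeasure ν] (A : Set ℤ) {M M' : ℕ} (h : M ≤ M')
    (t : ℤ × ℤ) : green ν A M t ≤ green ν A M' t :=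
  Finset.sum_le_sum_of_subset_of_nonneg (Finset.range_mono h) fun _ _ _ => measureReal_nonneg

lemma real_le_green (ν : Measure ℤ) [IsProbabilityMeasure ν] (A : Set ℤ) {k M : ℕ} (h : k < M)
    (t : ℤ × ℤ) : (jumpsLaw ν).real {x | state A x k = t} ≤ green ν A M t :=
  Finset.single_le_sum (f := fun k => (jumpsLaw ν).real {x | state A x k = t})
    (fun _ _ => measureReal_nonneg) (Finset.mem_range.2 h)

/-- One round of every recursion below: a good event for the first `N` steps, then a Green function
bound for the displacement still to be covered. -/
lemma mul_le_green (ν : Measure ℤ) [IsProbabilityMeasure ν] (A : Set ℤ) (N M : ℕ) (t : ℤ × ℤ)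
    {E : Set (ℕ → ℤ)} (hE : MeasurableSet E) {h : ℝ} (hh : 0 ≤ h)
    (H : ∀ᵐ y ∂(jumpsLaw ν), y ∈ E → h ≤ green ν A M (t - state A y N)) :
    (jumpsLaw ν).real E * h ≤ green ν A (N + M) t := by
  have h1 : ∑ k ∈ Finset.range M, (jumpsLaw ν).real {x | state A x (N + k) = t} ≤
      green ν A (N + M) t := by
    rw [green, Finset.sum_range_add]
    exact le_add_of_nonneg_left (Finset.sum_nonneg fun _ _ => measureReal_nonneg)
  refine le_trans ?_ h1
  refine le_sum_real_of_concat ν N _ (fun k _ => measurableSet_state_eq A _ t) hE hh ?_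
  filter_upwards [H] with y hy hyE
  refine (hy hyE).trans_eq (Finset.sum_congr rfl fun k _ => ?_)
  congr 1
  ext z
  simp only [Set.mem_ofPred_eq, state_concat]
  exact ⟨fun h => by rw [h]; abel, fun h => by rw [← h]; abel⟩

/-! ### The cycle lemma -/

/-- The cyclic shift by `k` of the first `N` indices. -/
def rotate (N k i : ℕ) : ℕ := if i < N then (i + k) % N else i

lemma rotate_lt {N k i : ℕ} (hi : i < N) : rotate N k i < N := by
  rw [rotate, if_pos hi]
  exact Nat.mod_lt _ (by omega)

lemma rotate_injective (N k : ℕ) : Function.Injective (rotate N k) := by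
  intro i j h
  by_cases hi : i < N <;> by_cases hj : j < N
  · simp only [rotate, hi, hj, if_true] at h
    have := Nat.ModEq.add_right_cancel' k (show i + k ≡ j + k [MOD N] from h)
    rwa [Nat.ModEq, Nat.mod_eq_of_lt hi, Nat.mod_eq_of_lt hj] at this
  · have := rotate_lt (k := k) hi
    rw [h, rotate, if_neg hj] at this
    omega
  · have := rotate_lt (k := k) hj
    rw [← h, rotate, if_neg hi] at this
    omega
  · simpa [rotate, hi, hj] using h

lemma image_rotate (N k : ℕ) : (Finset.range N).image (rotate N k) = Finset.range N := by
  refine Finset.eq_of_subset_of_card_le ?_ ?_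
  · intro j hj
    obtain ⟨i, hi, rfl⟩ := Finset.mem_image.1 hj
    exact Finset.mem_range.2 (rotate_lt (Finset.mem_range.1 hi))
  · rw [Finset.card_image_of_injective _ (rotate_injective N k)]

lemma sum_rotate {E : Type*} [AddCommMonoid E] (g : ℕ → E) (N k : ℕ) :
    ∑ i ∈ Finset.range N, g (rotate N k i) = ∑ i ∈ Finset.range N, g i := by
  conv_rhs => rw [← image_rotate N k, Finset.sum_image (rotate_injective N k).injOn]

lemma walk_rotate_of_le {N k j : ℕ} (x : ℕ → ℤ) (h : k + j ≤ N) :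
    walk (fun i => x (rotate N k i)) j = walk x (k + j) - walk x k := by
  rw [walk, walk, walk, Finset.sum_range_add, add_sub_cancel_left]
  refine Finset.sum_congr rfl fun i hi => ?_
  have := Finset.mem_range.1 hi
  rw [rotate, if_pos (by omega), Nat.mod_eq_of_lt (by omega), add_comm]

lemma walk_rotate_of_ge {N k j : ℕ} (x : ℕ → ℤ) (hk : k ≤ N) (h : N ≤ k + j) (hj : j ≤ N) :
    walk (fun i => x (rotate N k i)) j = walk x N - walk x k + walk x (k + j - N) := by
  obtain ⟨l, rfl⟩ : ∃ l, j = (N - k) + l := ⟨j - (N - k), by omega⟩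
  have h1 := walk_rotate_of_le (N := N) (k := k) (j := N - k) x (by omega)
  rw [Nat.add_sub_cancel' hk] at h1
  rw [walk, Finset.sum_range_add, ← walk, h1, show k + (N - k + l) - N = l by omega]
  congr 1
  refine Finset.sum_congr rfl fun i hi => ?_
  have := Finset.mem_range.1 hi
  rw [rotate, if_pos (by omega), show N - k + i + k = i + N by omega, Nat.add_mod_right,
    Nat.mod_eq_of_lt (by omega)]

lemma hitTime_eq {r N : ℕ} {x : ℕ → ℤ} (hN : 1 ≤ N) (hx : walk x N = -(r : ℤ))
    (h : ∀ j, 1 ≤ j → j < N → walk x j ≠ -(r : ℤ)) : hitTime r x = N := by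
  refine le_antisymm (Nat.sInf_le ⟨hN, hx⟩) (le_csInf ⟨N, hN, hx⟩ ?_)
  rintro j ⟨hj, hj'⟩
  by_contra! hlt
  exact h j hj hlt hj'

/-- Start the cycle at the first time `k` where the walk is minimal on `[0, N]`. Up to the end of
the original path the rotated walk is nonnegative; after wrapping around it is strictly above `-r`,
because earlier values strictly exceed the minimum. Since `S_N < 0`, `k` is not `0`. -/
lemma exists_rotate_hitTime {r N : ℕ} (hr : 1 ≤ r) {x : ℕ → ℤ} (hx : walk x N = -(r : ℤ)) :
    ∃ k ∈ Finset.range N, hitTime r (fun i => x (rotate N (k + 1) i)) = N := by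
  classical
  have hex : ∃ k, k ≤ N ∧ ∀ j ≤ N, walk x k ≤ walk x j := by
    obtain ⟨k, hk, hmin⟩ := Finset.exists_min_image (Finset.range (N + 1)) (walk x) ⟨0, by simp⟩
    refine ⟨k, Nat.lt_succ_iff.1 (Finset.mem_range.1 hk), fun j hj => hmin j ?_⟩
    exact Finset.mem_range.2 (Nat.lt_succ_iff.2 hj)
  set k := Nat.find hex with hk
  obtain ⟨hkN, hkmin⟩ := Nat.find_spec hex
  rw [← hk] at hkN hkmin
  have hfirst : ∀ j < k, walk x k < walk x j := by
    intro j hj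
    by_contra! hle
    exact Nat.find_min hex hj ⟨by omega, fun i hi => hle.trans (hkmin i hi)⟩
  have hk0 : k ≠ 0 := by
    intro h0
    have := hkmin N le_rfl
    rw [h0, hx] at this
    simp [walk] at this
    omega
  have hN : 1 ≤ N := by omega
  refine ⟨k - 1, Finset.mem_range.2 (by omega), ?_⟩
  rw [Nat.sub_add_cancel (by omega)]
  refine hitTime_eq hN ?_ fun j hj hjN => ?_
  · rw [walk_rotate_of_ge x hkN (by omega) le_rfl, Nat.add_sub_cancel, hx]
    ring
  · rcases le_or_gt (k + j) N with h | h
    · rw [walk_rotate_of_le x h]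
      have := hkmin (k + j) h
      omega
    · rw [walk_rotate_of_ge x hkN h.le hjN.le, hx]
      have := hfirst (k + j - N) (by omega)
      omega

lemma map_rotate (ν : Measure ℤ) [IsProbabilityMeasure ν] (N k : ℕ) :
    (jumpsLaw ν).map (fun x i => x (rotate N k i)) = jumpsLaw ν :=
  Measure.map_infinitePi_infinitePi_of_inj (P := fun _ : ℕ => ν) (rotate_injective N k)

/-- A quantitative half of the cycle lemma. -/
lemma real_state_le_mul_hitTime (ν : Measure ℤ) [IsProbabilityMeasure ν] (A : Set ℤ) {r : ℕ}
    (hr : 1 ≤ r) (N : ℕ) (n : ℤ) :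
    (jumpsLaw ν).real {x | state A x N = (-(r : ℤ), n)} ≤
      N * (jumpsLaw ν).real {x | hitTime r x = N ∧ (state A x N).2 = n} := by
  set F := {x | hitTime r x = N ∧ (state A x N).2 = n} with hF
  have hFm : MeasurableSet F := (measurable_hitTime r (measurableSet_singleton N)).inter
    ((measurable_snd.comp (measurable_state A N)) (measurableSet_singleton n))
  -- Each shift preserves both the law and the count, and one good shift among `N` is enough for a
  -- bound up to the factor `N`.
  have hsub : {x | state A x N = (-(r : ℤ), n)} ⊆
      ⋃ k ∈ Finset.range N, (fun x i => x (rotate N (k + 1) i)) ⁻¹' F := by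
    intro x hx
    have hx' : state A x N = (-(r : ℤ), n) := hx
    obtain ⟨k, hk, hhit⟩ := exists_rotate_hitTime hr
      (show walk x N = -(r : ℤ) by rw [← state_fst A, hx'])
    refine Set.mem_biUnion (Finset.mem_coe.2 hk) ⟨hhit, ?_⟩
    rw [state, sum_rotate (fun i => step A (x i))]
    exact congrArg Prod.snd hx'
  refine (measureReal_mono hsub (measure_ne_top _ _)).trans ((measureReal_biUnion_finset_le _ _).trans ?_)
  have : ∀ k ∈ Finset.range N,
      (jumpsLaw ν).real ((fun x i => x (rotate N (k + 1) i)) ⁻¹' F) = (jumpsLaw ν).real F := by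
    intro k _
    rw [← map_measureReal_apply (by fun_prop) hFm, map_rotate]
  rw [Finset.sum_congr rfl this]
  simp

lemma jumpCount_stoppedPath (A : Set ℤ) (r : ℕ) (x : ℕ → ℤ) :
    ((stoppedPath r x).jumpCount A : ℤ) = (state A x (hitTime r x)).2 := by
  classical
  have h1 : (stoppedPath r x).jumpCount A =
      {i : Fin (hitTime r x) | x i ∈ A}.ncard := by
    rw [FinPath.jumpCount]
    congr 1
    ext i
    simp [stoppedPath, walk, Finset.sum_range_succ]
  rw [h1, state_snd, Set.ncard_eq_toFinset_card', ← Fin.sum_univ_eq_sum_range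
    (fun i => A.indicator (1 : ℤ → ℤ) (x i))]
  simp [Set.indicator_apply]

lemma jumpEvent_eq (A : Set ℤ) (r n : ℕ) :
    jumpEvent A r n = {x | (state A x (hitTime r x)).2 = n} := by
  ext x
  simp only [jumpEvent, Set.mem_ofPred_eq, ← jumpCount_stoppedPath, Nat.cast_inj]

/-- The probability of making `n` jumps in `A` before hitting `-r` is bounded below by the Green
function at `(-r, n)`. -/
lemma green_le_mul_jumpEvent (ν : Measure ℤ) [IsProbabilityMeasure ν] (A : Set ℤ) {r n : ℕ}
    (hr : 1 ≤ r) (M : ℕ) :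
    green ν A M (-(r : ℤ), n) ≤ M * (jumpsLaw ν).real (jumpEvent A r n) := by
  set F : ℕ → Set (ℕ → ℤ) := fun N => {x | hitTime r x = N ∧ (state A x N).2 = n} with hF
  have hFm : ∀ N, MeasurableSet (F N) := fun N =>
    (measurable_hitTime r (measurableSet_singleton N)).inter
      ((measurable_snd.comp (measurable_state A N)) (measurableSet_singleton (n : ℤ)))
  have h1 : green ν A M (-(r : ℤ), n) ≤ ∑ N ∈ Finset.range M, M * (jumpsLaw ν).real (F N) := by
    refine Finset.sum_le_sum fun N hN => (real_state_le_mul_hitTime ν A hr N n).trans ?_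
    gcongr
    exact (Finset.mem_range.1 hN).le
  refine h1.trans ?_
  rw [← Finset.mul_sum]
  gcongr
  rw [← measureReal_biUnion_finset]
  · refine measureReal_mono ?_
    rw [jumpEvent_eq]
    intro x hx
    obtain ⟨N, -, hN⟩ := Set.mem_iUnion₂.1 hx
    simpa [hN.1] using hN.2
  · intro N _ N' _ hne
    refine Set.disjoint_left.2 fun x hx hx' => hne ?_
    rw [← hx.1, hx'.1]
  · exact fun N _ => hFm N

/-! ### Reachable states -/

section Reach

set_option linter.unusedSectionVars false

variable (ν : Measure ℤ) [IsProbabilityMeasure ν] (A : Set ℤ)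

lemma map_eval_jumpsLaw (i : ℕ) : (jumpsLaw ν).map (fun x => x i) = ν :=
  Measure.infinitePi_map_eval (fun _ : ℕ => ν) i

lemma real_eval_mem (i : ℕ) (s : Set ℤ) : (jumpsLaw ν).real {x | x i ∈ s} = ν.real s := by
  conv_rhs => rw [← map_eval_jumpsLaw ν i]
  rw [map_measureReal_apply (by fun_prop) (MeasurableSet.of_discrete)]
  rfl

/-- The states that the joint walk visits with positive probability. -/
def Reach (u : ℤ × ℤ) : Prop := ∃ k, 0 < (jumpsLaw ν).real {x | state A x k = u}

lemma mul_real_state_le (N k : ℕ) (u v : ℤ × ℤ) :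
    (jumpsLaw ν).real {x | state A x N = u} * (jumpsLaw ν).real {x | state A x k = v} ≤
      (jumpsLaw ν).real {x | state A x (N + k) = u + v} := by
  refine mul_le_real_of_concat ν N (measurableSet_state_eq A _ _) (measurableSet_state_eq A _ _)
    measureReal_nonneg (ae_of_all _ fun y hy => le_of_eq ?_)
  have hy' : state A y N = u := hy
  congr 1
  ext z
  simp [state_concat, hy']

lemma pow_real_state_le (k : ℕ) (u : ℤ × ℤ) (s : ℕ) :
    (jumpsLaw ν).real {x | state A x k = u} ^ s ≤
      (jumpsLaw ν).real {x | state A x (s * k) = s • u} := by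
  induction s with
  | zero => simp [state]
  | succ s ih =>
    rw [pow_succ, Nat.succ_mul, succ_nsmul]
    exact (mul_le_mul_of_nonneg_right ih measureReal_nonneg).trans (mul_real_state_le ν A _ _ _ _)

variable {ν A}

lemma Reach.zero : Reach ν A 0 := ⟨0, by simp [state]⟩

lemma Reach.add {u v : ℤ × ℤ} (hu : Reach ν A u) (hv : Reach ν A v) : Reach ν A (u + v) := by
  obtain ⟨k, hk⟩ := hu
  obtain ⟨l, hl⟩ := hv
  exact ⟨k + l, (mul_pos hk hl).trans_le (mul_real_state_le ν A _ _ _ _)⟩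

lemma Reach.nsmul {u : ℤ × ℤ} (hu : Reach ν A u) (s : ℕ) : Reach ν A (s • u) := by
  obtain ⟨k, hk⟩ := hu
  exact ⟨s * k, (pow_pos hk s).trans_le (pow_real_state_le ν A _ _ _)⟩

lemma real_singleton_pos {k : ℤ} (hk : ν {k} ≠ 0) : 0 < ν.real {k} :=
  ENNReal.toReal_pos hk (measure_ne_top _ _)

lemma real_le_real_state_one (k : ℤ) :
    ν.real {k} ≤ (jumpsLaw ν).real {x | state A x 1 = step A k} := by
  rw [← real_eval_mem ν 0]
  refine measureReal_mono (fun x hx => ?_) (measure_ne_top _ _)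
  have : x 0 = k := hx
  simp [state, this]

lemma Reach.step {k : ℤ} (hk : ν {k} ≠ 0) : Reach ν A (step A k) :=
  ⟨1, (real_singleton_pos hk).trans_le (real_le_real_state_one k)⟩

lemma exists_of_real_state_succ_pos {k : ℕ} {u : ℤ × ℤ}
    (h : 0 < (jumpsLaw ν).real {x | state A x (k + 1) = u}) :
    ∃ j, ν {j} ≠ 0 ∧ 0 < (jumpsLaw ν).real {x | state A x k = u - LukaPath.step A j} := by
  by_contra! hcon
  refine h.ne' ?_
  rw [measureReal_eq_zero_iff (measure_ne_top _ _)]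
  have hsub : {x | state A x (k + 1) = u} ⊆
      ⋃ j : ℤ, ({x | x k = j} ∩ {x | state A x k = u - LukaPath.step A j}) := by
    intro x hx
    refine Set.mem_iUnion.2 ⟨x k, rfl, ?_⟩
    have hx' : state A x (k + 1) = u := hx
    rw [state, Finset.sum_range_succ, ← state] at hx'
    exact eq_sub_of_add_eq hx'
  refine measure_mono_null hsub (measure_iUnion_null fun j => ?_)
  by_cases hj : ν {j} = 0
  · refine measure_mono_null Set.inter_subset_left ?_
    rw [← measureReal_eq_zero_iff (measure_ne_top _ _)]
    have := real_eval_mem ν k {j}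
    simp only [Set.mem_singleton_iff] at this
    rw [this, measureReal_eq_zero_iff (measure_ne_top _ _), hj]
  · refine measure_mono_null Set.inter_subset_right ?_
    rw [← measureReal_eq_zero_iff (measure_ne_top _ _)]
    exact le_antisymm (hcon j hj) measureReal_nonneg

-- The state space is countable, so the unreachable states form a null set together.
variable (ν A) in
lemma ae_reach (N : ℕ) : ∀ᵐ y ∂(jumpsLaw ν), Reach ν A (state A y N) := by
  rw [ae_iff]
  have hsub : {y | ¬ Reach ν A (state A y N)} ⊆
      ⋃ u : {u : ℤ × ℤ // ¬ Reach ν A u}, {y | state A y N = u} :=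
    fun y hy => Set.mem_iUnion.2 ⟨⟨_, hy⟩, rfl⟩
  refine measure_mono_null hsub (measure_iUnion_null fun u => ?_)
  rw [← measureReal_eq_zero_iff (measure_ne_top _ _)]
  by_contra hne
  exact u.2 ⟨N, lt_of_le_of_ne measureReal_nonneg (Ne.symm hne)⟩

lemma IsCentredJumpLaw.neg_one_le (hν : IsCentredJumpLaw ν) {k : ℤ} (hk : ν {k} ≠ 0) :
    -1 ≤ k := by
  by_contra! h
  exact hk (measure_mono_null (Set.singleton_subset_iff.2 h) hν.support)

lemma IsCentredJumpLaw.ae_neg_one_le (hν : IsCentredJumpLaw ν) : ∀ᵐ k ∂ν, -1 ≤ k := by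
  rw [ae_iff]
  refine measure_mono_null (fun k hk => ?_) hν.support
  simpa using hk

lemma exists_mem_of_measure_ne_zero {s : Set ℤ} (hs : ν s ≠ 0) : ∃ k ∈ s, ν {k} ≠ 0 := by
  by_contra! h
  refine hs ?_
  rw [← Set.biUnion_of_singleton s]
  exact (measure_biUnion_null_iff s.to_countable).2 h

/-- Otherwise the jump is nonpositive with mean zero, hence almost surely zero, against the mass at
`-1`. -/
lemma IsCentredJumpLaw.exists_one_le (hν : IsCentredJumpLaw ν) : ∃ k : ℤ, 1 ≤ k ∧ ν {k} ≠ 0 := by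
  refine exists_mem_of_measure_ne_zero (s := Set.Ici 1) fun h0 => hν.charges ?_
  have hle : ∀ᵐ k : ℤ ∂ν, 0 ≤ -(k : ℝ) := by
    rw [ae_iff]
    refine measure_mono_null (fun k hk => ?_) h0
    simp only [Left.nonneg_neg_iff, Int.cast_nonpos, not_le, Set.mem_ofPred_eq] at hk
    exact hk
  have := (integral_eq_zero_iff_of_nonneg_ae hle hν.integrable.neg).1
    (by rw [integral_neg, hν.mean_zero, neg_zero])
  rw [Filter.EventuallyEq, ae_iff] at this
  refine measure_mono_null (fun k hk => ?_) this
  have hk' : k = -1 := hk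
  simp [hk']

/-- Completing a possible jump to a reachable state with position zero. -/
lemma IsCentredJumpLaw.exists_reach_complement (hν : IsCentredJumpLaw ν) {j : ℤ} (hj : ν {j} ≠ 0) :
    ∃ w, Reach ν A w ∧ ∃ i : ℕ, LukaPath.step A j + w = (0, (i : ℤ)) := by
  have key : ∀ w : ℤ × ℤ, 0 ≤ w.2 → (LukaPath.step A j + w).1 = 0 →
      ∃ i : ℕ, LukaPath.step A j + w = (0, (i : ℤ)) := by
    intro w hw h1
    have : 0 ≤ (LukaPath.step A j + w).2 := add_nonneg (indicator_one_nonneg A j) hw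
    exact ⟨(LukaPath.step A j + w).2.toNat, by rw [Int.toNat_of_nonneg this, ← h1]⟩
  -- A jump `j ≥ 0` is undone by `j` jumps `-1`; a jump `-1` is undone by one jump `k ≥ 1` and `k -
  -- 1` jumps `-1`.
  rcases lt_or_eq_of_le (hν.neg_one_le hj) with h | h
  · refine ⟨j.toNat • LukaPath.step A (-1), (Reach.step hν.charges).nsmul _, key _ ?_ ?_⟩
    · simp only [LukaPath.step, Prod.smul_snd]
      exact nsmul_nonneg (indicator_one_nonneg A _) _
    · simp only [LukaPath.step, Prod.smul_fst, Prod.fst_add]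
      simp only [nsmul_eq_mul]
      rw [Int.toNat_of_nonneg (by omega)]
      ring
  · obtain ⟨k, hk, hk0⟩ := hν.exists_one_le
    refine ⟨(k - 1).toNat • LukaPath.step A (-1) + LukaPath.step A k,
      ((Reach.step hν.charges).nsmul _).add (Reach.step hk0), key _ ?_ ?_⟩
    · simp only [LukaPath.step, Prod.smul_snd, Prod.snd_add]
      exact add_nonneg (nsmul_nonneg (indicator_one_nonneg A _) _) (indicator_one_nonneg A _)
    · simp only [LukaPath.step, Prod.smul_fst, Prod.fst_add]
      simp only [nsmul_eq_mul]
      rw [Int.toNat_of_nonneg (by omega), ← h]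
      ring

/-- Close up a jump of `A` to a displacement of height zero: the count of that loop is at least one.
-/
lemma IsCentredJumpLaw.exists_reach_vertical (hν : IsCentredJumpLaw ν) (hA : 0 < ν A) :
    ∃ q : ℕ, 1 ≤ q ∧ Reach ν A (0, (q : ℤ)) := by
  obtain ⟨a, haA, ha⟩ := exists_mem_of_measure_ne_zero hA.ne'
  obtain ⟨w, hw, i, hi⟩ := hν.exists_reach_complement (A := A) ha
  refine ⟨i, ?_, hi ▸ (Reach.step ha).add hw⟩
  obtain ⟨k, hk⟩ := hw
  have h2 : 0 ≤ w.2 := by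
    by_contra! hneg
    refine hk.ne' ?_
    have : {x | state A x k = w} = ∅ := by
      refine Set.eq_empty_of_forall_notMem fun x hx => ?_
      have hx' : state A x k = w := hx
      have := state_snd_nonneg A x k
      rw [hx'] at this
      omega
    rw [this, measureReal_empty]
  have := congrArg Prod.snd hi
  simp only [LukaPath.step, Prod.snd_add, Set.indicator_of_mem haA, Pi.one_apply] at this
  omega

/-- Every jump can be completed to a vertical displacement, so reachable states are invertible
modulo the period `(0, q)`. -/
lemma IsCentredJumpLaw.exists_reach_neg (hν : IsCentredJumpLaw ν) {q : ℕ} (hq : 1 ≤ q)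
    {u : ℤ × ℤ} (hu : Reach ν A u) :
    ∃ s : ℕ, Reach ν A (s • ((0 : ℤ), (q : ℤ)) - u) := by
  obtain ⟨k, hk⟩ := hu
  induction k generalizing u with
  | zero =>
    have : u = 0 := by
      by_contra hne
      refine hk.ne' ?_
      simp [state, Ne.symm hne]
    exact ⟨0, by simpa [this] using Reach.zero⟩
  | succ k ih =>
    obtain ⟨j, hj, hj'⟩ := exists_of_real_state_succ_pos hk
    obtain ⟨s, hs⟩ := ih hj'
    obtain ⟨w, hw, i, hi⟩ := hν.exists_reach_complement (A := A) hj
    refine ⟨s + i, ?_⟩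
    have hvert : Reach ν A (0, (i : ℤ)) := hi ▸ (Reach.step hj).add hw
    -- The completed jump is `(0, i)`, where `i` need not be a multiple of `q`; `q - 1` extra copies
    -- of it make the total `i • (0, q)`.
    have := (hs.add hw).add (hvert.nsmul (q - 1))
    convert this using 1
    have hw' : w = (0, (i : ℤ)) - LukaPath.step A j := by rw [← hi]; abel
    rw [hw']
    ext
    · simp only [Prod.fst_sub, Prod.fst_add, Prod.smul_fst, smul_zero]
      ring
    · simp only [Prod.snd_sub, Prod.snd_add, Prod.smul_snd]
      simp only [nsmul_eq_mul]
      push_cast [Nat.cast_sub hq]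
      ring

variable (ν A) in
/-- The states that become reachable after adding a multiple of the vertical period `(0, q)`. -/
def Lat (q : ℕ) (u : ℤ × ℤ) : Prop := ∃ s : ℕ, Reach ν A (u + s • ((0 : ℤ), (q : ℤ)))

lemma Reach.lat {q : ℕ} {u : ℤ × ℤ} (hu : Reach ν A u) : Lat ν A q u := ⟨0, by simpa using hu⟩

/-- This is what lets the recursions restart: the remaining displacement after any visited state is
still compatible with the lattice. -/
lemma Lat.sub (hν : IsCentredJumpLaw ν) {q : ℕ} (hq : 1 ≤ q) {u v : ℤ × ℤ} (hu : Lat ν A q u)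
    (hv : Reach ν A v) : Lat ν A q (u - v) := by
  obtain ⟨s, hs⟩ := hu
  obtain ⟨t, ht⟩ := hν.exists_reach_neg hq hv
  refine ⟨s + t, ?_⟩
  convert hs.add ht using 1
  rw [add_nsmul]
  abel

/-- Only finitely many pairs `(e, r)` occur, so a single `T` bounds the added periods, the time and
the inverse probability. -/
lemma exists_uniform_reach (q D : ℕ) :
    ∃ T : ℕ, ∀ e : ℤ, |e| ≤ D → ∀ r : ℕ, r < q → Lat ν A q (e, r) →
      ∃ s ≤ T, ∃ k ≤ T,
        1 / ((T : ℝ) + 1) ≤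
          (jumpsLaw ν).real {x | state A x k = (e, (r : ℤ)) + s • ((0 : ℤ), (q : ℤ))} := by
  have h : ∀ p ∈ (Finset.Icc (-(D : ℤ)) D) ×ˢ (Finset.range q), ∀ᶠ T : ℕ in atTop,
      Lat ν A q (p.1, (p.2 : ℤ)) → ∃ s ≤ T, ∃ k ≤ T, 1 / ((T : ℝ) + 1) ≤
        (jumpsLaw ν).real {x | state A x k = (p.1, (p.2 : ℤ)) + s • ((0 : ℤ), (q : ℤ))} := by
    intro p _
    by_cases hp : Lat ν A q (p.1, (p.2 : ℤ))
    · obtain ⟨s, k, hk⟩ := hp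
      have hlim := tendsto_one_div_add_atTop_nhds_zero_nat (𝕜 := ℝ)
      filter_upwards [hlim.eventually (gt_mem_nhds hk), eventually_ge_atTop s,
        eventually_ge_atTop k] with T h1 h2 h3 _
      exact ⟨s, h2, k, h3, h1.le⟩
    · exact Eventually.of_forall fun T h => absurd h hp
  obtain ⟨T, hT⟩ := ((Filter.eventually_all_finset _).2 h).exists
  refine ⟨T, fun e he r hr hl => hT (e, r) ?_ hl⟩
  rw [Finset.mem_product, Finset.mem_Icc, Finset.mem_range]
  exact ⟨abs_le.1 he, hr⟩

/-- Lattice points at bounded height are reached with at worst exponentially small probability. -/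
lemma exists_pow_le_green {q : ℕ} (hq : 1 ≤ q) (hr : Reach ν A (0, (q : ℤ))) (D : ℕ) :
    ∃ (k₀ M₀ : ℕ) (p : ℝ), 0 < p ∧ p ≤ 1 ∧ ∀ i : ℕ, k₀ ≤ i → ∀ e : ℤ, |e| ≤ D →
      Lat ν A q (e, i) → p ^ i ≤ green ν A (M₀ * (i + 1)) (e, i) := by
  obtain ⟨T, hT⟩ := exists_uniform_reach (ν := ν) (A := A) q D
  obtain ⟨l, hl⟩ := hr
  set w := (jumpsLaw ν).real {x | state A x l = (0, (q : ℤ))} with hw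
  have hw1 : w ≤ 1 := measureReal_le_one
  have hT0 : 0 < 1 / ((T : ℝ) + 1) := by positivity
  have hT1 : 1 / ((T : ℝ) + 1) ≤ 1 := by
    rw [div_le_one (by positivity)]
    linarith [(Nat.cast_nonneg T : (0 : ℝ) ≤ T)]
  refine ⟨T * q + 1, T + l + 1, 1 / ((T : ℝ) + 1) * w, mul_pos hT0 hl,
    mul_le_one₀ hT1 hl.le hw1, fun i hi e he hlat => ?_⟩
  -- Reach `(e, r + s q)` with `s ≤ T` at bounded cost, then add `t - s` vertical loops. The
  -- threshold `T * q + 1` on `i` ensures `s ≤ t`.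
  obtain ⟨t, r, hrq, rfl⟩ : ∃ t r, r < q ∧ i = r + t * q :=
    ⟨i / q, i % q, Nat.mod_lt _ hq, by rw [mul_comm, Nat.mod_add_div]⟩
  have hlat' : Lat ν A q (e, (r : ℤ)) := by
    obtain ⟨s, hs⟩ := hlat
    refine ⟨s + t, ?_⟩
    convert hs using 1
    ext
    · simp
    · simp
      ring
  obtain ⟨s, hsT, k, hkT, hk⟩ := hT e he r hrq hlat'
  have hst : s ≤ t := by
    by_contra! hlt
    nlinarith [Nat.mul_le_mul_right q (show t + 1 ≤ T by omega)]
  have h1 := mul_real_state_le ν A k ((t - s) * l) ((e, (r : ℤ)) + s • ((0 : ℤ), (q : ℤ)))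
    ((t - s) • ((0 : ℤ), (q : ℤ)))
  have h2 : (e, (r : ℤ)) + s • ((0 : ℤ), (q : ℤ)) + (t - s) • ((0 : ℤ), (q : ℤ)) =
      (e, ((r + t * q : ℕ) : ℤ)) := by
    ext
    · simp
    · simp
      push_cast [Nat.cast_sub hst]
      ring
  rw [h2] at h1
  have hti : t ≤ r + t * q := by nlinarith
  have hk1 : k + (t - s) * l < (T + l + 1) * (r + t * q + 1) := by
    have : (t - s) * l ≤ (r + t * q) * l := Nat.mul_le_mul_right l (by omega)
    nlinarith
  refine le_trans ?_ (real_le_green ν A hk1 _)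
  refine le_trans ?_ h1
  have h3 := pow_real_state_le ν A l (0, (q : ℤ)) (t - s)
  rw [mul_pow]
  refine mul_le_mul ?_ ?_ (pow_nonneg hl.le _) measureReal_nonneg
  · exact (pow_le_of_le_one hT0.le hT1 (by omega)).trans hk
  · exact (pow_le_pow_of_le_one hl.le hw1 (by omega)).trans h3

end Reach

/-! ### Concentration and fluctuations of the walk -/

section Fluctuations

set_option linter.unusedSectionVars false

variable (ν : Measure ℤ) [IsProbabilityMeasure ν]

lemma iIndepFun_comp_eval {E : Type*} [MeasurableSpace E] (f : ℤ → E) :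
    iIndepFun (fun (i : ℕ) (x : ℕ → ℤ) => f (x i)) (jumpsLaw ν) :=
  iIndepFun_infinitePi (X := fun _ : ℕ => f) fun _ => measurable_of_countable f

lemma identDistrib_comp_eval {E : Type*} [MeasurableSpace E] (f : ℤ → E) (i j : ℕ) :
    IdentDistrib (fun x : ℕ → ℤ => f (x i)) (fun x => f (x j)) (jumpsLaw ν) (jumpsLaw ν) where
  aemeasurable_fst := ((measurable_of_countable f).comp (measurable_pi_apply i)).aemeasurable
  aemeasurable_snd := ((measurable_of_countable f).comp (measurable_pi_apply j)).aemeasurable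
  map_eq := by
    have h : ∀ i : ℕ, (jumpsLaw ν).map (fun x : ℕ → ℤ => f (x i)) = ν.map f := fun i => by
      conv_rhs => rw [← map_eval_jumpsLaw ν i]
      rw [Measure.map_map (measurable_of_countable f) (measurable_pi_apply i)]
      rfl
    rw [h, h]

lemma integral_comp_eval (f : ℤ → ℝ) (i : ℕ) :
    ∫ x, f (x i) ∂(jumpsLaw ν) = ∫ k, f k ∂ν := by
  conv_rhs => rw [← map_eval_jumpsLaw ν i]
  rw [integral_map (measurable_pi_apply i).aemeasurable
    (measurable_of_countable f).aestronglyMeasurable]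

lemma integrable_comp_eval {f : ℤ → ℝ} (hf : Integrable f ν) (i : ℕ) :
    Integrable (fun x : ℕ → ℤ => f (x i)) (jumpsLaw ν) := by
  rw [← map_eval_jumpsLaw ν i] at hf
  exact hf.comp_measurable (measurable_pi_apply i)

lemma hoeffding {f : ℤ → ℝ} {lo hi : ℝ} (hf : ∀ k, f k ∈ Set.Icc lo hi) (N : ℕ) {t : ℝ}
    (ht : 0 ≤ t) :
    (jumpsLaw ν).real {x | t ≤ ∑ i ∈ Finset.range N, (f (x i) - ∫ k, f k ∂ν)} ≤
      Real.exp (-t ^ 2 / (2 * N * ((hi - lo) / 2) ^ 2)) := by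
  have hindep := iIndepFun_comp_eval ν (fun k => f k - ∫ k, f k ∂ν)
  have hsub : ∀ i < N, HasSubgaussianMGF (fun x : ℕ → ℤ => f (x i) - ∫ k, f k ∂ν)
      ((‖hi - lo‖₊ / 2) ^ 2) (jumpsLaw ν) := by
    intro i _
    have := hasSubgaussianMGF_of_mem_Icc (μ := jumpsLaw ν) (X := fun x : ℕ → ℤ => f (x i))
      ((measurable_of_countable f).comp (measurable_pi_apply i)).aemeasurable
      (ae_of_all _ fun x => hf (x i))
    rwa [integral_comp_eval] at this
  have := HasSubgaussianMGF.measure_sum_range_ge_le_of_iIndepFun hindep hsub ht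
  refine this.trans_eq ?_
  congr 2
  simp [div_pow]

lemma integral_indicator_one (A : Set ℤ) :
    ∫ k, A.indicator (1 : ℤ → ℝ) k ∂ν = ν.real A :=
  MeasureTheory.integral_indicator_one MeasurableSet.of_discrete

lemma cast_state_snd (A : Set ℤ) (x : ℕ → ℤ) (N : ℕ) :
    ((state A x N).2 : ℝ) = ∑ i ∈ Finset.range N, A.indicator (1 : ℤ → ℝ) (x i) := by
  rw [state_snd]
  push_cast
  refine Finset.sum_congr rfl fun i _ => ?_
  by_cases h : x i ∈ A <;> simp [h]

/-- Hoeffding with deviation equal to half of the mean. -/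
lemma real_state_snd_le (A : Set ℤ) (N : ℕ) :
    (jumpsLaw ν).real {x | ((state A x N).2 : ℝ) ≤ ν.real A * N / 2} ≤
      Real.exp (-(ν.real A ^ 2 * N / 2)) := by
  have h := hoeffding ν (f := fun k => -A.indicator (1 : ℤ → ℝ) k) (lo := -1) (hi := 0)
    (fun k => by by_cases h : k ∈ A <;> simp [h]) N (t := ν.real A * N / 2)
    (by positivity)
  rw [integral_neg, integral_indicator_one] at h
  refine (le_of_eq ?_).trans (h.trans (Real.exp_le_exp.2 (le_of_eq ?_)))
  · congr 1
    ext x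
    simp only [Set.mem_ofPred_eq, cast_state_snd, Finset.sum_sub_distrib, Finset.sum_neg_distrib,
      Finset.sum_const, Finset.card_range, nsmul_eq_mul]
    constructor <;> intro h <;> linarith
  · rcases Nat.eq_zero_or_pos N with rfl | hN
    · simp
    · field_simp
      norm_num

variable {ν}

lemma cast_walk (x : ℕ → ℤ) (n : ℕ) : (walk x n : ℝ) = ∑ i ∈ Finset.range n, (x i : ℝ) := by
  simp [walk]

lemma IsCentredJumpLaw.integrable_walk (hν : IsCentredJumpLaw ν) (n : ℕ) :
    Integrable (fun x => (walk x n : ℝ)) (jumpsLaw ν) := by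
  simp only [cast_walk]
  exact integrable_finsetSum _ fun i _ => integrable_comp_eval ν hν.integrable i

lemma IsCentredJumpLaw.integral_walk (hν : IsCentredJumpLaw ν) (n : ℕ) :
    ∫ x, (walk x n : ℝ) ∂(jumpsLaw ν) = 0 := by
  simp only [cast_walk]
  rw [integral_finsetSum _ fun i _ => integrable_comp_eval ν hν.integrable i]
  refine Finset.sum_eq_zero fun i _ => ?_
  rw [integral_comp_eval ν (fun k => (k : ℝ)), hν.mean_zero]

lemma IsCentredJumpLaw.ae_forall_neg_one_le (hν : IsCentredJumpLaw ν) :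
    ∀ᵐ x ∂(jumpsLaw ν), ∀ i, -1 ≤ x i := by
  refine ae_all_iff.2 fun i => ?_
  have := hν.ae_neg_one_le
  rw [← map_eval_jumpsLaw ν i] at this
  exact ae_of_ae_map (measurable_pi_apply i).aemeasurable this

lemma neg_le_walk {x : ℕ → ℤ} (hx : ∀ i, -1 ≤ x i) (n : ℕ) : -(n : ℤ) ≤ walk x n := by
  have := Finset.sum_le_sum (s := Finset.range n) fun i _ => hx i
  simpa [walk] using this

lemma walk_add_le {x : ℕ → ℤ} (hx : ∀ i, -1 ≤ x i) (n k : ℕ) :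
    walk x n ≤ walk x (n + k) + k := by
  have := neg_le_walk (x := fun i => x (n + i)) (fun i => hx _) k
  rw [walk, walk, Finset.sum_range_add]
  rw [walk] at this
  linarith

/-- A centred walk with jumps at least `-1` is nonpositive with polynomially large probability. -/
lemma IsCentredJumpLaw.le_real_walk_nonpos (hν : IsCentredJumpLaw ν) (n : ℕ) :
    1 / ((n : ℝ) + 1) ≤ (jumpsLaw ν).real {x | walk x n ≤ 0} := by
  have hm : MeasurableSet {x : ℕ → ℤ | walk x n ≤ 0} :=
    measurable_walk n (MeasurableSet.of_discrete (s := Set.Iic 0))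
  have hint : Integrable (fun x => {x : ℕ → ℤ | walk x n ≤ 0}.indicator (1 : (ℕ → ℤ) → ℝ) x)
      (jumpsLaw ν) := (integrable_const (1 : ℝ)).indicator hm
  -- By integrality `S_n ≥ 1` off the event, and `S_n ≥ -n` on it, so `1 - (n + 1) 1{S_n ≤ 0} ≤ S_n`
  -- almost surely; the right side has mean zero.
  have h1 : ∫ x, (1 - ((n : ℝ) + 1) * {x : ℕ → ℤ | walk x n ≤ 0}.indicator 1 x) ∂(jumpsLaw ν) ≤
      ∫ x, (walk x n : ℝ) ∂(jumpsLaw ν) := by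
    refine integral_mono_ae ?_ (hν.integrable_walk n) ?_
    · exact (integrable_const _).sub (hint.const_mul _)
    · filter_upwards [hν.ae_forall_neg_one_le] with x hx
      by_cases hw : walk x n ≤ 0
      · have : (-(n : ℝ)) ≤ walk x n := by exact_mod_cast neg_le_walk hx n
        simpa [hw] using this
      · have : (1 : ℝ) ≤ walk x n := by
          have : 1 ≤ walk x n := by omega
          exact_mod_cast this
        simpa [hw] using this
  rw [hν.integral_walk, integral_sub (integrable_const _) (hint.const_mul _), integral_const_mul,
    MeasureTheory.integral_indicator_one hm] at h1
  simp only [integral_const, probReal_univ, smul_eq_mul, mul_one] at h1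
  rw [div_le_iff₀ (by positivity)]
  linarith

/-- Lower semicontinuity of the mass of open sets under convergence in distribution. -/
lemma eventually_lt_real_of_tendstoInDistribution {Ω : Type*} [MeasurableSpace Ω]
    {P : Measure Ω} [IsProbabilityMeasure P] {μ : Measure ℝ} [IsProbabilityMeasure μ]
    {X : ℕ → Ω → ℝ}
    (h : TendstoInDistribution X atTop (id : ℝ → ℝ) (fun _ => P) μ) {G : Set ℝ} (hG : IsOpen G)
    {c : ℝ} (hc : c < μ.real G) : ∀ᶠ n in atTop, c < P.real {ω | X n ω ∈ G} := by
  rcases lt_or_ge c 0 with h0 | h0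
  · exact Eventually.of_forall fun n => h0.trans_le measureReal_nonneg
  have h1 := ProbabilityMeasure.le_liminf_measure_open_of_tendsto h.tendsto hG
  have h2 : ENNReal.ofReal c < μ G := by
    rw [← ofReal_measureReal (measure_ne_top μ G)]
    exact (ENNReal.ofReal_lt_ofReal_iff_of_nonneg h0).2 hc
  simp only [ProbabilityMeasure.coe_mk, Measure.map_id] at h1
  filter_upwards [eventually_lt_of_lt_liminf (h2.trans_le h1)] with n hn
  rw [Measure.map_apply_of_aemeasurable (h.forall_aemeasurable n) hG.measurableSet] at hn
  exact (ENNReal.ofReal_lt_iff_lt_toReal h0 (measure_ne_top _ _)).1 hn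

lemma IsCentredJumpLaw.variance_pos (hν : IsCentredJumpLaw ν) (h2 : FiniteVariance ν) :
    0 < Var[fun k : ℤ => (k : ℝ); ν] := by
  refine lt_of_le_of_ne (variance_nonneg _ _) fun h0 => hν.charges ?_
  have := ae_eq_integral_of_variance_eq_zero h2 h0.symm
  rw [hν.mean_zero, ae_iff] at this
  refine measure_mono_null (fun k hk => ?_) this
  have hk' : k = -1 := hk
  simp [hk']

lemma variance_comp_eval (f : ℤ → ℝ) (i : ℕ) :
    Var[fun x : ℕ → ℤ => f (x i); jumpsLaw ν] = Var[f; ν] := by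
  conv_rhs => rw [← map_eval_jumpsLaw ν i]
  rw [variance_map (measurable_of_countable f).aestronglyMeasurable.aemeasurable
    (measurable_pi_apply i).aemeasurable]
  rfl

lemma FiniteVariance.memLp_eval (h2 : FiniteVariance ν) (i : ℕ) :
    MemLp (fun x : ℕ → ℤ => (x i : ℝ)) 2 (jumpsLaw ν) := by
  rw [FiniteVariance, ← map_eval_jumpsLaw ν i] at h2
  exact h2.comp_of_map (measurable_pi_apply i).aemeasurable

/-- The central limit theorem for the walk. -/
lemma IsCentredJumpLaw.tendstoInDistribution_gaussian (hν : IsCentredJumpLaw ν)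
    (h2 : FiniteVariance ν) :
    TendstoInDistribution (fun (n : ℕ) (x : ℕ → ℤ) => (√(n : ℝ))⁻¹ * (walk x n : ℝ)) atTop
      (id : ℝ → ℝ) (fun _ => jumpsLaw ν)
      (gaussianReal 0 Var[fun k : ℤ => (k : ℝ); ν].toNNReal) := by
  have h := tendstoInDistribution_inv_sqrt_mul_sum_sub (P := jumpsLaw ν)
    (P' := gaussianReal 0 Var[fun k : ℤ => (k : ℝ); ν].toNNReal) (Y := id)
    (X := fun (i : ℕ) (x : ℕ → ℤ) => (x i : ℝ))
    ⟨aemeasurable_id, by rw [Measure.map_id, variance_comp_eval (fun k : ℤ => (k : ℝ))]⟩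
    (h2.memLp_eval 0) (iIndepFun_comp_eval ν _)
    (fun i => identDistrib_comp_eval ν (fun k : ℤ => (k : ℝ)) i 0)
  simpa only [integral_comp_eval ν (fun k : ℤ => (k : ℝ)), hν.mean_zero, mul_zero, sub_zero,
    ← cast_walk] using h

/-- Uniform lower bound for the walk to be at a prescribed place at the diffusive scale. -/
lemma IsCentredJumpLaw.exists_le_real_abs_walk_sub_le (hν : IsCentredJumpLaw ν)
    (h2 : FiniteVariance ν) {C : ℝ} (hC : 0 < C) :
    ∃ q : ℝ, 0 < q ∧ ∀ᶠ L : ℕ in atTop, ∀ e : ℝ, |e| ≤ 2 * C * √L →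
      q ≤ (jumpsLaw ν).real {x | |(walk x L : ℝ) - e| ≤ C * √L} := by
  set μ := gaussianReal 0 Var[fun k : ℤ => (k : ℝ); ν].toNNReal with hμ
  have hv : Var[fun k : ℤ => (k : ℝ); ν].toNNReal ≠ 0 :=
    (Real.toNNReal_pos.2 (hν.variance_pos h2)).ne'
  -- The nine intervals with `|j| ≤ 4` cover `[-2C, 2C]`. The one centred nearest to `e/√L` lies
  -- within distance `3C/4` of it, and the Gaussian law charges all nine.
  set G : ℤ → Set ℝ := fun j => Set.Ioo (j * (C / 2) - C / 2) (j * (C / 2) + C / 2) with hG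
  have hpos : ∀ j, 0 < μ.real (G j) := by
    intro j
    refine ENNReal.toReal_pos (fun h0 => ?_) (measure_ne_top _ _)
    have := gaussianReal_absolutelyContinuous' 0 hv h0
    rw [Real.volume_Ioo] at this
    simp only [ENNReal.ofReal_eq_zero] at this
    linarith
  have hne : (Finset.Icc (-4 : ℤ) 4).Nonempty := ⟨0, by simp⟩
  obtain ⟨j₀, -, hj₀⟩ := Finset.exists_min_image (Finset.Icc (-4 : ℤ) 4) (fun j => μ.real (G j)) hne
  refine ⟨μ.real (G j₀) / 2, half_pos (hpos _), ?_⟩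
  have hev : ∀ j ∈ Finset.Icc (-4 : ℤ) 4, ∀ᶠ L : ℕ in atTop, μ.real (G j₀) / 2 <
      (jumpsLaw ν).real {x | (√(L : ℝ))⁻¹ * (walk x L : ℝ) ∈ G j} := fun j hj =>
    eventually_lt_real_of_tendstoInDistribution (hν.tendstoInDistribution_gaussian h2)
      isOpen_Ioo ((half_lt_self (hpos j₀)).trans_le (hj₀ j hj))
  filter_upwards [(Filter.eventually_all_finset _).2 hev, eventually_ge_atTop 1] with L hL hL1 e he
  have hs : 0 < √(L : ℝ) := Real.sqrt_pos.2 (by exact_mod_cast hL1)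
  set y := e / √(L : ℝ) / (C / 2) with hy
  have hey : e = y * (C / 2) * √L := by
    rw [hy]
    field_simp
  have hy4 : |y| ≤ 4 := by
    rw [hy, abs_div, abs_div, abs_of_pos hs, abs_of_pos (half_pos hC), div_div,
      div_le_iff₀ (by positivity)]
    linarith
  have hround := abs_le.1 (abs_sub_round y)
  have hy4' := abs_le.1 hy4
  have hj : round y ∈ Finset.Icc (-4 : ℤ) 4 := by
    have h1 : (round y : ℝ) < 5 := by linarith
    have h2 : (-5 : ℝ) < round y := by linarith
    have h1' : round y < 5 := by exact_mod_cast h1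
    have h2' : -5 < round y := by exact_mod_cast h2
    rw [Finset.mem_Icc]
    omega
  refine (hL _ hj).le.trans (measureReal_mono (fun x hx => ?_) (measure_ne_top _ _))
  have hx' : (√(L : ℝ))⁻¹ * (walk x L : ℝ) ∈ G (round y) := hx
  have hw : (walk x L : ℝ) = ((√(L : ℝ))⁻¹ * (walk x L : ℝ)) * √L := by field_simp
  simp only [Set.mem_ofPred_eq]
  rw [hw, hey, ← sub_mul, abs_mul, abs_of_pos hs]
  refine mul_le_mul_of_nonneg_right ?_ hs.le
  rw [abs_le]
  constructor <;> nlinarith [hx'.1, hx'.2]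

end Fluctuations

/-! ### Lower bounds for the Green function: finite variance -/

section FiniteVariance

variable {ν : Measure ℤ} [IsProbabilityMeasure ν] {A : Set ℤ}

lemma pow_real_singleton_le (j : ℤ) (t : ℕ) :
    ν.real {j} ^ t ≤ (jumpsLaw ν).real {x | state A x t = t • step A j} := by
  have h := pow_real_state_le ν A 1 (step A j) t
  rw [mul_one] at h
  exact (pow_le_pow_left₀ measureReal_nonneg (real_le_real_state_one j) t).trans h

/-- Lattice points in a cone around the vertical axis are reached with at worst exponentially small
probability. -/
lemma IsCentredJumpLaw.exists_pow_le_green_of_cone (hν : IsCentredJumpLaw ν) {q : ℕ} (hq : 1 ≤ q)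
    (hr : Reach ν A (0, (q : ℤ))) :
    ∃ (k₀ M₀ : ℕ) (p : ℝ), 0 < p ∧ p ≤ 1 ∧ ∀ i : ℕ, k₀ ≤ i → ∀ e : ℤ, 2 * |e| ≤ i →
      Lat ν A q (e, i) → p ^ i ≤ green ν A (M₀ * (i + 1)) (e, i) := by
  obtain ⟨k, hk, hk0⟩ := hν.exists_one_le
  obtain ⟨k₀, M₀, p, hp0, hp1, H⟩ := exists_pow_le_green hq hr k.toNat
  set w := min (ν.real {k}) (ν.real {-1}) with hw
  have hw0 : 0 < w := lt_min (real_singleton_pos hk0) (real_singleton_pos hν.charges)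
  have hw1 : w ≤ 1 := (min_le_left _ _).trans measureReal_le_one
  refine ⟨2 * k₀, M₀ + 1, w * p, mul_pos hw0 hp0, mul_le_one₀ hw1 hp0.le hp1,
    fun i hi e he hlat => ?_⟩
  -- Equal jumps `j`, with `j` either `k` or `-1`, cancel `e` up to a remainder of size at most `k`.
  -- At most `|e| ≤ i/2` of them are needed, so the remaining count stays above `k₀`.
  have key : ∀ (j : ℤ) (t : ℕ), ν {j} ≠ 0 → w ≤ ν.real {j} → (t : ℤ) ≤ |e| → |e - t * j| ≤ k →
      (w * p) ^ i ≤ green ν A ((M₀ + 1) * (i + 1)) (e, i) := by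
    intro j t hj hwj ht het
    have hti : 2 * t ≤ i := by omega
    have ha0 := indicator_one_nonneg A j
    have ha1 := indicator_one_le_one A j
    obtain ⟨i', hi', hi'2, hi'3⟩ : ∃ i' : ℕ, (i' : ℤ) = i - t * A.indicator (1 : ℤ → ℤ) j ∧
        k₀ ≤ i' ∧ i' ≤ i := by
      refine ⟨((i : ℤ) - t * A.indicator (1 : ℤ → ℤ) j).toNat, ?_, ?_, ?_⟩
      · rw [Int.toNat_of_nonneg]
        nlinarith
      · zify
        rw [Int.toNat_of_nonneg (by nlinarith)]
        nlinarith
      · zify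
        rw [Int.toNat_of_nonneg (by nlinarith)]
        nlinarith
    have hres : ((e, (i : ℤ)) : ℤ × ℤ) - t • step A j = (e - t * j, (i' : ℤ)) := by
      ext
      · simp only [Prod.fst_sub, Prod.smul_fst, step]
        simp
      · simp only [Prod.snd_sub, Prod.smul_snd, step]
        simp [hi']
    have h1 : p ^ i' ≤ green ν A (M₀ * (i' + 1)) (e - t * j, i') := by
      refine H i' hi'2 _ (by rwa [Int.toNat_of_nonneg (by omega)]) ?_
      rw [← hres]
      exact hlat.sub hν hq ((Reach.step hj).nsmul t)
    have h2 := mul_le_green ν A t (M₀ * (i' + 1)) (e, (i : ℤ))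
      (measurableSet_state_eq A t (t • step A j)) (pow_nonneg hp0.le i')
      (ae_of_all _ fun y (hy : state A y t = _) => by rw [hy, hres]; exact h1)
    refine le_trans ?_ (h2.trans (green_mono ν A ?_ _))
    · rw [mul_pow]
      refine mul_le_mul ?_ (pow_le_pow_of_le_one hp0.le hp1 hi'3) (by positivity)
        measureReal_nonneg
      calc w ^ i ≤ w ^ t := pow_le_pow_of_le_one hw0.le hw1 (by omega)
        _ ≤ ν.real {j} ^ t := pow_le_pow_left₀ hw0.le hwj t
        _ ≤ _ := pow_real_singleton_le j t
    · have := Nat.mul_le_mul_left M₀ (show i' + 1 ≤ i + 1 by omega)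
      nlinarith
  rcases le_total 0 e with h0 | h0
  · refine key k (e / k).toNat hk0 (min_le_left _ _) ?_ ?_
    · rw [Int.toNat_of_nonneg (by positivity), abs_of_nonneg h0]
      exact Int.ediv_le_self _ h0
    · rw [Int.toNat_of_nonneg (by positivity), mul_comm, ← Int.emod_def,
        abs_of_nonneg (Int.emod_nonneg _ (by omega))]
      exact (Int.emod_lt_of_pos _ (by omega)).le
  · refine key (-1) (-e).toNat hν.charges (min_le_right _ _) ?_ ?_
    · rw [Int.toNat_of_nonneg (by omega), abs_of_nonpos h0]
    · rw [Int.toNat_of_nonneg (by omega)]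
      simp
      omega

/-- Keep a fixed proportion of a likely event while also having many jumps in `A`. -/
lemma le_real_inter_state_snd {L : ℕ} {F : Set (ℕ → ℤ)} {b : ℝ}
    (hF : 2 * b ≤ (jumpsLaw ν).real F)
    (hb : Real.exp (-(ν.real A ^ 2 * L / 2)) ≤ b) :
    b ≤ (jumpsLaw ν).real (F ∩ {x | ν.real A * L / 2 < ((state A x L).2 : ℝ)}) := by
  have h1 : (jumpsLaw ν).real F ≤
      (jumpsLaw ν).real (F ∩ {x | ν.real A * L / 2 < ((state A x L).2 : ℝ)}) +
      (jumpsLaw ν).real {x | ((state A x L).2 : ℝ) ≤ ν.real A * L / 2} := by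
    refine (measureReal_mono (fun x hx => ?_) (measure_ne_top _ _)).trans
      (measureReal_union_le _ _)
    rcases lt_or_ge (ν.real A * L / 2) ((state A x L).2 : ℝ) with h | h
    · exact Or.inl ⟨hx, h⟩
    · exact Or.inr h
  have := real_state_snd_le ν A L
  linarith

lemma measurableSet_state_snd (A : Set ℤ) (L : ℕ) (b : ℝ) :
    MeasurableSet {x | b < ((state A x L).2 : ℝ)} :=
  (measurable_state A L) (MeasurableSet.of_discrete (s := {u : ℤ × ℤ | b < (u.2 : ℝ)}))

lemma tendsto_exp_neg_mul_nat {a : ℝ} (ha : 0 < a) :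
    Tendsto (fun L : ℕ => Real.exp (-(a * L))) atTop (𝓝 0) :=
  Real.tendsto_exp_neg_atTop_nhds_zero.comp
    (tendsto_natCast_atTop_atTop.const_mul_atTop ha)

/-- Polynomial lower bound for the Green function at the diffusive scale. -/
theorem IsCentredJumpLaw.exists_div_pow_le_green (hν : IsCentredJumpLaw ν) (h2 : FiniteVariance ν)
    {q : ℕ} (hq : 1 ≤ q) (hr : Reach ν A (0, (q : ℤ))) (hA : 0 < ν A) {C : ℝ} (hC : 0 < C) :
    ∃ (i₀ M₀ κ : ℕ) (c : ℝ), 0 < c ∧ ∀ i : ℕ, i₀ ≤ i → ∀ e : ℤ, |(e : ℝ)| ≤ C * √i →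
      Lat ν A q (e, i) → c / (i : ℝ) ^ κ ≤ green ν A (M₀ * (i + 1)) (e, i) := by
  obtain ⟨k₀, M₁, p, hp0, hp1, hbase⟩ := hν.exists_pow_le_green_of_cone hq hr
  obtain ⟨g, hg0, hg⟩ := hν.exists_le_real_abs_walk_sub_le h2 hC
  set a := ν.real A with ha
  have ha0 : 0 < a := ENNReal.toReal_pos hA.ne' (measure_ne_top _ _)
  have ha1 : a ≤ 1 := measureReal_le_one
  have hexp : ∀ᶠ L : ℕ in atTop, Real.exp (-(a ^ 2 * L / 2)) ≤ g / 2 := by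
    have := tendsto_exp_neg_mul_nat (a := a ^ 2 / 2) (by positivity)
    filter_upwards [this.eventually (gt_mem_nhds (half_pos hg0))] with L hL
    refine le_trans (le_of_eq ?_) hL.le
    congr 2
    ring
  obtain ⟨L₀, hL₀⟩ := eventually_atTop.1 (hg.and hexp)
  -- A round costs a factor `g / 2` and multiplies the count by at most `1 - a / 8`; this `κ` lets
  -- the gain in `i ^ (-κ)` pay for the cost.
  obtain ⟨κ, hκ⟩ : ∃ κ : ℕ, (1 - a / 8) ^ κ ≤ g / 2 :=
    (exists_pow_lt_of_lt_one (half_pos hg0) (by linarith)).imp fun _ h => h.le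
  -- heights below `i₁` are handled by the cone estimate
  set i₀ := max (k₀ + 1) (⌈4 * C ^ 2⌉₊) with hi₀
  set i₁ := 2 * (max i₀ L₀ + 2) with hi₁
  -- A round of `L` steps uses `j > a L / 2` of the count, so `L ≤ M₀ j` and the horizon `M₀ (i +
  -- 1)` is respected.
  set M₀ := max M₁ (⌈2 / a⌉₊) with hM₀
  refine ⟨i₀, M₀, κ, p ^ i₁, pow_pos hp0 _, fun i => ?_⟩
  induction i using Nat.strong_induction_on with
  | _ i ih =>
  intro hi e he hlat
  have hik : k₀ + 1 ≤ i := (le_max_left _ _).trans hi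
  have hi1 : (1 : ℝ) ≤ i := by exact_mod_cast (by omega : 1 ≤ i)
  rcases lt_or_ge i i₁ with hlt | hge
  -- Since `i ≥ 4 C²`, the diffusive bound `C √i` is at most `i / 2`.
  · have hcone : 2 * |e| ≤ i := by
      have h4 : 4 * C ^ 2 ≤ i := (Nat.le_ceil _).trans
        (by exact_mod_cast (le_max_right _ _).trans hi)
      have h5 : (2 * C) ≤ √(i : ℝ) := Real.le_sqrt_of_sq_le (by linarith)
      have h6 := Real.mul_self_sqrt (show (0 : ℝ) ≤ i by positivity)
      have h7 : 2 * |(e : ℝ)| ≤ i := by nlinarith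
      exact_mod_cast h7
    have h1 := hbase i (by omega) e hcone hlat
    refine le_trans ?_ (h1.trans (green_mono ν A
      (Nat.mul_le_mul_right _ (le_max_left _ _)) _))
    refine (div_le_self (by positivity) (one_le_pow₀ hi1)).trans ?_
    exact pow_le_pow_of_le_one hp0.le hp1 hlt.le
  -- After `L` steps the height error is at most `C √L`, and the remaining count `i - j` is at least
  -- `L`, so the hypothesis `|e| ≤ C √i` reproduces itself. The inequality `i ≤ 4 L` puts `e` within
  -- the range `2 C √L` of the central limit estimate.
  · set L := i / 2 with hL
    have hL1 : L₀ ≤ L ∧ i₀ ≤ L ∧ 1 ≤ L := by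
      have := le_max_left i₀ L₀
      have := le_max_right i₀ L₀
      omega
    have hL2 : 2 * L ≤ i ∧ i ≤ 4 * L := by omega
    obtain ⟨hg', hexp'⟩ := hL₀ L hL1.1
    have hLi : √(i : ℝ) ≤ 2 * √(L : ℝ) := by
      rw [show (2 : ℝ) = √4 by rw [show (4 : ℝ) = 2 ^ 2 by norm_num]; simp,
        ← Real.sqrt_mul (by norm_num)]
      exact Real.sqrt_le_sqrt (by exact_mod_cast hL2.2)
    have hPF := hg' e (he.trans (by nlinarith))
    have hPE := le_real_inter_state_snd (A := A) (b := g / 2)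
      (F := {x | |(walk x L : ℝ) - e| ≤ C * √L}) (by linarith) hexp'
    set E := {x : ℕ → ℤ | |(walk x L : ℝ) - e| ≤ C * √L} ∩
      {x | a * L / 2 < ((state A x L).2 : ℝ)} with hE
    have hEm : MeasurableSet E := by
      refine MeasurableSet.inter ?_ (measurableSet_state_snd A L _)
      exact (measurable_walk L)
        (MeasurableSet.of_discrete (s := {u : ℤ | |(u : ℝ) - e| ≤ C * √L}))
    have hLR : (1 : ℝ) ≤ L := by exact_mod_cast hL1.2.2
    have hmain := mul_le_green ν A L (M₀ * (i + 1) - L) (e, (i : ℤ)) hEm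
      (h := p ^ i₁ / ((1 - a / 8) * i) ^ κ)
      (by have : 0 < 1 - a / 8 := by linarith
          positivity) ?_
    · rw [Nat.add_sub_cancel'] at hmain
      · refine le_trans ?_ hmain
        rw [mul_pow, ← div_div]
        have h1 : 0 < (1 - a / 8) ^ κ := pow_pos (by linarith) _
        calc p ^ i₁ / (i : ℝ) ^ κ = (1 - a / 8) ^ κ * (p ^ i₁ / (1 - a / 8) ^ κ / (i : ℝ) ^ κ) := by
              rw [div_right_comm, mul_div_cancel₀ _ h1.ne']
          _ ≤ _ := by
              refine mul_le_mul_of_nonneg_right (hκ.trans hPE) (by positivity)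
      · have : 1 ≤ M₀ := by
          have h1 : 1 ≤ ⌈2 / a⌉₊ := Nat.one_le_ceil_iff.2 (by positivity)
          exact h1.trans (le_max_right _ _)
        nlinarith
    · filter_upwards [ae_reach ν A L] with y hy hyE
      obtain ⟨hy1, hy2⟩ := hyE
      have hs0 := state_snd_nonneg A y L
      have hs1 := state_snd_le A y L
      obtain ⟨j, hj⟩ := Int.eq_ofNat_of_zero_le hs0
      have hy2' : a * L / 2 < (j : ℝ) := by
        have : a * L / 2 < ((state A y L).2 : ℝ) := hy2
        rw [hj] at this
        exact_mod_cast this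
      have hj0 : 1 ≤ j := by
        have : (0 : ℝ) < j := lt_of_le_of_lt (by positivity) hy2'
        exact_mod_cast this
      have hjL : j ≤ L := by omega
      have hres : ((e, (i : ℤ)) : ℤ × ℤ) - state A y L = (e - walk y L, ((i - j : ℕ) : ℤ)) := by
        ext
        · simp [state_fst]
        · simp only [Prod.snd_sub, hj]
          push_cast [Nat.cast_sub (show j ≤ i by omega)]
          rfl
      have hih := ih (i - j) (by omega) (by omega) (e - walk y L) ?_ ?_
      · rw [hres]
        have hij : ((i - j : ℕ) : ℝ) ≤ (1 - a / 8) * i := by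
          rw [Nat.cast_sub (by omega)]
          have : (i : ℝ) ≤ 4 * L := by exact_mod_cast hL2.2
          nlinarith
        have hij0 : (0 : ℝ) < ((i - j : ℕ) : ℝ) := by
          exact_mod_cast (by omega : 0 < i - j)
        refine le_trans ?_ (hih.trans (green_mono ν A ?_ _))
        · gcongr
        · have hM : L ≤ M₀ * j := by
            have h1 : 2 / a ≤ (M₀ : ℝ) :=
              (Nat.le_ceil _).trans (by exact_mod_cast le_max_right _ _)
            rw [div_le_iff₀ ha0] at h1
            have h2 : (L : ℝ) ≤ M₀ * j := by nlinarith
            exact_mod_cast h2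
          have : M₀ * (i - j + 1) + M₀ * j = M₀ * (i + 1) := by
            rw [← mul_add]
            congr 1
            omega
          omega
      · push_cast
        rw [abs_sub_comm]
        refine (show |(walk y L : ℝ) - e| ≤ C * √L from hy1).trans ?_
        gcongr
        omega
      · rw [← hres]
        exact hlat.sub hν hq hy

end FiniteVariance

/-! ### Lower bounds for the Green function: heavy tails -/

section HeavyTail

variable {ν : Measure ℤ} [IsProbabilityMeasure ν] {A : Set ℤ}

/-- Every dyadic block far enough to the right carries polynomially large mass. -/
def DyadicMass (ν : Measure ℤ) : Prop :=
  ∃ κ k₁ : ℕ, ∀ k : ℕ, k₁ ≤ k → 1 / ((2 : ℝ) ^ k) ^ κ ≤ ν.real (Set.Ico (2 ^ k) (2 ^ (k + 1)))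

/-- If `2^(k+1) ≤ e < 2^(k+2)`, the block `[2^k, 2^(k+1))` lies inside `[e/4, e]`. -/
lemma DyadicMass.exists_forall_le (h : DyadicMass ν) :
    ∃ κ D : ℕ, ∀ e : ℤ, D ≤ e → 1 / (e : ℝ) ^ κ ≤ ν.real {x : ℤ | e ≤ 4 * x ∧ x ≤ e} := by
  obtain ⟨κ, k₁, H⟩ := h
  refine ⟨κ, 2 ^ (k₁ + 1), fun e he => ?_⟩
  lift e to ℕ using le_trans (by positivity) he
  have he' : 2 ^ (k₁ + 1) ≤ e := by exact_mod_cast he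
  have he0 : e ≠ 0 := by
    have : 0 < 2 ^ (k₁ + 1) := by positivity
    omega
  have hlog : k₁ + 1 ≤ Nat.log 2 e := Nat.le_log_of_pow_le (by norm_num) he'
  obtain ⟨k, hk⟩ : ∃ k, Nat.log 2 e = k + 1 := ⟨Nat.log 2 e - 1, by omega⟩
  have h1 : 2 ^ (k + 1) ≤ e := hk ▸ Nat.pow_log_le_self 2 he0
  have h2 : e < 2 ^ (k + 1 + 1) := hk ▸ Nat.lt_pow_succ_log_self (by norm_num) e
  refine le_trans ?_ ((H k (by omega)).trans (measureReal_mono ?_ (measure_ne_top _ _)))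
  · have h3 : ((2 : ℝ) ^ k) ≤ e := by
      have : 2 ^ k ≤ e := le_trans (Nat.pow_le_pow_right (by norm_num) (by omega)) h1
      exact_mod_cast this
    push_cast
    gcongr
  · rintro x ⟨hx1, hx2⟩
    have h1' : (2 : ℤ) ^ (k + 1) ≤ e := by exact_mod_cast h1
    have h2' : (e : ℤ) < 2 ^ (k + 1 + 1) := by exact_mod_cast h2
    rw [pow_succ] at h2' hx2 h1'
    constructor
    · rw [pow_succ] at h2'
      linarith
    · linarith

lemma state_one (A : Set ℤ) (x : ℕ → ℤ) : state A x 1 = step A (x 0) := by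
  simp [state]

/-- Deficits can be filled by a logarithmic number of large jumps. -/
lemma exists_pow_mul_pow_le_green (hν : IsCentredJumpLaw ν) (hd : DyadicMass ν) {q : ℕ}
    (hq : 1 ≤ q) (hr : Reach ν A (0, (q : ℤ))) :
    ∃ (k₀ M₀ κ D : ℕ) (p : ℝ), 0 < p ∧ p ≤ 1 ∧ 1 ≤ D ∧
      ∀ (E m i : ℕ) (e : ℤ), 1 ≤ E → k₀ + m ≤ i → 0 ≤ e → e ≤ E → (3 / 4 : ℝ) ^ m * e ≤ D → Lat ν A q (e, i) →
      p ^ i * (1 / (E : ℝ) ^ κ) ^ m ≤ green ν A (M₀ * (i + 1) + m) (e, i) := by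
  obtain ⟨κ, D, hD⟩ := hd.exists_forall_le
  obtain ⟨k₀, M₀, p, hp0, hp1, H⟩ := exists_pow_le_green hq hr (D + 1)
  refine ⟨k₀, M₀, κ, D + 1, p, hp0, hp1, by omega, fun E m => ?_⟩
  induction m with
  | zero =>
    intro i e hE hi he0 heE heD hlat
    simp only [pow_zero, one_mul, mul_one, add_zero] at heD ⊢
    refine H i (by omega) e ?_ hlat
    rw [abs_of_nonneg he0]
    exact_mod_cast heD
  | succ m ih =>
    intro i e hE hi he0 heE heD hlat
    have hE1 : (1 : ℝ) ≤ E := by exact_mod_cast hE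
    have hw0 : 0 < 1 / (E : ℝ) ^ κ := by positivity
    have hw1 : 1 / (E : ℝ) ^ κ ≤ 1 := by
      rw [div_le_one (by positivity)]
      exact one_le_pow₀ hE1
    rcases le_or_gt e ((D + 1 : ℕ) : ℤ) with hle | hgt
    · refine le_trans ?_ ((H i (by omega) e (by rwa [abs_of_nonneg he0]) hlat).trans
        (green_mono ν A (by omega) _))
      exact mul_le_of_le_one_right (by positivity) (pow_le_one₀ hw0.le hw1)
    -- A jump in `[e/4, e]` lowers the deficit to at most `3e/4` without overshooting. It may use
    -- one unit of the count, which is why `k₀ + m ≤ i` is kept in reserve.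
    · have he1 : (1 : ℝ) ≤ e := by
        have : 1 ≤ e := by push_cast at hgt; omega
        exact_mod_cast this
      have hmass := hD e (by push_cast at hgt; omega)
      rw [← real_eval_mem ν 0] at hmass
      have hmain := mul_le_green ν A 1 (M₀ * (i + 1) + m) (e, (i : ℤ))
        (E := {x : ℕ → ℤ | x 0 ∈ {x : ℤ | e ≤ 4 * x ∧ x ≤ e}})
        (h := p ^ i * (1 / (E : ℝ) ^ κ) ^ m)
        ((measurable_pi_apply 0) (MeasurableSet.of_discrete)) (by positivity) ?_
      · rw [show 1 + (M₀ * (i + 1) + m) = M₀ * (i + 1) + (m + 1) by ring] at hmain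
        refine le_trans ?_ hmain
        have hEe : 1 / (E : ℝ) ^ κ ≤ 1 / (e : ℝ) ^ κ := by
          have : (e : ℝ) ≤ E := by exact_mod_cast heE
          gcongr
        calc p ^ i * (1 / (E : ℝ) ^ κ) ^ (m + 1)
            = 1 / (E : ℝ) ^ κ * (p ^ i * (1 / (E : ℝ) ^ κ) ^ m) := by ring
          _ ≤ _ := mul_le_mul_of_nonneg_right (hEe.trans hmass) (by positivity)
      · filter_upwards [ae_reach ν A 1] with y hy hyE
        obtain ⟨hy1, hy2⟩ := (hyE : e ≤ 4 * y 0 ∧ y 0 ≤ e)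
        have ha0 := indicator_one_nonneg A (y 0)
        have ha1 := indicator_one_le_one A (y 0)
        have hlat' := hlat.sub hν hq hy
        obtain ⟨i', hi', hi'2, hi'3⟩ : ∃ i' : ℕ, (i' : ℤ) = i - A.indicator (1 : ℤ → ℤ) (y 0) ∧
            k₀ + m ≤ i' ∧ i' ≤ i := by
          refine ⟨((i : ℤ) - A.indicator (1 : ℤ → ℤ) (y 0)).toNat, ?_, ?_, ?_⟩ <;> omega
        have hres : ((e, (i : ℤ)) : ℤ × ℤ) - state A y 1 = (e - y 0, (i' : ℤ)) := by
          rw [state_one]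
          ext
          · simp [step]
          · simp [step, hi']
        rw [hres] at hlat' ⊢
        have := ih i' (e - y 0) hE hi'2 (by omega) (by omega) ?_ hlat'
        · refine le_trans ?_ (this.trans (green_mono ν A ?_ _))
          · exact mul_le_mul_of_nonneg_right (pow_le_pow_of_le_one hp0.le hp1 hi'3) (by positivity)
          · gcongr
        · have h3 : ((e - y 0 : ℤ) : ℝ) ≤ 3 / 4 * e := by
            have : (e : ℝ) ≤ 4 * y 0 := by exact_mod_cast hy1
            push_cast
            linarith
          calc (3 / 4 : ℝ) ^ m * ((e - y 0 : ℤ) : ℝ) ≤ (3 / 4 : ℝ) ^ m * (3 / 4 * e) := by gcongr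
            _ = (3 / 4 : ℝ) ^ (m + 1) * e := by ring
            _ ≤ _ := heD

/-- The number of remaining jumps in `A` can be brought down geometrically fast while the walk does
not go up. -/
lemma exists_mul_pow_le_green_of_base (hν : IsCentredJumpLaw ν) {q : ℕ} (hq : 1 ≤ q)
    (hA : 0 < ν A) :
    ∃ L₁ : ℕ, ∀ (n K E M : ℕ) (h : ℝ), 1 ≤ n → 2 * L₁ ≤ K → 0 ≤ h →
      (∀ (i : ℕ) (e : ℤ), K ≤ 2 * i → i ≤ K → 0 ≤ e → e ≤ E → Lat ν A q (e, i) →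
        h ≤ green ν A M (e, i)) →
      ∀ (R i : ℕ) (e : ℤ), K ≤ 2 * i → i ≤ n → (1 - ν.real A / 8) ^ R * i ≤ K → 0 ≤ e →
        e + R * n ≤ E → Lat ν A q (e, i) →
        h * (1 / (4 * n : ℝ)) ^ R ≤ green ν A (M + R * n) (e, i) := by
  set a := ν.real A with ha
  have ha0 : 0 < a := ENNReal.toReal_pos hA.ne' (measure_ne_top _ _)
  have ha1 : a ≤ 1 := measureReal_le_one
  -- The Hoeffding error has to be at most half of the lower bound `1 / (L + 1)` for `P(S_L ≤ 0)`.
  have hexp : ∀ᶠ L : ℕ in atTop, Real.exp (-(a ^ 2 * L / 2)) ≤ 1 / (2 * ((L : ℝ) + 1)) := by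
    have h1 : Tendsto (fun x : ℝ => x ^ 1 * Real.exp (-x)) atTop (𝓝 0) :=
      Real.tendsto_pow_mul_exp_neg_atTop_nhds_zero 1
    have h2 : Tendsto (fun L : ℕ => a ^ 2 / 2 * (L : ℝ)) atTop atTop :=
      tendsto_natCast_atTop_atTop.const_mul_atTop (by positivity)
    filter_upwards [(h1.comp h2).eventually (gt_mem_nhds (show 0 < a ^ 2 / 2 / 4 by positivity)),
      eventually_ge_atTop 1] with L hL hL1
    simp only [Function.comp, pow_one] at hL
    have hL1' : (1 : ℝ) ≤ L := by exact_mod_cast hL1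
    rw [le_div_iff₀ (by positivity), show -(a ^ 2 * L / 2) = -(a ^ 2 / 2 * L) by ring]
    set x := Real.exp (-(a ^ 2 / 2 * L))
    have hx : 0 < x := Real.exp_pos _
    have ha2 : 0 < a ^ 2 / 2 := by positivity
    have h3 : a ^ 2 / 2 * (L * x) < a ^ 2 / 2 * (1 / 4) := by linarith
    have h4 : L * x < 1 / 4 := lt_of_mul_lt_mul_left h3 ha2.le
    nlinarith
  obtain ⟨L₁, hL₁⟩ := eventually_atTop.1 hexp
  refine ⟨L₁ + 2, fun n K E M h hn hK hh hbase R => ?_⟩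
  have hn1 : (1 : ℝ) ≤ n := by exact_mod_cast hn
  have hw0 : 0 < 1 / (4 * n : ℝ) := by positivity
  have hw1 : 1 / (4 * n : ℝ) ≤ 1 := by
    rw [div_le_one (by positivity)]
    linarith
  induction R with
  | zero =>
    intro i e hKi hin hiK he0 heE hlat
    simp only [pow_zero, one_mul, mul_one, Nat.cast_zero, zero_mul, add_zero] at hiK heE ⊢
    exact hbase i e hKi (by exact_mod_cast hiK) he0 heE hlat
  | succ R ih =>
    intro i e hKi hin hiK he0 heE hlat
    push_cast at heE
    rw [add_mul, one_mul] at heE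
    have hRn : (0 : ℤ) ≤ R * n := by positivity
    rcases le_or_gt i K with hle | hgt
    · refine le_trans ?_ ((hbase i e hKi hle he0 (by omega) hlat).trans
        (green_mono ν A (by omega) _))
      exact mul_le_of_le_one_right hh (pow_le_one₀ hw0.le hw1)
    -- As `j ≤ L`, one has `2 (i - j) ≥ i > K`, so a round cannot jump over the window `[K/2, K]`.
    -- As `S_L ≥ -L`, the deficit grows by at most `n` per round, as budgeted in `e + R * n ≤ E`.
    · set L := i / 2 with hL
      have hL1 : L₁ ≤ L ∧ 1 ≤ L := by omega
      have hL2 : 2 * L ≤ i ∧ i ≤ 4 * L := by omega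
      have hPE := le_real_inter_state_snd (A := A) (b := 1 / (2 * ((L : ℝ) + 1)))
        (F := {x | walk x L ≤ 0})
        (le_trans (le_of_eq (by field_simp)) (hν.le_real_walk_nonpos L)) (hL₁ L hL1.1)
      have hEm : MeasurableSet ({x | walk x L ≤ 0} ∩ {x | a * L / 2 < ((state A x L).2 : ℝ)}) :=
        ((measurable_walk L) (MeasurableSet.of_discrete (s := Set.Iic 0))).inter
          (measurableSet_state_snd A L _)
      have hLR : (1 : ℝ) ≤ L := by exact_mod_cast hL1.2
      have hmain := mul_le_green ν A L (M + R * n + n - L) (e, (i : ℤ)) hEm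
        (h := h * (1 / (4 * n : ℝ)) ^ R) (by positivity) ?_
      · rw [Nat.add_sub_cancel' (by omega),
          show M + R * n + n = M + (R + 1) * n by ring] at hmain
        refine le_trans ?_ hmain
        rw [pow_succ, ← mul_assoc, mul_comm]
        refine mul_le_mul_of_nonneg_right (le_trans ?_ hPE) (by positivity)
        have : (2 * L : ℝ) ≤ n := by exact_mod_cast (by omega : 2 * L ≤ n)
        exact one_div_le_one_div_of_le (by positivity) (by linarith)
      · filter_upwards [ae_reach ν A L, hν.ae_forall_neg_one_le] with y hy hyν hyE
        obtain ⟨hy1, hy2⟩ := hyE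
        have hs0 := state_snd_nonneg A y L
        have hs1 := state_snd_le A y L
        obtain ⟨j, hj⟩ := Int.eq_ofNat_of_zero_le hs0
        have hy2' : a * L / 2 < (j : ℝ) := by
          have : a * L / 2 < ((state A y L).2 : ℝ) := hy2
          rw [hj] at this
          exact_mod_cast this
        have hjL : j ≤ L := by omega
        have hlat' := hlat.sub hν hq hy
        have hres : ((e, (i : ℤ)) : ℤ × ℤ) - state A y L = (e - walk y L, ((i - j : ℕ) : ℤ)) := by
          ext
          · simp [state_fst]
          · simp only [Prod.snd_sub, hj]
            push_cast [Nat.cast_sub (show j ≤ i by omega)]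
            rfl
        rw [hres] at hlat' ⊢
        have hwy : walk y L ≤ 0 := hy1
        have hwy' := neg_le_walk hyν L
        refine (ih (i - j) (e - walk y L) (by omega) (by omega) ?_ (by omega) (by omega)
          hlat').trans (green_mono ν A (by omega) _)
        have hij : ((i - j : ℕ) : ℝ) ≤ (1 - a / 8) * i := by
          rw [Nat.cast_sub (by omega)]
          have : (i : ℝ) ≤ 4 * L := by exact_mod_cast hL2.2
          nlinarith
        refine le_trans ?_ hiK
        rw [pow_succ, mul_assoc]
        exact mul_le_mul_of_nonneg_left hij (pow_nonneg (by linarith) _)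

end HeavyTail

/-! ### Subexponential lower bounds for the conditioning events -/

section LowerBound

set_option linter.unusedSectionVars false

/-- The integer part of the fourth root. -/
def fourthRoot (n : ℕ) : ℕ := Nat.sqrt (Nat.sqrt n)

lemma fourthRoot_pow_le (n : ℕ) : fourthRoot n ^ 4 ≤ n := by
  have h1 : fourthRoot n * fourthRoot n ≤ Nat.sqrt n := Nat.sqrt_le (Nat.sqrt n)
  have h2 := Nat.sqrt_le n
  calc fourthRoot n ^ 4 = (fourthRoot n * fourthRoot n) * (fourthRoot n * fourthRoot n) := by ring
    _ ≤ Nat.sqrt n * Nat.sqrt n := Nat.mul_le_mul h1 h1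
    _ ≤ n := h2

lemma succ_le_fourthRoot_pow (n : ℕ) : n + 1 ≤ (fourthRoot n + 1) ^ 4 := by
  have h1 : Nat.sqrt n + 1 ≤ (fourthRoot n + 1) * (fourthRoot n + 1) :=
    Nat.lt_succ_sqrt (Nat.sqrt n)
  have h2 : n + 1 ≤ (Nat.sqrt n + 1) * (Nat.sqrt n + 1) := Nat.lt_succ_sqrt n
  calc n + 1 ≤ (Nat.sqrt n + 1) * (Nat.sqrt n + 1) := h2
    _ ≤ ((fourthRoot n + 1) * (fourthRoot n + 1)) * ((fourthRoot n + 1) * (fourthRoot n + 1)) :=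
      Nat.mul_le_mul h1 h1
    _ = _ := by ring

lemma tendsto_fourthRoot : Tendsto fourthRoot atTop atTop := by
  refine tendsto_atTop.2 fun b => ?_
  filter_upwards [eventually_ge_atTop ((b + 1) ^ 4)] with n hn
  by_contra! hlt
  have h1 := succ_le_fourthRoot_pow n
  have h2 := Nat.pow_le_pow_left (show fourthRoot n + 1 ≤ b + 1 by omega) 4
  omega

lemma fourthRoot_sq_le_sqrt (n : ℕ) : (fourthRoot n : ℝ) ^ 2 ≤ √n := by
  refine Real.le_sqrt_of_sq_le ?_
  have := fourthRoot_pow_le n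
  rw [← pow_mul]
  exact_mod_cast this

/-- Here `K log K = o(K²)`. With `K` the fourth root of `n` and `K² ≤ √n`, a cost of `O(K)`
polynomial factors is negligible against `exp(-ε√n)`. -/
lemma eventually_exp_le_pow (m : ℕ) {ε : ℝ} (hε : 0 < ε) :
    ∀ᶠ K : ℕ in atTop, Real.exp (-ε * (K : ℝ) ^ 2) ≤ (1 / ((K : ℝ) + 2)) ^ (m * K) := by
  have hlim : Tendsto (fun K : ℕ => (K : ℝ) + 2) atTop atTop :=
    tendsto_atTop_add_const_right _ _ tendsto_natCast_atTop_atTop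
  have hlog := (Real.isLittleO_log_id_atTop.comp_tendsto hlim).bound
    (show 0 < ε / (3 * (m + 1)) by positivity)
  filter_upwards [hlog, eventually_ge_atTop 1] with K hK hK1
  have hK1' : (1 : ℝ) ≤ K := by exact_mod_cast hK1
  simp only [Function.comp, id, Real.norm_eq_abs] at hK
  rw [abs_of_nonneg (Real.log_nonneg (by linarith)), abs_of_nonneg (by linarith)] at hK
  have hQ : (0 : ℝ) < (K : ℝ) + 2 := by linarith
  rw [← Real.log_le_log_iff (Real.exp_pos _) (by positivity), Real.log_exp, Real.log_pow,
    one_div, Real.log_inv]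
  push_cast
  have h1 : (m + 1 : ℝ) * Real.log ((K : ℝ) + 2) ≤ ε * K := by
    have h2 : ε / (3 * (m + 1)) * ((K : ℝ) + 2) * (m + 1) = ε / 3 * (K + 2) := by
      field_simp
    have h3 := mul_le_mul_of_nonneg_right hK (show (0 : ℝ) ≤ m + 1 by positivity)
    rw [h2] at h3
    nlinarith
  have h4 : 0 ≤ Real.log ((K : ℝ) + 2) := Real.log_nonneg (by linarith)
  nlinarith

variable {ν : Measure ℤ} [IsProbabilityMeasure ν] {A : Set ℤ}

/-- With `n ≥ 1` the hitting time is not the default value `0`, for which no jump would be counted.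
Hence validity of `n` puts the target on the lattice. -/
lemma reach_of_jumpEvent {r n : ℕ} (hn : 1 ≤ n) (h : jumpsLaw ν (jumpEvent A r n) ≠ 0) :
    Reach ν A (-(r : ℤ), (n : ℤ)) := by
  by_contra hcon
  refine h (measure_mono_null (t := ⋃ N, {x | state A x N = (-(r : ℤ), (n : ℤ))}) ?_
    (measure_iUnion_null fun N => ?_))
  · intro x hx
    rw [jumpEvent_eq] at hx
    have hx' : (state A x (hitTime r x)).2 = n := hx
    refine Set.mem_iUnion.2 ⟨hitTime r x, ?_⟩
    have hne : {i : ℕ | 1 ≤ i ∧ walk x i = -(r : ℤ)}.Nonempty := by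
      by_contra hemp
      rw [Set.not_nonempty_iff_eq_empty] at hemp
      rw [hitTime, hemp, Nat.sInf_empty] at hx'
      simp [state] at hx'
      omega
    exact Prod.ext ((state_fst A x _).trans (Nat.sInf_mem hne).2) hx'
  · rw [← measureReal_eq_zero_iff (measure_ne_top _ _)]
    by_contra hne
    exact hcon ⟨N, lt_of_le_of_ne measureReal_nonneg (Ne.symm hne)⟩

/-- The conditioning events have at worst stretched-exponentially small probability. -/
def SubexponentialJumpEvents (ν : Measure ℤ) (A : Set ℤ) (ϱ : ℕ → ℕ) : Prop :=
  ∀ ε : ℝ, 0 < ε → ∀ᶠ n : ℕ in atTop, n ∈ validTimes ν A ϱ →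
    Real.exp (-ε * √n) ≤ (jumpsLaw ν).real (jumpEvent A (ϱ n) n)

lemma subexponentialJumpEvents_of_pow {ϱ : ℕ → ℕ} (m : ℕ)
    (h : ∀ᶠ n : ℕ in atTop, n ∈ validTimes ν A ϱ →
      (1 / ((fourthRoot n : ℝ) + 2)) ^ (m * fourthRoot n) ≤
        (jumpsLaw ν).real (jumpEvent A (ϱ n) n)) : SubexponentialJumpEvents ν A ϱ := by
  intro ε hε
  filter_upwards [h, tendsto_fourthRoot.eventually (eventually_exp_le_pow m hε)] with n h1 h2 hn
  refine le_trans (Real.exp_le_exp.2 ?_) (h2.trans (h1 hn))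
  nlinarith [fourthRoot_sq_le_sqrt n]

lemma cast_add_one_le_pow (n : ℕ) : (n : ℝ) + 1 ≤ ((fourthRoot n : ℝ) + 2) ^ 4 := by
  have h1 : (n : ℝ) + 1 ≤ ((fourthRoot n : ℝ) + 1) ^ 4 := by
    exact_mod_cast succ_le_fourthRoot_pow n
  refine h1.trans ?_
  gcongr
  norm_num

lemma eventually_one_div_le {c : ℝ} (hc : 0 < c) :
    ∀ᶠ n : ℕ in atTop, 1 / ((fourthRoot n : ℝ) + 2) ≤ c := by
  have hlim : Tendsto (fun K : ℕ => (K : ℝ) + 2) atTop atTop :=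
    tendsto_atTop_add_const_right _ _ tendsto_natCast_atTop_atTop
  filter_upwards [tendsto_fourthRoot.eventually (hlim.eventually_ge_atTop (1 / c))] with n hn
  rw [div_le_iff₀ (by positivity)]
  rw [div_le_iff₀ hc] at hn
  linarith

lemma eventually_cast_le (M : ℕ) : ∀ᶠ n : ℕ in atTop, (M : ℝ) ≤ (fourthRoot n : ℝ) + 2 := by
  filter_upwards [tendsto_fourthRoot.eventually_ge_atTop M] with n hn
  have : (M : ℝ) ≤ fourthRoot n := by exact_mod_cast hn
  linarith

/-- Lower bound for the conditioning events in the finite variance regime. -/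
theorem IsCentredJumpLaw.subexponential_of_finiteVariance (hν : IsCentredJumpLaw ν)
    (h2 : FiniteVariance ν) (hA : 0 < ν A) {ϱ : ℕ → ℕ} (hϱ : ∀ n, 1 ≤ n → 1 ≤ ϱ n)
    {C : ℝ} (hC : ∀ᶠ n : ℕ in atTop, (ϱ n : ℝ) ≤ C * √n) :
    SubexponentialJumpEvents ν A ϱ := by
  obtain ⟨q, hq, hr⟩ := hν.exists_reach_vertical hA
  obtain ⟨i₀, M₀, κ, c, hc, H⟩ :=
    hν.exists_div_pow_le_green h2 hq hr hA (C := max C 1) (by positivity)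
  refine subexponentialJumpEvents_of_pow (4 * κ + 6) ?_
  filter_upwards [hC, eventually_ge_atTop (i₀ + 1), eventually_one_div_le hc,
    eventually_cast_le M₀, tendsto_fourthRoot.eventually_ge_atTop 1] with n hn hi hc' hM hK hv
  have hlow := H n (by omega) (-(ϱ n : ℤ)) ?_ (reach_of_jumpEvent hv.1 hv.2).lat
  · have hup := green_le_mul_jumpEvent ν A (n := n) (hϱ n hv.1) (M₀ * (n + 1))
    set Q := (fourthRoot n : ℝ) + 2 with hQ
    set x := (jumpsLaw ν).real (jumpEvent A (ϱ n) n) with hx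
    have hx0 : 0 ≤ x := measureReal_nonneg
    have hQ1 : 1 ≤ Q := by
      rw [hQ]
      linarith [(Nat.cast_nonneg (fourthRoot n) : (0 : ℝ) ≤ fourthRoot n)]
    have hQ0 : 0 < Q := by linarith
    have hn4 := cast_add_one_le_pow n
    have hn1 : (1 : ℝ) ≤ n := by exact_mod_cast hv.1
    -- Constants and powers of `n` are absorbed into powers of `Q`, using `n + 1 ≤ Q ^ 4`.
    have h1 : (1 / Q) / (Q ^ 4) ^ κ ≤ Q * Q ^ 4 * x := by
      calc (1 / Q) / (Q ^ 4) ^ κ ≤ c / (n : ℝ) ^ κ := by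
            gcongr
            linarith
        _ ≤ ((M₀ * (n + 1) : ℕ) : ℝ) * x := hlow.trans hup
        _ ≤ _ := by
            push_cast
            gcongr
    have h2 : (1 / Q) ^ (4 * κ + 6) ≤ x := by
      rw [← pow_mul, div_div, div_le_iff₀ (by positivity)] at h1
      rw [div_pow, one_pow, div_le_iff₀ (by positivity)]
      calc (1 : ℝ) ≤ _ := h1
        _ = _ := by ring
    refine le_trans ?_ h2
    refine pow_le_pow_of_le_one (by positivity) ?_ (Nat.le_mul_of_pos_right _ hK)
    rw [div_le_one hQ0]
    exact hQ1
  · push_cast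
    rw [abs_neg, abs_of_nonneg (by positivity)]
    refine hn.trans ?_
    gcongr
    exact le_max_left _ _

/-- The walk is below any multiple of the scale `a` with non-vanishing probability. -/
def LeftTail (ν : Measure ℤ) (a : ℕ → ℝ) : Prop :=
  ∀ C : ℝ, ∃ c : ℝ, 0 < c ∧ ∀ᶠ n : ℕ in atTop,
    c ≤ (jumpsLaw ν).real {x | (walk x n : ℝ) ≤ -(C * a n)}

/-- Stopping `K` steps before `n` leaves at least `K` of the count. If `a_n ≥ K`, the left tail at
level `(C + 1) a_n` suffices, since those `K` steps descend at most `K`. If `a_n < K`, then `ϱ_n ≤ C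
K` and that many jumps `-1` can be forced. -/
lemma IsCentredJumpLaw.exists_pow_le_real_walk_le (hν : IsCentredJumpLaw ν) {a : ℕ → ℝ}
    (ha : ∀ n, 1 ≤ n → 0 < a n) (hleft : LeftTail ν a) {ϱ : ℕ → ℕ} {C : ℕ}
    (hC : ∀ᶠ n : ℕ in atTop, (ϱ n : ℝ) ≤ C * a n) :
    ∃ m : ℕ, ∀ᶠ n : ℕ in atTop, (1 / ((fourthRoot n : ℝ) + 2)) ^ (m * fourthRoot n) ≤
      (jumpsLaw ν).real {x | walk x (n - fourthRoot n) ≤ -(ϱ n : ℤ)} := by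
  obtain ⟨c, hc, hleft'⟩ := hleft (C + 1)
  have hw0 : 0 < ν.real {-1} := real_singleton_pos hν.charges
  refine ⟨C + 4, ?_⟩
  filter_upwards [hC, hleft', eventually_one_div_le hc, eventually_one_div_le hw0,
    tendsto_fourthRoot.eventually_ge_atTop (C + 1), eventually_ge_atTop 1]
    with n hϱ hl hc' hw' hK hn
  set K := fourthRoot n with hKdef
  set Q := (K : ℝ) + 2 with hQ
  have hKn : K ^ 4 ≤ n := fourthRoot_pow_le n
  have hK3 : (C + 1) * K ≤ n := by
    calc (C + 1) * K ≤ K * K := Nat.mul_le_mul_right _ hK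
      _ = K ^ 2 := by ring
      _ ≤ K ^ 4 := Nat.pow_le_pow_right (by omega) (by norm_num)
      _ ≤ n := hKn
  have hQ1 : 1 ≤ Q := by
    rw [hQ]
    linarith [(Nat.cast_nonneg K : (0 : ℝ) ≤ K)]
  have hQ0 : 0 < Q := by linarith
  have hiQ0 : 0 ≤ 1 / Q := by positivity
  have hiQ1 : 1 / Q ≤ 1 := by rwa [div_le_one hQ0]
  have han := ha n hn
  rcases le_or_gt (K : ℝ) (a n) with hcase | hcase
  · calc (1 / Q) ^ ((C + 4) * K) ≤ (1 / Q) ^ 1 :=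
          pow_le_pow_of_le_one hiQ0 hiQ1 (Nat.mul_pos (by omega) (by omega))
      _ ≤ c := by rwa [pow_one]
      _ ≤ _ := hl
      _ ≤ _ := by
          refine ENNReal.toReal_mono (measure_ne_top _ _) (measure_mono_ae ?_)
          filter_upwards [hν.ae_forall_neg_one_le] with x hx hxl
          have h1 := walk_add_le hx (n - K) K
          rw [Nat.sub_add_cancel (by nlinarith)] at h1
          have h2 : (walk x n : ℝ) ≤ -((C + 1) * a n) := hxl
          have h3 : (walk x (n - K) : ℝ) ≤ walk x n + K := by exact_mod_cast h1
          have h4 : (walk x (n - K) : ℝ) ≤ -(ϱ n : ℝ) := by linarith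
          show walk x (n - K) ≤ -(ϱ n : ℤ)
          exact_mod_cast h4
  · have hϱK : ϱ n ≤ C * K := by
      have h1 : (ϱ n : ℝ) ≤ C * K := hϱ.trans (by gcongr)
      exact_mod_cast h1
    set r := ϱ n with hr
    obtain ⟨l, hl⟩ : ∃ l, n - K = r + l := ⟨n - K - r, by
      have : (C + 1) * K = C * K + K := by ring
      omega⟩
    -- First `r` jumps `-1`, then `l` steps with nonpositive total. Counting jumps in `∅` makes
    -- `state` record the position only.
    have hmain := mul_le_real_of_concat ν r (F := {x | walk x (n - K) ≤ -(r : ℤ)})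
      (E := {x | state ∅ x r = r • step ∅ (-1)}) (h := (jumpsLaw ν).real {x | walk x l ≤ 0})
      ((measurable_walk _) (MeasurableSet.of_discrete (s := Set.Iic (-(r : ℤ)))))
      (measurableSet_state_eq _ _ _) measureReal_nonneg (ae_of_all _ fun y hy => ?_)
    · refine le_trans ?_ hmain
      have h1 : (1 / Q) ^ (C * K) ≤ (jumpsLaw ν).real {x | state ∅ x r = r • step ∅ (-1)} := by
        calc (1 / Q) ^ (C * K) ≤ (1 / Q) ^ r := pow_le_pow_of_le_one hiQ0 hiQ1 hϱK
          _ ≤ ν.real {-1} ^ r := pow_le_pow_left₀ hiQ0 hw' r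
          _ ≤ _ := pow_real_singleton_le _ _
      have h2 : (1 / Q) ^ (4 * K) ≤ (jumpsLaw ν).real {x | walk x l ≤ 0} := by
        calc (1 / Q) ^ (4 * K) ≤ (1 / Q) ^ 4 :=
              pow_le_pow_of_le_one hiQ0 hiQ1 (Nat.le_mul_of_pos_right _ (by omega))
          _ = 1 / Q ^ 4 := by rw [div_pow, one_pow]
          _ ≤ 1 / ((l : ℝ) + 1) := by
              have h3 := cast_add_one_le_pow n
              have h4 : (l : ℝ) ≤ n := by exact_mod_cast (by omega : l ≤ n)
              exact one_div_le_one_div_of_le (by positivity) (by linarith)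
          _ ≤ _ := hν.le_real_walk_nonpos l
      rw [add_mul, pow_add]
      exact mul_le_mul h1 h2 (by positivity) measureReal_nonneg
    · have hy' : state ∅ y r = r • step ∅ (-1) := hy
      have hwy : walk y r = -(r : ℤ) := by
        rw [← state_fst ∅, hy']
        simp only [Prod.smul_fst, step]
        simp
      refine measureReal_mono (fun z hz => ?_) (measure_ne_top _ _)
      have hz' : walk z l ≤ 0 := hz
      show walk (concat r y z) (n - K) ≤ -(r : ℤ)
      rw [hl, walk_concat, hwy]
      omega

/-- Lower bound for the conditioning events in the heavy-tailed regime. -/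
theorem IsCentredJumpLaw.subexponential_of_dyadicMass (hν : IsCentredJumpLaw ν)
    (hd : DyadicMass ν) (hA : 0 < ν A) {a : ℕ → ℝ} (ha : ∀ n, 1 ≤ n → 0 < a n)
    (hleft : LeftTail ν a) {ϱ : ℕ → ℕ} (hϱ : ∀ n, 1 ≤ n → 1 ≤ ϱ n) {C : ℕ}
    (hC : ∀ᶠ n : ℕ in atTop, (ϱ n : ℝ) ≤ C * a n) :
    SubexponentialJumpEvents ν A ϱ := by
  obtain ⟨q, hq, hr⟩ := hν.exists_reach_vertical hA
  obtain ⟨k₀, M₀, κ, D, p, hp0, hp1, hD, hup⟩ := exists_pow_mul_pow_le_green hν hd hq hr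
  obtain ⟨L₁, hdown⟩ := exists_mul_pow_le_green_of_base (A := A) hν hq hA
  obtain ⟨m, hstart⟩ := hν.exists_pow_le_real_walk_le ha hleft hC
  set b := 1 - ν.real A / 8 with hb
  have ha0 : 0 < ν.real A := ENNReal.toReal_pos hA.ne' (measure_ne_top _ _)
  have hb1 : b < 1 := by linarith
  have hb0 : 0 < b := by linarith [(measureReal_le_one : ν.real A ≤ 1)]
  -- geometric factors beat powers of `n`
  have hgeo : ∀ᶠ K : ℕ in atTop, b ^ K * ((K : ℝ) + 1) ^ 4 ≤ 1 ∧
      (3 / 4 : ℝ) ^ (K / 4) * ((K : ℝ) + 2) ^ 5 ≤ 1 := by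
    have h1 : Tendsto (fun K : ℕ => (K : ℝ) ^ 4 * b ^ K) atTop (𝓝 0) :=
      tendsto_pow_const_mul_const_pow_of_lt_one 4 hb0.le hb1
    have h2 : Tendsto (fun K : ℕ => (K : ℝ) ^ 5 * (3 / 4 : ℝ) ^ K) atTop (𝓝 0) :=
      tendsto_pow_const_mul_const_pow_of_lt_one 5 (by norm_num) (by norm_num)
    have h4 : Tendsto (fun K : ℕ => K / 4) atTop atTop :=
      Nat.tendsto_div_const_atTop (by norm_num)
    filter_upwards [h1.eventually (gt_mem_nhds (show (0 : ℝ) < 1 / 2 ^ 4 by norm_num)),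
      (h2.comp h4).eventually (gt_mem_nhds (show (0 : ℝ) < 1 / 9 ^ 5 by norm_num)),
      eventually_ge_atTop 4] with K hK1 hK2 hK3
    have hK3' : (1 : ℝ) ≤ K := by exact_mod_cast (by omega : 1 ≤ K)
    constructor
    · calc b ^ K * ((K : ℝ) + 1) ^ 4 ≤ b ^ K * (2 * K) ^ 4 := by
            gcongr
            linarith
        _ = 2 ^ 4 * ((K : ℝ) ^ 4 * b ^ K) := by ring
        _ ≤ 2 ^ 4 * (1 / 2 ^ 4) := by gcongr
        _ = 1 := by norm_num
    · simp only [Function.comp] at hK2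
      have h5 : (K : ℝ) + 2 ≤ 9 * ((K / 4 : ℕ) : ℝ) := by
        exact_mod_cast (by omega : K + 2 ≤ 9 * (K / 4))
      calc (3 / 4 : ℝ) ^ (K / 4) * ((K : ℝ) + 2) ^ 5
          ≤ (3 / 4 : ℝ) ^ (K / 4) * (9 * ((K / 4 : ℕ) : ℝ)) ^ 5 := by gcongr
        _ = 9 ^ 5 * (((K / 4 : ℕ) : ℝ) ^ 5 * (3 / 4 : ℝ) ^ (K / 4)) := by ring
        _ ≤ 9 ^ 5 * (1 / 9 ^ 5) := by gcongr
        _ = 1 := by norm_num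
  -- The exponents pay, in order, for the initial descent, the base bound `h` (with `E ≤ Q ^ 5`),
  -- the `K` rounds (with `4 n ≤ Q ^ 6`) and the time horizon, at most `Q ^ 7`.
  refine subexponentialJumpEvents_of_pow (m + (1 + 5 * κ) + 6 + 7) ?_
  filter_upwards [hstart, tendsto_fourthRoot.eventually hgeo, eventually_one_div_le hp0,
    eventually_cast_le (M₀ + 2), tendsto_fourthRoot.eventually_ge_atTop (4 * k₀ + 2 * L₁ + 4)]
    with n hs hgeo' hp hM hK hv
  have hn1 : 1 ≤ n := hv.1
  set K := fourthRoot n with hKdef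
  set Q := (K : ℝ) + 2 with hQ
  have hKn : K ≤ n := (Nat.le_self_pow (by norm_num) K).trans (fourthRoot_pow_le n)
  have hQ2 : 2 ≤ Q := by
    rw [hQ]
    linarith [(Nat.cast_nonneg K : (0 : ℝ) ≤ K)]
  have hQ0 : 0 < Q := by linarith
  have hiQ0 : 0 ≤ 1 / Q := by positivity
  have hiQ1 : 1 / Q ≤ 1 := by
    rw [div_le_one hQ0]
    linarith
  have hn4 : (n : ℝ) + 1 ≤ Q ^ 4 := cast_add_one_le_pow n
  have hn4' : (n : ℝ) + 1 ≤ ((K : ℝ) + 1) ^ 4 := by exact_mod_cast succ_le_fourthRoot_pow n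
  have hnR : (1 : ℝ) ≤ n := by exact_mod_cast hn1
  -- The largest possible deficit: at most `n` at the start and `n` more in each of `K` rounds.
  set E := (K + 1) * n with hE
  have hE1 : 1 ≤ E := Nat.mul_pos (by omega) hn1
  have hEQ : (E : ℝ) ≤ Q ^ 5 := by
    rw [hE]
    push_cast
    calc ((K : ℝ) + 1) * n ≤ Q * Q ^ 4 := by
          gcongr <;> linarith
      _ = Q ^ 5 := by ring
  set M₁ := M₀ * (K + 1) + K / 4 with hM₁
  set h := p ^ K * (1 / (E : ℝ) ^ κ) ^ (K / 4) with hh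
  have hh0 : 0 ≤ h := by positivity
  -- The `K / 4` large jumps fit: `i ≥ K / 2` and `k₀ ≤ K / 4` give `k₀ + K / 4 ≤ i`.
  have hbase : ∀ (i : ℕ) (e : ℤ), K ≤ 2 * i → i ≤ K → 0 ≤ e → e ≤ E → Lat ν A q (e, i) →
      h ≤ green ν A M₁ (e, i) := by
    intro i e hKi hiK he0 heE hlat
    refine le_trans ?_ ((hup E (K / 4) i e hE1 (by omega) he0 heE ?_ hlat).trans
      (green_mono ν A ?_ _))
    · exact mul_le_mul_of_nonneg_right (pow_le_pow_of_le_one hp0.le hp1 hiK) (by positivity)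
    · have h1 : (e : ℝ) ≤ Q ^ 5 := le_trans (by exact_mod_cast heE) hEQ
      have h2 : (1 : ℝ) ≤ D := by exact_mod_cast hD
      calc (3 / 4 : ℝ) ^ (K / 4) * e ≤ (3 / 4 : ℝ) ^ (K / 4) * Q ^ 5 := by gcongr
        _ ≤ 1 := hgeo'.2
        _ ≤ D := h2
    · rw [hM₁]
      gcongr
  have hgreen : ∀ (i : ℕ) (e : ℤ), K ≤ 2 * i → i ≤ n → 0 ≤ e → e ≤ n → Lat ν A q (e, i) →
      h * (1 / (4 * n : ℝ)) ^ K ≤ green ν A (M₁ + K * n) (e, i) := by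
    intro i e hKi hin he0 hen hlat
    refine hdown n K E M₁ h hn1 (by omega) hh0 hbase K i e hKi hin ?_ he0 ?_ hlat
    · have h1 : (i : ℝ) ≤ ((K : ℝ) + 1) ^ 4 := by
        have : (i : ℝ) ≤ n := by exact_mod_cast hin
        linarith
      calc b ^ K * i ≤ b ^ K * ((K : ℝ) + 1) ^ 4 := by gcongr
        _ ≤ 1 := hgeo'.1
        _ ≤ K := by exact_mod_cast (by omega : 1 ≤ K)
    · rw [hE]
      push_cast
      linarith
  have hlat : Lat ν A q (-(ϱ n : ℤ), (n : ℤ)) := (reach_of_jumpEvent hv.1 hv.2).lat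
  have hmain := mul_le_green ν A (n - K) (M₁ + K * n) (-(ϱ n : ℤ), (n : ℤ))
    (E := {x | walk x (n - K) ≤ -(ϱ n : ℤ)}) (h := h * (1 / (4 * n : ℝ)) ^ K)
    ((measurable_walk _) (MeasurableSet.of_discrete (s := Set.Iic (-(ϱ n : ℤ)))))
    (by positivity) ?_
  · have hle := hmain.trans (green_le_mul_jumpEvent ν A (hϱ n hn1) _)
    set x := (jumpsLaw ν).real (jumpEvent A (ϱ n) n) with hx
    have hx0 : 0 ≤ x := measureReal_nonneg
    have hMQ : ((n - K + (M₁ + K * n) : ℕ) : ℝ) ≤ Q ^ 7 := by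
      have h1 : n - K + (M₁ + K * n) ≤ (M₀ + 2) * ((K + 2) * (n + 1)) := by
        rw [hM₁]
        have h2 : K / 4 ≤ K := Nat.div_le_self _ _
        have h3 : n - K ≤ n := Nat.sub_le _ _
        have h4 : M₀ * (K + 1) ≤ M₀ * ((K + 2) * (n + 1)) := by
          refine Nat.mul_le_mul_left _ ?_
          nlinarith
        nlinarith
      have h2 : ((n - K + (M₁ + K * n) : ℕ) : ℝ) ≤ (((M₀ + 2 : ℕ) : ℝ)) * (Q * (n + 1)) := by
        rw [hQ]
        exact_mod_cast h1
      calc _ ≤ (((M₀ + 2 : ℕ) : ℝ)) * (Q * (n + 1)) := h2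
        _ ≤ Q * (Q * Q ^ 4) := by gcongr
        _ = Q ^ 6 := by ring
        _ ≤ Q ^ 7 := pow_le_pow_right₀ (by linarith) (by norm_num)
    have hhQ : (1 / Q) ^ ((1 + 5 * κ) * K) ≤ h := by
      rw [add_mul, pow_add, one_mul, hh]
      refine mul_le_mul (pow_le_pow_left₀ hiQ0 hp K) ?_ (by positivity) (by positivity)
      have h1 : (1 / Q) ^ (5 * κ) ≤ 1 / (E : ℝ) ^ κ := by
        rw [div_pow, one_pow, pow_mul]
        have hE0 : (0 : ℝ) < E := by exact_mod_cast hE1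
        gcongr
      calc (1 / Q) ^ (5 * κ * K) = ((1 / Q) ^ (5 * κ)) ^ K := by rw [pow_mul]
        _ ≤ ((1 / Q) ^ (5 * κ)) ^ (K / 4) :=
            pow_le_pow_of_le_one (by positivity) (pow_le_one₀ hiQ0 hiQ1) (Nat.div_le_self _ _)
        _ ≤ _ := pow_le_pow_left₀ (by positivity) h1 _
    have hnQ : (1 / Q) ^ (6 * K) ≤ (1 / (4 * n : ℝ)) ^ K := by
      rw [pow_mul]
      refine pow_le_pow_left₀ (by positivity) ?_ _
      rw [div_pow, one_pow]
      refine one_div_le_one_div_of_le (by positivity) ?_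
      calc (4 * n : ℝ) ≤ Q ^ 2 * Q ^ 4 := by
            gcongr
            · nlinarith
            · linarith
        _ = Q ^ 6 := by ring
    have hprod : (1 / Q) ^ ((m + (1 + 5 * κ) + 6) * K) ≤ Q ^ 7 * x := by
      calc (1 / Q) ^ ((m + (1 + 5 * κ) + 6) * K)
          = (1 / Q) ^ (m * K) * ((1 / Q) ^ ((1 + 5 * κ) * K) * (1 / Q) ^ (6 * K)) := by
            rw [← pow_add, ← pow_add]
            congr 1
            ring
        _ ≤ _ * (h * (1 / (4 * n : ℝ)) ^ K) :=
            mul_le_mul hs (mul_le_mul hhQ hnQ (by positivity) hh0) (by positivity)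
              measureReal_nonneg
        _ ≤ _ := hle
        _ ≤ Q ^ 7 * x := by gcongr
    calc (1 / Q) ^ ((m + (1 + 5 * κ) + 6 + 7) * K)
        = (1 / Q) ^ ((m + (1 + 5 * κ) + 6) * K) * (1 / Q) ^ (7 * K) := by
          rw [← pow_add]
          congr 1
          ring
      _ ≤ (Q ^ 7 * x) * (1 / Q) ^ 7 := by
          refine mul_le_mul hprod ?_ (by positivity) (by positivity)
          exact pow_le_pow_of_le_one hiQ0 hiQ1 (Nat.le_mul_of_pos_right _ (by omega))
      _ = x := by
          rw [div_pow, one_pow]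
          field_simp
  -- The deficit `-ϱ_n - S_{n-K}` is nonnegative on the event and at most `n`, and at most `n - K`
  -- of the count has been used.
  · filter_upwards [ae_reach ν A (n - K), hν.ae_forall_neg_one_le] with y hy hyν hyE
    have hyE' : walk y (n - K) ≤ -(ϱ n : ℤ) := hyE
    have hs0 := state_snd_nonneg A y (n - K)
    have hs1 := state_snd_le A y (n - K)
    obtain ⟨j, hj⟩ := Int.eq_ofNat_of_zero_le hs0
    have hjn : j ≤ n - K := by omega
    have hlat' := hlat.sub hν hq hy
    have hres : ((-(ϱ n : ℤ), (n : ℤ)) : ℤ × ℤ) - state A y (n - K) =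
        (-(ϱ n : ℤ) - walk y (n - K), ((n - j : ℕ) : ℤ)) := by
      ext
      · simp [state_fst]
      · simp only [Prod.snd_sub, hj]
        push_cast [Nat.cast_sub (show j ≤ n by omega)]
        rfl
    rw [hres] at hlat' ⊢
    have hwy := neg_le_walk hyν (n - K)
    exact hgreen _ _ (by omega) (by omega) (by omega) (by omega) hlat'

end LowerBound

/-! ### Regularly varying tails charge dyadic blocks -/

section Tails

set_option linter.unusedSectionVars false

variable {ν : Measure ℤ} [IsProbabilityMeasure ν]

lemma tendsto_dyadic_ratio {f : ℕ → ℝ} {β : ℝ} {l : ℝ≥0 → ℝ≥0} (hl : SlowlyVarying l)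
    (hf : ∀ n : ℕ, 1 ≤ n → f n = (n : ℝ) ^ (-β) * (l (n : ℝ≥0) : ℝ)) :
    Tendsto (fun k : ℕ => f (2 ^ (k + 1)) / f (2 ^ k)) atTop (𝓝 ((2 : ℝ) ^ (-β))) := by
  have hx : Tendsto (fun k : ℕ => ((2 ^ k : ℕ) : ℝ≥0)) atTop atTop :=
    tendsto_natCast_atTop_atTop.comp (tendsto_pow_atTop_atTop_of_one_lt (by norm_num))
  have h := ((hl.2 2 (by norm_num)).comp hx).const_mul ((2 : ℝ) ^ (-β))
  rw [mul_one] at h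
  refine h.congr fun k => ?_
  simp only [Function.comp]
  rw [hf _ Nat.one_le_two_pow, hf _ Nat.one_le_two_pow, mul_div_mul_comm]
  congr 1
  · push_cast
    rw [← Real.div_rpow (by positivity) (by positivity), pow_succ,
      mul_div_cancel_left₀ _ (by positivity)]
  · congr 3
    push_cast
    rw [pow_succ, mul_comm]

/-- Ratios bounded below give at worst geometric decay in `k`, that is polynomial decay in `2 ^ k`;
the extra factor in the exponent `N + 1` absorbs the constant. -/
lemma exists_dyadic_lower_bound {u : ℕ → ℝ} (hu : ∀ k, 0 ≤ u k) {r : ℝ} (hr : 0 < r)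
    (h : Tendsto (fun k => u (k + 1) / u k) atTop (𝓝 r)) {c : ℝ} (hc : 0 < c) :
    ∃ κ : ℕ, ∀ᶠ k : ℕ in atTop, 1 / ((2 : ℝ) ^ k) ^ κ ≤ c * u k := by
  obtain ⟨N, hN⟩ := exists_pow_lt_of_lt_one hr (show (1 / 2 : ℝ) < 1 by norm_num)
  obtain ⟨k₀, hk₀⟩ := eventually_atTop.1 (h.eventually (lt_mem_nhds hN))
  -- A zero value would make the quotient `0` by convention, below `(1/2) ^ N`.
  have hpos : ∀ k, k₀ ≤ k → 0 < u k := by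
    intro k hk
    refine lt_of_le_of_ne (hu k) fun h0 => ?_
    have := hk₀ k hk
    rw [← h0, div_zero] at this
    exact absurd this (not_lt.2 (by positivity))
  have hstep : ∀ j, ((1 / 2 : ℝ) ^ N) ^ j * u k₀ ≤ u (k₀ + j) := by
    intro j
    induction j with
    | zero => simp
    | succ j ih =>
      have h1 := hk₀ (k₀ + j) (by omega)
      rw [lt_div_iff₀ (hpos _ (by omega))] at h1
      rw [pow_succ, ← add_assoc]
      nlinarith [pow_pos (show (0 : ℝ) < 1 / 2 by norm_num) N]
  refine ⟨N + 1, ?_⟩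
  have hcu : 0 < c * u k₀ := mul_pos hc (hpos k₀ le_rfl)
  have hlim : Tendsto (fun k : ℕ => (1 / 2 : ℝ) ^ k) atTop (𝓝 0) :=
    tendsto_pow_atTop_nhds_zero_of_lt_one (by norm_num) (by norm_num)
  filter_upwards [hlim.eventually (gt_mem_nhds hcu), eventually_ge_atTop k₀] with k hk hk0
  obtain ⟨j, rfl⟩ : ∃ j, k = k₀ + j := ⟨k - k₀, by omega⟩
  calc 1 / ((2 : ℝ) ^ (k₀ + j)) ^ (N + 1)
      = ((1 / 2 : ℝ) ^ N) ^ (k₀ + j) * (1 / 2 : ℝ) ^ (k₀ + j) := by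
        rw [← pow_mul, ← pow_mul, ← pow_add, one_div, one_div, inv_pow]
        congr 2
        ring
    _ ≤ ((1 / 2 : ℝ) ^ N) ^ j * (c * u k₀) := by
        refine mul_le_mul ?_ hk.le (by positivity) (by positivity)
        exact pow_le_pow_of_le_one (by positivity) (pow_le_one₀ (by norm_num) (by norm_num))
          (by omega)
    _ = c * (((1 / 2 : ℝ) ^ N) ^ j * u k₀) := by ring
    _ ≤ c * u (k₀ + j) := by gcongr; exact hstep j

/-- The block is the difference of consecutive dyadic tails, whose ratio tends to `2 ^ (-α) < 1`, so
it keeps a fixed proportion of the tail. -/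
lemma dyadicMass_of_tail {α : ℝ} (hα : 0 < α) {l : ℝ≥0 → ℝ≥0} (hl : SlowlyVarying l)
    (hν : ∀ n : ℕ, 1 ≤ n → ν.real (Set.Ici (n : ℤ)) = (n : ℝ) ^ (-α) * (l (n : ℝ≥0) : ℝ)) :
    DyadicMass ν := by
  have hlim := tendsto_dyadic_ratio (f := fun n => ν.real (Set.Ici (n : ℤ))) hl hν
  set r : ℝ := 2 ^ (-α) with hr
  have hr0 : 0 < r := by positivity
  have hr1 : r < 1 := Real.rpow_lt_one_of_one_lt_of_neg (by norm_num) (by linarith)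
  obtain ⟨κ, hκ⟩ := exists_dyadic_lower_bound (u := fun k => ν.real (Set.Ici ((2 ^ k : ℕ) : ℤ)))
    (fun _ => measureReal_nonneg) hr0 hlim (c := (1 - r) / 2) (by linarith)
  obtain ⟨k₁, hk₁⟩ := eventually_atTop.1
    (hκ.and (hlim.eventually (gt_mem_nhds (show r < (1 + r) / 2 by linarith))))
  refine ⟨κ, k₁, fun k hk => ?_⟩
  obtain ⟨h1, h2⟩ := hk₁ k hk
  have hu0 : 0 < ν.real (Set.Ici ((2 ^ k : ℕ) : ℤ)) := by
    refine lt_of_le_of_ne measureReal_nonneg fun h0 => ?_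
    rw [← h0, mul_zero] at h1
    exact absurd h1 (not_le.2 (by positivity))
  rw [div_lt_iff₀ hu0] at h2
  have hdiff : ν.real (Set.Ico ((2 : ℤ) ^ k) (2 ^ (k + 1))) =
      ν.real (Set.Ici ((2 ^ k : ℕ) : ℤ)) - ν.real (Set.Ici ((2 ^ (k + 1) : ℕ) : ℤ)) := by
    rw [← measureReal_sdiff _ MeasurableSet.of_discrete]
    · push_cast
      rw [Set.Ici_sdiff_Ici]
    · refine Set.Ici_subset_Ici.2 ?_
      push_cast
      exact pow_le_pow_right₀ (by norm_num) (by omega)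
  rw [hdiff]
  nlinarith

lemma HLoc.dyadicMass (h : HLoc ν) : DyadicMass ν := by
  obtain ⟨l, hl, hν⟩ := h
  obtain ⟨κ, hκ⟩ := exists_dyadic_lower_bound (u := fun k => ν.real {((2 ^ k : ℕ) : ℤ)})
    (fun _ => measureReal_nonneg) (by positivity)
    (tendsto_dyadic_ratio (f := fun n => ν.real {(n : ℤ)}) hl hν) one_pos
  obtain ⟨k₁, hk₁⟩ := eventually_atTop.1 hκ
  refine ⟨κ, k₁, fun k hk => (hk₁ k hk).trans ?_⟩
  rw [one_mul]
  refine measureReal_mono (Set.singleton_subset_iff.2 ⟨?_, ?_⟩) (measure_ne_top _ _)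
  · push_cast
    exact le_rfl
  · push_cast
    exact pow_lt_pow_right₀ (by norm_num) (by omega)

lemma HTail.dyadicMass {α : ℝ} (hα : 0 < α) (h : HTail α ν) (h2 : ¬ FiniteVariance ν) :
    DyadicMass ν := by
  rcases h with ⟨l, hl, hν⟩ | ⟨-, hfv⟩
  · exact dyadicMass_of_tail hα hl hν
  · exact absurd hfv h2

/-! ### The left tail at the scale of the walk -/

/-- A law carried by `[-C, ∞)` has Laplace transform at most `exp (C t)`, against superlinear growth
of `ψ`. -/
lemma HasLaplaceExponent.real_Iio_pos {μ : Measure ℝ} [IsProbabilityMeasure μ] {ψ : ℝ → ℝ}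
    (hμ : HasLaplaceExponent μ ψ) (hψ : ∀ C : ℝ, ∃ t, 0 < t ∧ C * t < ψ t) (C : ℝ) :
    0 < μ.real (Set.Iio (-C)) := by
  refine lt_of_le_of_ne measureReal_nonneg fun h0 => ?_
  have h0' := (measureReal_eq_zero_iff (measure_ne_top _ _)).1 h0.symm
  obtain ⟨t, ht, htC⟩ := hψ C
  obtain ⟨hint, heq⟩ := hμ t ht
  have hle : ∫ y, Real.exp (-t * y) ∂μ ≤ ∫ _, Real.exp (C * t) ∂μ := by
    refine integral_mono_ae hint (integrable_const _) ?_
    have : ∀ᵐ y ∂μ, -C ≤ y := by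
      rw [ae_iff]
      simp only [not_le]
      exact h0'
    filter_upwards [this] with y hy
    refine Real.exp_le_exp.2 ?_
    nlinarith
  rw [heq] at hle
  simp only [integral_const, probReal_univ, smul_eq_mul, one_mul, Real.exp_le_exp] at hle
  linarith

/-- With `b_n ≤ 0`, the centring only pushes the walk further to the left. -/
lemma ScalesTo.leftTail {a b : ℕ → ℝ} {ψ : ℝ → ℝ} (h : ScalesTo ν a b ψ)
    (hψ : ∀ C : ℝ, ∃ t, 0 < t ∧ C * t < ψ t) (hb : ∀ᶠ n in atTop, b n ≤ 0) :
    LeftTail ν a := by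
  obtain ⟨ha, μ, _, hμ, hlim⟩ := h
  intro C
  have hpos := hμ.real_Iio_pos hψ C
  refine ⟨μ.real (Set.Iio (-C)) / 2, half_pos hpos, ?_⟩
  filter_upwards [eventually_lt_real_of_tendstoInDistribution hlim isOpen_Iio
    (half_lt_self hpos), hb, eventually_ge_atTop 1] with n hn hbn hn1
  refine hn.le.trans (measureReal_mono (fun x hx => ?_) (measure_ne_top _ _))
  have hx' : ((walk x n : ℝ) - b n) / a n < -C := hx
  rw [div_lt_iff₀ (ha n hn1)] at hx'
  show (walk x n : ℝ) ≤ -(C * a n)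
  linarith

lemma exists_lt_rpow {α : ℝ} (hα : 1 < α) (C : ℝ) : ∃ t : ℝ, 0 < t ∧ C * t < t ^ α := by
  obtain ⟨t, ht, ht0⟩ := (((tendsto_rpow_atTop (sub_pos.2 hα)).eventually_gt_atTop C).and
    (eventually_gt_atTop 0)).exists
  refine ⟨t, ht0, ?_⟩
  calc C * t < t ^ (α - 1) * t := by gcongr
    _ = t ^ α := by rw [← Real.rpow_add_one ht0.ne', sub_add_cancel]

lemma exists_lt_mul_log (C : ℝ) : ∃ t : ℝ, 0 < t ∧ C * t < t * Real.log t := by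
  obtain ⟨t, ht, ht0⟩ := ((Real.tendsto_log_atTop.eventually_gt_atTop C).and
    (eventually_gt_atTop 0)).exists
  exact ⟨t, ht0, by rw [mul_comm]; gcongr⟩

/-- In the finite variance regime, scaling sequences are at most diffusive. -/
lemma FiniteVariance.scaling_le_sqrt (h2 : FiniteVariance ν) (hν : IsCentredJumpLaw ν) {a : ℕ → ℝ}
    (ha : ∀ n, 1 ≤ n → 0 < a n) (hleft : LeftTail ν a) :
    ∃ C : ℝ, 0 < C ∧ ∀ᶠ n : ℕ in atTop, a n ≤ C * √n := by
  -- Chebyshev against `P(S_n ≤ -a_n) ≥ c` gives `c ≤ n v / a_n²`.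
  obtain ⟨c, hc, hev⟩ := hleft 1
  set v := Var[fun k : ℤ => (k : ℝ); ν] with hv
  have hv0 : 0 < v := hν.variance_pos h2
  have hvar : ∀ n : ℕ, Var[fun x : ℕ → ℤ => (walk x n : ℝ); jumpsLaw ν] = n * v := by
    intro n
    have h := IndepFun.variance_sum (s := Finset.range n)
      (X := fun (i : ℕ) (x : ℕ → ℤ) => (x i : ℝ)) (μ := jumpsLaw ν)
      (fun i _ => h2.memLp_eval i)
      (fun i _ j _ hij => (iIndepFun_comp_eval ν (fun k : ℤ => (k : ℝ))).indepFun hij)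
    have hsum : (∑ i ∈ Finset.range n, fun x : ℕ → ℤ => (x i : ℝ)) =
        fun x : ℕ → ℤ => (walk x n : ℝ) := by
      ext x
      simp [walk]
    rw [hsum] at h
    rw [h, Finset.sum_congr rfl fun i _ => variance_comp_eval (ν := ν) (fun k : ℤ => (k : ℝ)) i]
    simp [hv]
  refine ⟨√(v / c), Real.sqrt_pos.2 (by positivity), ?_⟩
  filter_upwards [hev, eventually_ge_atTop 1] with n hn hn1
  have han := ha n hn1
  have hmem : MemLp (fun x : ℕ → ℤ => (walk x n : ℝ)) 2 (jumpsLaw ν) := by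
    simp only [cast_walk]
    exact memLp_finsetSum _ fun i _ => h2.memLp_eval i
  have hcheb := meas_ge_le_variance_div_sq hmem han
  rw [hν.integral_walk, hvar] at hcheb
  have h1 : c ≤ n * v / a n ^ 2 := by
    have h3 := hn.trans (measureReal_mono
      (s₂ := {x : ℕ → ℤ | a n ≤ |(walk x n : ℝ) - 0|}) (fun x hx => ?_) (measure_ne_top _ _))
    · exact h3.trans (ENNReal.toReal_le_of_le_ofReal (by positivity) hcheb)
    · have hx' : (walk x n : ℝ) ≤ -(1 * a n) := hx
      show a n ≤ |(walk x n : ℝ) - 0|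
      rw [sub_zero, abs_of_nonpos (by linarith)]
      linarith
  rw [le_div_iff₀ (by positivity)] at h1
  rw [← Real.sqrt_mul (by positivity)]
  refine Real.le_sqrt_of_sq_le ?_
  rw [div_mul_eq_mul_div, le_div_iff₀ hc]
  linarith

end Tails

/-! ### The centring sequence in the Cauchy regime -/

section Cauchy

set_option linter.unusedSectionVars false

lemma exists_lt_real_Ioo {μ : Measure ℝ} [IsProbabilityMeasure μ] {η : ℝ} (hη : η < 1) :
    ∃ M : ℝ, 0 < M ∧ η < μ.real (Set.Ioo (-M) M) := by
  have hmono : Monotone fun k : ℕ => Set.Ioo (-((k : ℝ) + 1)) ((k : ℝ) + 1) := by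
    intro k l hkl
    have : (k : ℝ) ≤ l := by exact_mod_cast hkl
    exact Set.Ioo_subset_Ioo (by linarith) (by linarith)
  have hU : ⋃ k : ℕ, Set.Ioo (-((k : ℝ) + 1)) ((k : ℝ) + 1) = Set.univ := by
    refine Set.eq_univ_of_forall fun x => Set.mem_iUnion.2 ?_
    obtain ⟨k, hk⟩ := exists_nat_ge |x|
    have := abs_le.1 hk
    exact ⟨k, by constructor <;> linarith⟩
  have h := tendsto_measure_iUnion_atTop (μ := μ) hmono
  rw [hU, measure_univ] at h
  have h' := (ENNReal.tendsto_toReal ENNReal.one_ne_top).comp h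
  obtain ⟨k, hk⟩ := (h'.eventually (lt_mem_nhds (show η < (1 : ENNReal).toReal by simpa))).exists
  exact ⟨k + 1, by positivity, hk⟩

lemma exists_pos_real_Ioi_pos {μ : Measure ℝ} [IsProbabilityMeasure μ]
    (h : 0 < μ.real (Set.Ioi 0)) : ∃ y : ℝ, 0 < y ∧ 0 < μ.real (Set.Ioi y) := by
  by_contra! hcon
  refine h.ne' ((measureReal_eq_zero_iff (measure_ne_top _ _)).2 ?_)
  refine measure_mono_null (t := ⋃ k : ℕ, Set.Ioi (1 / ((k : ℝ) + 1))) (fun x hx => ?_)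
    (measure_iUnion_null fun k => ?_)
  · obtain ⟨k, hk⟩ := exists_nat_one_div_lt (show (0 : ℝ) < x from hx)
    exact Set.mem_iUnion.2 ⟨k, hk⟩
  · exact (measureReal_eq_zero_iff (measure_ne_top _ _)).1
      (le_antisymm (hcon _ (by positivity)) measureReal_nonneg)

lemma exists_mem_inter_of_one_lt {Ω : Type*} [MeasurableSpace Ω] {P : Measure Ω}
    [IsProbabilityMeasure P] {s t : Set Ω} (ht : MeasurableSet t) (h : 1 < P.real s + P.real t) :
    ∃ ω, ω ∈ s ∧ ω ∈ t := by
  by_contra! hcon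
  have hd : Disjoint s t := Set.disjoint_left.2 hcon
  rw [← measureReal_union hd ht] at h
  exact absurd h (not_lt.2 measureReal_le_one)

/-- A nonpositive variable has Laplace transform at least `1`, whereas `t log t < 0` at `t = 1/2`.
-/
lemma HasLaplaceExponent.real_Ioi_zero_pos {μ : Measure ℝ} [IsProbabilityMeasure μ]
    (hμ : HasLaplaceExponent μ fun t => t * Real.log t) : 0 < μ.real (Set.Ioi 0) := by
  refine lt_of_le_of_ne measureReal_nonneg fun h0 => ?_
  have h0' := (measureReal_eq_zero_iff (measure_ne_top _ _)).1 h0.symm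
  obtain ⟨hint, heq⟩ := hμ (1 / 2) (by norm_num)
  have hle : ∫ _, (1 : ℝ) ∂μ ≤ ∫ y, Real.exp (-(1 / 2) * y) ∂μ := by
    refine integral_mono_ae (integrable_const _) hint ?_
    have : ∀ᵐ y ∂μ, y ≤ 0 := by
      rw [ae_iff]
      simp only [not_le]
      exact h0'
    filter_upwards [this] with y hy
    refine Real.one_le_exp ?_
    linarith
  rw [heq] at hle
  simp only [integral_const, probReal_univ, smul_eq_mul, mul_one, Real.one_le_exp_iff] at hle
  have : Real.log (1 / 2) < 0 := Real.log_neg (by norm_num) (by norm_num)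
  linarith

/-- A spectrally positive Cauchy law is not the law of `r (X + X') + s` with `s ≥ 0`. -/
lemma HasLaplaceExponent.ne_affine_map_prod {μ : Measure ℝ} [IsProbabilityMeasure μ]
    (hμ : HasLaplaceExponent μ fun t => t * Real.log t) {r s : ℝ} (hr : 0 ≤ r) (hs : 0 ≤ s)
    (h : μ = (μ.prod μ).map fun p : ℝ × ℝ => r * (p.1 + p.2) + s) : False := by
  have key : ∀ t : ℝ, 0 < t → t * Real.log t = 2 * (r * t * Real.log (r * t)) - t * s := by
    intro t ht
    have hone : ∫ u, Real.exp (-(r * t) * u) ∂μ = Real.exp (r * t * Real.log (r * t)) := by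
      rcases hr.eq_or_lt with rfl | hr'
      · simp
      · exact (hμ (r * t) (by positivity)).2
    have h1 := (hμ t ht).2
    rw [h, integral_map (by fun_prop) (by fun_prop)] at h1
    have h2 : ∀ p : ℝ × ℝ, Real.exp (-t * (r * (p.1 + p.2) + s)) =
        Real.exp (-(t * s)) * (Real.exp (-(r * t) * p.1) * Real.exp (-(r * t) * p.2)) := by
      intro p
      rw [← Real.exp_add, ← Real.exp_add]
      congr 1
      ring
    simp only [h2] at h1
    rw [integral_const_mul, integral_prod_mul (fun u => Real.exp (-(r * t) * u))
      (fun u => Real.exp (-(r * t) * u)), hone, ← Real.exp_add, ← Real.exp_add] at h1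
    have := Real.exp_injective h1
    linarith
  -- Where `r > 0`, `t = 1` gives `s = 2 r log r`, and subtracting this from `t = e` gives `r =
  -- 1/2`; hence `s = -log 2`, a contradiction. The degenerate limit `r = 0` is excluded separately.
  have k1 := key 1 one_pos
  have k2 := key (Real.exp 1) (Real.exp_pos 1)
  simp only [Real.log_one, mul_zero, mul_one, one_mul, Real.log_exp] at k1 k2
  rcases hr.eq_or_lt with rfl | hr'
  · simp only [zero_mul, Real.log_zero, mul_zero, zero_sub] at k1 k2
    have := Real.exp_pos 1
    nlinarith
  · rw [Real.log_mul hr'.ne' (Real.exp_pos 1).ne', Real.log_exp] at k2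
    have he := Real.exp_pos 1
    have k3 : Real.exp 1 * (2 * r * (Real.log r + 1) - s - 1) = 0 := by linarith
    have k4 : 2 * r * (Real.log r + 1) - s - 1 = 0 := by
      rcases mul_eq_zero.1 k3 with h0 | h0
      · exact absurd h0 he.ne'
      · exact h0
    have k5 : r = 1 / 2 := by linarith
    have : Real.log (1 / 2) < 0 := Real.log_neg (by norm_num) (by norm_num)
    rw [k5] at k1
    linarith

variable {ν : Measure ℤ} [IsProbabilityMeasure ν]

/-- Weak law of large numbers for the walk. -/
lemma IsCentredJumpLaw.tendsto_real_mul_le_walk (hν : IsCentredJumpLaw ν) {ε : ℝ} (hε : 0 < ε) :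
    Tendsto (fun m : ℕ => (jumpsLaw ν).real {x | ε * m ≤ (walk x m : ℝ)}) atTop (𝓝 0) := by
  have hsl := strong_law_ae_real (μ := jumpsLaw ν) (fun (i : ℕ) (x : ℕ → ℤ) => (x i : ℝ))
    (integrable_comp_eval ν hν.integrable 0)
    (fun i j hij => (iIndepFun_comp_eval ν (fun k : ℤ => (k : ℝ))).indepFun hij)
    (fun i => identDistrib_comp_eval ν (fun k : ℤ => (k : ℝ)) i 0)
  rw [integral_comp_eval ν (fun k : ℤ => (k : ℝ)), hν.mean_zero] at hsl
  simp only [← cast_walk] at hsl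
  have hmeas : ∀ n : ℕ, Measurable fun x : ℕ → ℤ => (walk x n : ℝ) / n := fun n =>
    (measurable_of_countable fun k : ℤ => (k : ℝ) / n).comp (measurable_walk n)
  have htm := tendstoInMeasure_of_tendsto_ae (fun n => (hmeas n).aestronglyMeasurable) hsl
    (ENNReal.ofReal ε) (ENNReal.ofReal_pos.2 hε)
  have htm' := (ENNReal.tendsto_toReal ENNReal.zero_ne_top).comp htm
  rw [ENNReal.toReal_zero] at htm'
  refine squeeze_zero' (Eventually.of_forall fun m => measureReal_nonneg) ?_ htm'
  filter_upwards [eventually_ge_atTop 1] with m hm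
  have hm' : (0 : ℝ) < m := by exact_mod_cast hm
  refine measureReal_mono (fun x hx => ?_) (measure_ne_top _ _)
  have hx' : ε * m ≤ (walk x m : ℝ) := hx
  show ENNReal.ofReal ε ≤ edist ((walk x m : ℝ) / m) 0
  rw [edist_dist, Real.dist_eq, sub_zero]
  refine ENNReal.ofReal_le_ofReal (le_trans ?_ (le_abs_self _))
  rwa [le_div_iff₀ hm']

/-- Write `S_{2n}` as two independent copies of `S_n`. If `s_n = (2 b_n - b_{2n}) / a_{2n}` were
positive infinitely often, tightness would bound `s_n` and `r_n = a_n / a_{2n}`; a subsequential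
limit would then identify `μ` with the law of `r (X + X') + s`, `s ≥ 0`. -/
lemma eventually_two_mul_centring_le {a b : ℕ → ℝ} (ha : ∀ n, 1 ≤ n → 0 < a n)
    {μ : Measure ℝ} [IsProbabilityMeasure μ] (hμ : HasLaplaceExponent μ fun t => t * Real.log t)
    (hlim : TendstoInDistribution
        (fun (n : ℕ) (x : ℕ → ℤ) => ((walk x n : ℝ) - b n) / a n) atTop
        (id : ℝ → ℝ) (fun _ => jumpsLaw ν) μ) :
    ∀ᶠ n in atTop, 2 * b n ≤ b (2 * n) := by
  set P := jumpsLaw ν with hP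
  set X : ℕ → (ℕ → ℤ) → ℝ := fun n x => ((walk x n : ℝ) - b n) / a n with hX
  have hXm : ∀ n, Measurable (X n) := fun n =>
    (measurable_of_countable fun k : ℤ => ((k : ℝ) - b n) / a n).comp (measurable_walk n)
  set r : ℕ → ℝ := fun n => a n / a (2 * n) with hr
  set s : ℕ → ℝ := fun n => (2 * b n - b (2 * n)) / a (2 * n) with hs
  have hdecomp : ∀ n, 1 ≤ n → ∀ y z : ℕ → ℤ,
      X (2 * n) (concat n y z) = r n * (X n y + X n z) + s n := by
    intro n hn y z
    have h1 := (ha n hn).ne'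
    have h2 := (ha (2 * n) (by omega)).ne'
    have h3 := walk_concat n n y z
    rw [← two_mul] at h3
    simp only [hX, hr, hs, h3]
    push_cast
    field_simp
    ring
  by_contra hcon
  -- along a subsequence, `s n > 0`
  have hfreq : ∃ᶠ n in atTop, 0 < s n ∧ 1 ≤ n := by
    refine ((not_eventually.1 hcon).and_eventually (eventually_ge_atTop 1)).mono ?_
    rintro n ⟨h1, h2⟩
    exact ⟨div_pos (by linarith) (ha _ (by omega)), h2⟩
  -- tightness
  obtain ⟨y₀, hy₀, hc⟩ := exists_pos_real_Ioi_pos hμ.real_Ioi_zero_pos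
  set c := μ.real (Set.Ioi y₀) / 2 with hcdef
  have hc0 : 0 < c := half_pos hc
  have hc1 : c * c < 1 := by
    have : c < 1 := by
      have : μ.real (Set.Ioi y₀) ≤ 1 := measureReal_le_one
      linarith
    nlinarith
  -- The levels are such that `c² + (1 - c²)` and `(9/10)² + 9/10` are at least `1`, with room, so
  -- that the events for the halves and for the whole must meet. A common point bounds `r n`, then
  -- `s n`.
  obtain ⟨M, hM, hMμ⟩ := exists_lt_real_Ioo (μ := μ) (η := max (1 - c * c) (9 / 10))
    (max_lt (by nlinarith) (by norm_num))
  have hev1 := eventually_lt_real_of_tendstoInDistribution hlim isOpen_Ioi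
    (show c < μ.real (Set.Ioi y₀) from half_lt_self hc)
  have hev2 := eventually_lt_real_of_tendstoInDistribution hlim isOpen_Ioo hMμ
  have h2n : Tendsto (fun n : ℕ => 2 * n) atTop atTop :=
    tendsto_id.const_mul_atTop' (by norm_num)
  have hprodreal : ∀ (n : ℕ) (S : Set ℝ), MeasurableSet S →
      (P.prod P).real {p | X n p.1 ∈ S ∧ X n p.2 ∈ S} =
        P.real {x | X n x ∈ S} * P.real {x | X n x ∈ S} := by
    intro n S _
    exact measureReal_prod_prod {x | X n x ∈ S} {x | X n x ∈ S}
  have hconcreal : ∀ (n : ℕ) (S : Set ℝ), MeasurableSet S →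
      (P.prod P).real {p | X n (concat (n / 2) p.1 p.2) ∈ S} = P.real {x | X n x ∈ S} := by
    intro n S hS
    conv_rhs => rw [hP, ← map_concat ν (n / 2)]
    exact (map_measureReal_apply (measurable_concat _) ((hXm n) hS)).symm
  set Bd := {p : ℝ × ℝ | p.1 ∈ Set.Icc 0 (M / (2 * y₀)) ∧
    p.2 ∈ Set.Icc 0 (M + M / (2 * y₀) * (2 * M))} with hBd
  have hbd : ∀ᶠ n in atTop, 0 < s n → (r n, s n) ∈ Bd := by
    filter_upwards [hev1, hev2, h2n.eventually hev2, eventually_ge_atTop 1] with n h1 h2 h3 hn hsn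
    have hr0 : 0 < r n := div_pos (ha n hn) (ha _ (by omega))
    have hE3m : MeasurableSet {p : (ℕ → ℤ) × (ℕ → ℤ) |
        X (2 * n) (concat (2 * n / 2) p.1 p.2) ∈ Set.Ioo (-M) M} :=
      ((hXm _).comp (measurable_concat _)) measurableSet_Ioo
    have hE3 := hconcreal (2 * n) (Set.Ioo (-M) M) measurableSet_Ioo
    have hhalf : 2 * n / 2 = n := by omega
    have hrM : r n ≤ M / (2 * y₀) := by
      obtain ⟨⟨y, z⟩, hp1, hp2⟩ := exists_mem_inter_of_one_lt (P := P.prod P)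
        (s := {p | X n p.1 ∈ Set.Ioi y₀ ∧ X n p.2 ∈ Set.Ioi y₀}) hE3m (by
          rw [hprodreal n _ measurableSet_Ioi, hE3]
          have h4 : 1 - c * c < P.real {x | X (2 * n) x ∈ Set.Ioo (-M) M} :=
            (le_max_left _ _).trans_lt h3
          have h5 : c * c ≤ P.real {x | X n x ∈ Set.Ioi y₀} * P.real {x | X n x ∈ Set.Ioi y₀} :=
            mul_le_mul h1.le h1.le hc0.le measureReal_nonneg
          linarith)
      have hp2' : X (2 * n) (concat (2 * n / 2) y z) < M := hp2.2
      rw [hhalf, hdecomp n hn] at hp2'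
      have hy : y₀ < X n y := hp1.1
      have hz : y₀ < X n z := hp1.2
      rw [le_div_iff₀ (by positivity)]
      nlinarith
    refine ⟨⟨hr0.le, hrM⟩, hsn.le, ?_⟩
    obtain ⟨⟨y, z⟩, hp1, hp2⟩ := exists_mem_inter_of_one_lt (P := P.prod P)
      (s := {p | X n p.1 ∈ Set.Ioo (-M) M ∧ X n p.2 ∈ Set.Ioo (-M) M}) hE3m (by
        rw [hprodreal n _ measurableSet_Ioo, hE3]
        have h4 : 9 / 10 < P.real {x | X (2 * n) x ∈ Set.Ioo (-M) M} :=
          (le_max_right _ _).trans_lt h3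
        have h5 : 9 / 10 < P.real {x | X n x ∈ Set.Ioo (-M) M} :=
          (le_max_right _ _).trans_lt h2
        nlinarith)
    have hp2' : X (2 * n) (concat (2 * n / 2) y z) < M := hp2.2
    rw [hhalf, hdecomp n hn] at hp2'
    have hy : -M < X n y := hp1.1.1
    have hz : -M < X n z := hp1.2.1
    have h6 : r n * (2 * M) ≤ M / (2 * y₀) * (2 * M) := by gcongr
    nlinarith
  have hBb : Bornology.IsBounded Bd := by
    have : Bd = Set.Icc 0 (M / (2 * y₀)) ×ˢ Set.Icc 0 (M + M / (2 * y₀) * (2 * M)) := rfl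
    rw [this]
    exact (Metric.isBounded_Icc _ _).prod (Metric.isBounded_Icc _ _)
  have hfreq' : ∃ᶠ n in atTop, (r n, s n) ∈ Bd ∧ 1 ≤ n :=
    (hfreq.and_eventually hbd).mono fun n h => ⟨h.2 h.1.1, h.1.2⟩
  obtain ⟨φ, hφ, hφB⟩ := extraction_of_frequently_atTop hfreq'
  obtain ⟨⟨r', s'⟩, hmem, θ, hθ, hlimrs⟩ :=
    tendsto_subseq_of_bounded hBb (x := fun k => (r (φ k), s (φ k))) fun k => (hφB k).1
  have hBc : IsClosed Bd := by
    have : Bd = Set.Icc 0 (M / (2 * y₀)) ×ˢ Set.Icc 0 (M + M / (2 * y₀) * (2 * M)) := rfl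
    rw [this]
    exact isClosed_Icc.prod isClosed_Icc
  rw [hBc.closure_eq] at hmem
  set N : ℕ → ℕ := fun k => φ (θ k) with hN
  have hNlim : Tendsto N atTop atTop := (hφ.comp hθ).tendsto_atTop
  -- the pair of rescaled halves converges in distribution
  have hpair : TendstoInDistribution
      (fun (k : ℕ) (p : (ℕ → ℤ) × (ℕ → ℤ)) => (X (N k) p.1, X (N k) p.2)) atTop
      (id : ℝ × ℝ → ℝ × ℝ) (fun _ => P.prod P) (μ.prod μ) := by
    refine ⟨fun k => (((hXm _).comp measurable_fst).prodMk
      ((hXm _).comp measurable_snd)).aemeasurable, aemeasurable_id, ?_⟩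
    have hone := hlim.tendsto.comp hNlim
    have hprod := (ProbabilityMeasure.continuous_prod.tendsto _).comp (hone.prodMk_nhds hone)
    have hlim' : (⟨(μ.prod μ).map id, Measure.isProbabilityMeasure_map aemeasurable_id⟩ :
        ProbabilityMeasure (ℝ × ℝ)) =
        ProbabilityMeasure.prod ⟨μ.map id, Measure.isProbabilityMeasure_map aemeasurable_id⟩
          ⟨μ.map id, Measure.isProbabilityMeasure_map aemeasurable_id⟩ :=
      Subtype.ext (by simp; rfl)
    rw [hlim']
    refine hprod.congr fun k => Subtype.ext ?_
    exact Measure.map_prod_map P P (hXm _) (hXm _)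
  -- Slutsky: the coefficients converge to constants along the subsequence.
  have hslut := hpair.continuous_comp_prodMk_of_tendstoInMeasure_const
    (g := fun q : (ℝ × ℝ) × (ℝ × ℝ) => q.2.1 * (q.1.1 + q.1.2) + q.2.2) (by fun_prop)
    (Y := fun k _ => (r (N k), s (N k))) (c := (r', s'))
    (tendstoInMeasure_of_tendsto_ae (fun k => aestronglyMeasurable_const)
      (ae_of_all _ fun _ => hlimrs)) (fun k => aemeasurable_const)
  have hdouble : TendstoInDistribution
      (fun (k : ℕ) (p : (ℕ → ℤ) × (ℕ → ℤ)) => r (N k) * (X (N k) p.1 + X (N k) p.2) + s (N k))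
      atTop (id : ℝ → ℝ) (fun _ => P.prod P) μ := by
    refine ⟨hslut.forall_aemeasurable, aemeasurable_id, ?_⟩
    have hone := hlim.tendsto.comp (h2n.comp hNlim)
    refine hone.congr fun k => Subtype.ext ?_
    simp only [Function.comp]
    have hNk : 1 ≤ N k := (hφB (θ k)).2
    conv_lhs => rw [← map_concat ν (N k)]
    rw [Measure.map_map (hXm _) (measurable_concat _)]
    congr 1
    ext p
    exact hdecomp (N k) hNk p.1 p.2
  have huniq := tendstoInDistribution_unique _ hdouble hslut
  rw [Measure.map_id] at huniq
  exact hμ.ne_affine_map_prod hmem.1.1 hmem.2.1 huniq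

/-- In the Cauchy regime the centring sequence is eventually nonpositive. -/
lemma IsCentredJumpLaw.eventually_centring_nonpos (hν : IsCentredJumpLaw ν) {a b : ℕ → ℝ}
    (h : ScalesTo ν a b fun t => t * Real.log t) : ∀ᶠ n in atTop, b n ≤ 0 := by
  obtain ⟨ha, μ, _, hμ, hlim⟩ := h
  obtain ⟨N₀, hN₀⟩ := eventually_atTop.1 (eventually_two_mul_centring_le ha hμ hlim)
  filter_upwards [eventually_ge_atTop N₀, eventually_ge_atTop 1] with n hn hn1
  by_contra! hbn
  -- Iterated doubling: `b` grows at least linearly along `2 ^ k n`, so `S_m ≥ ε m` would keep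
  -- positive probability along that sequence.
  have hpow : ∀ k : ℕ, 2 ^ k * b n ≤ b (2 ^ k * n) := by
    intro k
    induction k with
    | zero => simp
    | succ k ih =>
      have h1 := hN₀ (2 ^ k * n) (hn.trans (Nat.le_mul_of_pos_left _ (by positivity)))
      rw [pow_succ, pow_succ, mul_comm (2 ^ k) 2, mul_comm (2 ^ k) 2, mul_assoc, mul_assoc]
      linarith
  have hn0 : (0 : ℝ) < n := by exact_mod_cast hn1
  set ε := b n / n with hε
  have hε0 : 0 < ε := div_pos hbn hn0
  have hsub : Tendsto (fun k : ℕ => 2 ^ k * n) atTop atTop :=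
    (tendsto_pow_atTop_atTop_of_one_lt (by norm_num)).atTop_mul_const' hn1
  have hpos := hμ.real_Ioi_zero_pos
  have h1 := hsub.eventually
    (eventually_lt_real_of_tendstoInDistribution hlim isOpen_Ioi (half_lt_self hpos))
  have h2 := hsub.eventually
    ((hν.tendsto_real_mul_le_walk hε0).eventually (gt_mem_nhds (half_pos hpos)))
  obtain ⟨k, hk1, hk2⟩ := (h1.and h2).exists
  refine absurd (hk1.le.trans (measureReal_mono (fun x hx => ?_) (measure_ne_top _ _)))
    (not_le.2 hk2)
  have hx' : 0 < ((walk x (2 ^ k * n) : ℝ) - b (2 ^ k * n)) / a (2 ^ k * n) := hx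
  have hak := ha (2 ^ k * n) (Nat.mul_pos (by positivity) hn1)
  have h3 := (div_pos_iff_of_pos_right hak).1 hx'
  show ε * ((2 ^ k * n : ℕ) : ℝ) ≤ (walk x (2 ^ k * n) : ℝ)
  have h4 : ε * ((2 ^ k * n : ℕ) : ℝ) = 2 ^ k * b n := by
    rw [hε]
    push_cast
    field_simp
  rw [h4]
  linarith [hpow k]

end Cauchy

/-! ### Concentration of the number of jumps -/

section Concentration

set_option linter.unusedSectionVars false

/-- Each length contributes a countable discrete piece, so every set of paths is measurable. -/
instance : DiscreteMeasurableSpace FinPath where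
  forall_measurableSet s := by
    refine MeasurableSpace.measurableSet_iInf.2 fun ℓ => ?_
    exact MeasurableSet.of_discrete (s := (fun v : Fin (ℓ + 1) → ℤ => (⟨ℓ, v⟩ : FinPath)) ⁻¹' s)

variable (ν : Measure ℤ) [IsProbabilityMeasure ν]

lemma state_snd_mono (A : Set ℤ) (x : ℕ → ℤ) {m n : ℕ} (h : m ≤ n) :
    (state A x m).2 ≤ (state A x n).2 := by
  rw [state_snd, state_snd]
  refine Finset.sum_le_sum_of_subset_of_nonneg (Finset.range_mono h) fun i _ _ => ?_
  exact Set.indicator_nonneg (fun _ _ => zero_le_one) _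

/-- The counts of the jumps in `A` and in `B` are proportional up to Gaussian deviations. -/
lemma real_le_abs_count_sub (A B : Set ℤ) (N : ℕ) {t : ℝ} (ht : 0 ≤ t) :
    (jumpsLaw ν).real {x | t ≤ |ν.real A * (state B x N).2 - ν.real B * (state A x N).2|} ≤
      2 * Real.exp (-t ^ 2 / (2 * N)) := by
  set f : ℤ → ℝ := fun k => ν.real A * B.indicator 1 k - ν.real B * A.indicator 1 k with hf
  have hA0 : 0 ≤ ν.real A := measureReal_nonneg
  have hA1 : ν.real A ≤ 1 := measureReal_le_one
  have hB0 : 0 ≤ ν.real B := measureReal_nonneg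
  have hB1 : ν.real B ≤ 1 := measureReal_le_one
  have hmem : ∀ k, f k ∈ Set.Icc (-1 : ℝ) 1 := fun k => by
    by_cases h1 : k ∈ A <;> by_cases h2 : k ∈ B <;> simp only [hf, h1, h2, Set.mem_Icc,
      Set.indicator_of_mem, Set.indicator_of_notMem, not_false_eq_true, Pi.one_apply] <;>
      constructor <;> linarith
  have hind : ∀ S : Set ℤ, Integrable (S.indicator (1 : ℤ → ℝ)) ν := fun S =>
    (integrable_const (1 : ℝ)).indicator MeasurableSet.of_discrete
  have hmean : ∫ k, f k ∂ν = 0 := by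
    rw [hf, integral_sub ((hind B).const_mul _) ((hind A).const_mul _), integral_const_mul,
      integral_const_mul, integral_indicator_one, integral_indicator_one]
    ring
  have hsum : ∀ x : ℕ → ℤ, ∑ i ∈ Finset.range N, f (x i) =
      ν.real A * (state B x N).2 - ν.real B * (state A x N).2 := fun x => by
    rw [cast_state_snd, cast_state_snd, Finset.mul_sum, Finset.mul_sum, ← Finset.sum_sub_distrib]
  have h1 := hoeffding ν hmem N ht
  have h2 := hoeffding ν (f := fun k => -f k) (lo := -1) (hi := 1)
    (fun k => ⟨by linarith [(hmem k).2], by linarith [(hmem k).1]⟩) N ht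
  rw [integral_neg, hmean] at h2
  rw [hmean] at h1
  simp only [sub_zero, neg_zero, hsum, Finset.sum_neg_distrib] at h1 h2
  have h3 : (2 * (N : ℝ) * ((1 - -1) / 2) ^ 2) = 2 * N := by ring
  rw [h3] at h1 h2
  have hsub : {x : ℕ → ℤ | t ≤ |ν.real A * (state B x N).2 - ν.real B * (state A x N).2|} ⊆
      {x | t ≤ ν.real A * (state B x N).2 - ν.real B * (state A x N).2} ∪
      {x | t ≤ -(ν.real A * (state B x N).2 - ν.real B * (state A x N).2)} :=
    fun x (hx : t ≤ |ν.real A * (state B x N).2 - ν.real B * (state A x N).2|) => by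
      simpa [Set.mem_union] using le_abs.1 hx
  refine (measureReal_mono hsub (measure_ne_top _ _)).trans ((measureReal_union_le _ _).trans ?_)
  linarith

/-- The paths for which the ratio of `n` and of the number of jumps in `B` is far from `ρ`. -/
def deviantPaths (B : Set ℤ) (ρ δ : ℝ) (n : ℕ) : Set FinPath :=
  {w | w.jumpCount B = 0 ∨
    δ / (n : ℝ) ^ (1 / 4 : ℝ) < |(n : ℝ) / (w.jumpCount B : ℝ) - ρ|}

/-- Here `s ^ 4` plays the role of `n`. If `J` is below half of its expected size, the linear
discrepancy is of order `s ^ 4`. Otherwise multiplying by `q J` turns the ratio error `δ / s` into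
one of order `s ^ 3`. -/
lemma deviant_abs_ge {p q δ s J : ℝ} (hp : 0 < p) (hq : 0 < q) (hδ : 0 < δ) (hs : 1 ≤ s)
    (h : J = 0 ∨ δ / s < |s ^ 4 / J - p / q|) :
    min (δ * q ^ 2 / (2 * p)) (q / 2) * s ^ 3 ≤ |p * J - q * s ^ 4| := by
  have hs0 : 0 < s := by linarith
  rcases lt_or_ge J (q * s ^ 4 / (2 * p)) with hlt | hge
  · rw [lt_div_iff₀ (by positivity)] at hlt
    calc _ ≤ q / 2 * s ^ 3 := by
          gcongr
          exact min_le_right _ _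
      _ ≤ q / 2 * s ^ 4 := by
          gcongr
          · norm_num
      _ ≤ -(p * J - q * s ^ 4) := by linarith
      _ ≤ _ := neg_le_abs _
  · have hJ0 : 0 < J := lt_of_lt_of_le (by positivity) hge
    have h' := h.resolve_left hJ0.ne'
    have heq : s ^ 4 / J - p / q = -(p * J - q * s ^ 4) / (q * J) := by
      field_simp
      ring
    rw [heq, abs_div, abs_neg, abs_of_pos (mul_pos hq hJ0), lt_div_iff₀ (mul_pos hq hJ0)] at h'
    calc _ ≤ δ * q ^ 2 / (2 * p) * s ^ 3 := by
          gcongr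
          exact min_le_left _ _
      _ = δ / s * (q * (q * s ^ 4 / (2 * p))) := by
          field_simp
      _ ≤ δ / s * (q * J) := by gcongr
      _ ≤ _ := h'.le

lemma exists_real_jumpEvent_inter_le {A B : Set ℤ} (hA : 0 < ν A) (hB : 0 < ν B) {δ : ℝ}
    (hδ : 0 < δ) : ∃ c : ℝ, 0 < c ∧ ∃ C : ℝ, 0 < C ∧ ∀ r n : ℕ, 1 ≤ n →
      (jumpsLaw ν).real (jumpEvent A r n ∩
        stoppedPath r ⁻¹' deviantPaths B (ν.real A / ν.real B) δ n) ≤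
      C * Real.exp (-c * (n : ℝ) ^ (1 / 2 : ℝ)) := by
  set p := ν.real A with hpdef
  set q := ν.real B with hqdef
  have hp : 0 < p := ENNReal.toReal_pos hA.ne' (measure_ne_top _ _)
  have hq : 0 < q := ENNReal.toReal_pos hB.ne' (measure_ne_top _ _)
  set c₁ := min (δ * q ^ 2 / (2 * p)) (q / 2) with hc₁
  have hc₁0 : 0 < c₁ := lt_min (by positivity) (by positivity)
  set c₂ := min (c₁ ^ 2 * p / 8) p with hc₂
  have hc₂0 : 0 < c₂ := lt_min (by positivity) hp
  refine ⟨c₂ / 2, half_pos hc₂0, (2 * (2 / p + 1) + 1) * (2 * (2 / c₂) ^ 2), by positivity, ?_⟩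
  intro r n hn
  set s : ℝ := (n : ℝ) ^ (1 / 4 : ℝ) with hs
  have hn1 : (1 : ℝ) ≤ n := by exact_mod_cast hn
  have hs1 : 1 ≤ s := Real.one_le_rpow hn1 (by norm_num)
  have hs0 : 0 < s := by linarith
  have hs4 : s ^ 4 = n := by
    rw [hs, ← Real.rpow_natCast, ← Real.rpow_mul (by positivity)]
    norm_num
  have hs2 : (n : ℝ) ^ (1 / 2 : ℝ) = s ^ 2 := by
    rw [hs, ← Real.rpow_natCast, ← Real.rpow_mul (by positivity)]
    norm_num
  -- If the hitting time exceeds `M`, at most `n ≤ p M / 2` jumps among the first `M` lie in `A`,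
  -- half of the mean.
  set M := ⌈2 * n / p⌉₊ with hM
  have hMge : 2 * n / p ≤ (M : ℝ) := Nat.le_ceil _
  have hMle : (M : ℝ) ≤ 2 * n / p + 1 := (Nat.ceil_lt_add_one (by positivity)).le
  set D : ℕ → Set (ℕ → ℤ) := fun N =>
    {x | c₁ * s ^ 3 ≤ |p * (state B x N).2 - q * (state A x N).2|} with hD
  have hsub : jumpEvent A r n ∩ stoppedPath r ⁻¹' deviantPaths B (p / q) δ n ⊆
      (⋃ N ∈ Finset.Icc 1 M, D N) ∪ {x | ((state A x M).2 : ℝ) ≤ p * M / 2} := by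
    rintro x ⟨hxA, hxB⟩
    rw [jumpEvent_eq] at hxA
    have hxA' : (state A x (hitTime r x)).2 = n := hxA
    have hxAR : ((state A x (hitTime r x)).2 : ℝ) = n := by rw [hxA']; rfl
    have hcount : (((stoppedPath r x).jumpCount B : ℕ) : ℝ) = (state B x (hitTime r x)).2 := by
      rw [← jumpCount_stoppedPath]
      rfl
    rcases le_or_gt (hitTime r x) M with hle | hgt
    · left
      have h0 : 1 ≤ hitTime r x := by
        rcases Nat.eq_zero_or_pos (hitTime r x) with h | h
        · rw [h] at hxA'
          simp [state] at hxA'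
          omega
        · exact h
      refine Set.mem_biUnion (Finset.mem_coe.2 (Finset.mem_Icc.2 ⟨h0, hle⟩)) ?_
      have hdev : (stoppedPath r x).jumpCount B = 0 ∨
        δ / s < |(n : ℝ) / ((stoppedPath r x).jumpCount B : ℝ) - p / q| := hxB
      have := deviant_abs_ge hp hq hδ hs1 (J := ((stoppedPath r x).jumpCount B : ℝ))
        (by rwa [hs4, Nat.cast_eq_zero])
      rw [hs4, hcount] at this
      simp only [hD, Set.mem_ofPred_eq]
      rwa [hxAR]
    · right
      have h1 : (state A x M).2 ≤ n := (state_snd_mono A x hgt.le).trans_eq hxA'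
      have h2 : ((state A x M).2 : ℝ) ≤ n := by exact_mod_cast h1
      rw [div_le_iff₀ hp] at hMge
      simp only [Set.mem_ofPred_eq]
      linarith
  have hDle : ∀ N ∈ Finset.Icc 1 M, (jumpsLaw ν).real (D N) ≤ 2 * Real.exp (-c₂ * s ^ 2) := by
    intro N hN
    obtain ⟨hN1, hNM⟩ := Finset.mem_Icc.1 hN
    refine (real_le_abs_count_sub ν A B N (by positivity)).trans ?_
    gcongr
    have hN0 : (0 : ℝ) < N := by exact_mod_cast hN1
    have hNs : (N : ℝ) * p ≤ 4 * s ^ 4 := by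
      have h1 : (N : ℝ) ≤ 2 * n / p + 1 := le_trans (by exact_mod_cast hNM) hMle
      have h2 : p ≤ 1 := measureReal_le_one
      have h3 : (N : ℝ) * p ≤ (2 * n / p + 1) * p := by gcongr
      have h4 : (2 * n / p + 1) * p = 2 * n + p := by field_simp
      rw [hs4]
      linarith
    rw [neg_mul, neg_div, neg_le_neg_iff, le_div_iff₀ (by positivity)]
    calc c₂ * s ^ 2 * (2 * N) ≤ c₁ ^ 2 * p / 8 * s ^ 2 * (2 * N) := by
          gcongr
          exact min_le_left _ _
      _ = c₁ ^ 2 / 4 * s ^ 2 * (N * p) := by ring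
      _ ≤ c₁ ^ 2 / 4 * s ^ 2 * (4 * s ^ 4) := by gcongr
      _ = (c₁ * s ^ 3) ^ 2 := by ring
  have hAle : (jumpsLaw ν).real {x | ((state A x M).2 : ℝ) ≤ p * M / 2} ≤
      Real.exp (-c₂ * s ^ 2) := by
    refine (real_state_snd_le ν A M).trans (Real.exp_le_exp.2 ?_)
    rw [neg_mul, neg_le_neg_iff, ← hpdef]
    rw [div_le_iff₀ hp] at hMge
    calc c₂ * s ^ 2 ≤ p * s ^ 4 := by
          gcongr
          · exact min_le_right _ _
          · norm_num
      _ ≤ p * (M * p / 2) := by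
          rw [hs4]
          gcongr
          linarith
      _ = _ := by ring
  have hunion : (jumpsLaw ν).real (jumpEvent A r n ∩ stoppedPath r ⁻¹' deviantPaths B (p / q) δ n) ≤
      M * (2 * Real.exp (-c₂ * s ^ 2)) + Real.exp (-c₂ * s ^ 2) := by
    refine (measureReal_mono hsub (measure_ne_top _ _)).trans
      ((measureReal_union_le _ _).trans (add_le_add ?_ hAle))
    refine (measureReal_biUnion_finset_le _ _).trans ((Finset.sum_le_sum hDle).trans_eq ?_)
    simp
  rw [hs2]
  -- Half of the exponent is spent on the `O(n)` terms of the union bound.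
  set y := c₂ / 2 * s ^ 2 with hy
  have hy0 : 0 ≤ y := by positivity
  have hsplit : Real.exp (-c₂ * s ^ 2) = Real.exp (-y) * Real.exp (-y) := by
    rw [← Real.exp_add]
    congr 1
    rw [hy]
    ring
  have hny : (n : ℝ) * Real.exp (-y) ≤ 2 * (2 / c₂) ^ 2 := by
    have h1 := Real.quadratic_le_exp_of_nonneg hy0
    have h2 : (n : ℝ) = (2 / c₂) ^ 2 * y ^ 2 := by
      rw [hy, ← hs4]
      field_simp
    rw [Real.exp_neg, ← div_eq_mul_inv, div_le_iff₀ (Real.exp_pos _), h2]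
    have h3 : y ^ 2 ≤ 2 * Real.exp y := by linarith
    calc (2 / c₂) ^ 2 * y ^ 2 ≤ (2 / c₂) ^ 2 * (2 * Real.exp y) := by gcongr
      _ = _ := by ring
  calc _ ≤ M * (2 * Real.exp (-c₂ * s ^ 2)) + Real.exp (-c₂ * s ^ 2) := hunion
    _ = (2 * M + 1) * Real.exp (-y) * Real.exp (-y) := by
        rw [hsplit]
        ring
    _ ≤ ((2 * (2 / p + 1) + 1) * n) * Real.exp (-y) * Real.exp (-y) := by
        gcongr
        have : (2 * n / p : ℝ) = 2 / p * n := by ring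
        nlinarith
    _ = (2 * (2 / p + 1) + 1) * (n * Real.exp (-y)) * Real.exp (-y) := by ring
    _ ≤ (2 * (2 / p + 1) + 1) * (2 * (2 / c₂) ^ 2) * Real.exp (-y) := by gcongr
    _ = _ := by rw [hy, neg_mul]

/-! ### Passage to the conditional laws -/

lemma measurableSet_jumpEvent (A : Set ℤ) (r n : ℕ) : MeasurableSet (jumpEvent A r n) :=
  measurable_stoppedPath r (MeasurableSet.of_discrete (s := {w : FinPath | w.jumpCount A = n}))

lemma condLaw_real (A : Set ℤ) (r n : ℕ) (S : Set FinPath) :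
    (condLaw ν A r n).real S =
      (jumpsLaw ν).real (jumpEvent A r n ∩ stoppedPath r ⁻¹' S) /
        (jumpsLaw ν).real (jumpEvent A r n) := by
  rw [condLaw, map_measureReal_apply (measurable_stoppedPath r) MeasurableSet.of_discrete,
    measureReal_def, cond_apply (measurableSet_jumpEvent A r n), ENNReal.toReal_mul,
    ENNReal.toReal_inv, div_eq_inv_mul]
  rfl

variable {ν}

/-- Exponential concentration under the conditional laws. -/
lemma exists_condLaw_real_le {A B : Set ℤ} (hA : 0 < ν A) (hB : 0 < ν B) {ϱ : ℕ → ℕ}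
    (hsub : SubexponentialJumpEvents ν A ϱ) {δ : ℝ} (hδ : 0 < δ) :
    ∃ c : ℝ, 0 < c ∧ ∃ C : ℝ, 0 < C ∧ ∀ n ∈ validTimes ν A ϱ,
      (condLaw ν A (ϱ n) n).real (deviantPaths B (ν.real A / ν.real B) δ n) ≤
        C * Real.exp (-c * (n : ℝ) ^ (1 / 2 : ℝ)) := by
  obtain ⟨c, hc, C, hC, hle⟩ := exists_real_jumpEvent_inter_le ν hA hB hδ
  -- The denominator is allowed to eat half of the exponent. For the finitely many `n < N` the
  -- constant is enlarged so that the bound exceeds `1`.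
  obtain ⟨N, hN⟩ := eventually_atTop.1 (hsub (c / 2) (half_pos hc))
  refine ⟨c / 2, half_pos hc, C + Real.exp (c / 2 * (N : ℝ) ^ (1 / 2 : ℝ)), by positivity, ?_⟩
  intro n hn
  rw [condLaw_real]
  rcases le_or_gt N n with hNn | hNn
  · have h1 := hN n hNn hn
    rw [Real.sqrt_eq_rpow] at h1
    rw [div_le_iff₀ (lt_of_lt_of_le (Real.exp_pos _) h1)]
    have h2 := hle (ϱ n) n hn.1
    set z := (n : ℝ) ^ (1 / 2 : ℝ)
    calc _ ≤ C * Real.exp (-c * z) := h2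
      _ = C * Real.exp (-(c / 2) * z) * Real.exp (-(c / 2) * z) := by
          rw [mul_assoc, ← Real.exp_add]
          congr 2
          ring
      _ ≤ (C + Real.exp (c / 2 * (N : ℝ) ^ (1 / 2 : ℝ))) * Real.exp (-(c / 2) * z) * _ := by
          gcongr
          exact le_add_of_nonneg_right (Real.exp_pos _).le
  · have h1 : (1 : ℝ) ≤ Real.exp (c / 2 * (N : ℝ) ^ (1 / 2 : ℝ)) *
        Real.exp (-(c / 2) * (n : ℝ) ^ (1 / 2 : ℝ)) := by
      rw [← Real.exp_add]
      refine Real.one_le_exp ?_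
      have : (n : ℝ) ^ (1 / 2 : ℝ) ≤ (N : ℝ) ^ (1 / 2 : ℝ) := by gcongr
      nlinarith
    refine (div_le_one_of_le₀ (measureReal_mono Set.inter_subset_left (measure_ne_top _ _))
      measureReal_nonneg).trans (h1.trans ?_)
    gcongr
    exact le_add_of_nonneg_left hC.le

lemma summable_exp_neg_mul_sqrt {c : ℝ} (hc : 0 < c) :
    Summable fun n : ℕ => Real.exp (-c * (n : ℝ) ^ (1 / 2 : ℝ)) := by
  refine (summable_nat_add_iff 1).1 (Summable.of_nonneg_of_le (fun _ => (Real.exp_pos _).le)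
    (fun n => ?_) (((summable_nat_add_iff 1).2
      (Real.summable_one_div_nat_pow.2 one_lt_two)).mul_left (24 / c ^ 4)))
  have hn0 : (0 : ℝ) < (n + 1 : ℕ) := by positivity
  rw [← Real.sqrt_eq_rpow, neg_mul, Real.exp_neg]
  have h1 := Real.pow_div_factorial_le_exp (c * √(n + 1 : ℕ)) (by positivity) 4
  have h2 : √((n + 1 : ℕ) : ℝ) ^ 4 = ((n + 1 : ℕ) : ℝ) ^ 2 := by
    rw [show 4 = 2 * 2 from rfl, pow_mul, Real.sq_sqrt hn0.le]
  rw [mul_pow, h2, show ((Nat.factorial 4 : ℕ) : ℝ) = 24 by norm_num [Nat.factorial]] at h1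
  rw [inv_le_comm₀ (Real.exp_pos _) (by positivity)]
  refine le_trans (le_of_eq ?_) h1
  field_simp

/-- Borel--Cantelli for random variables with prescribed laws. -/
lemma ae_eventually_notMem_of_hasLaw {Ω : Type*} [MeasurableSpace Ω] {P : Measure Ω}
    [IsProbabilityMeasure P] {V : Set ℕ} {L : ℕ → Measure FinPath} {W : ℕ → Ω → FinPath}
    (hW : ∀ n ∈ V, HasLaw (W n) (L n) P) {S : ℕ → Set FinPath} {u : ℕ → ℝ} (hu : Summable u)
    (hle : ∀ᶠ n in atTop, n ∈ V → (L n).real (S n) ≤ u n) :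
    ∀ᵐ ω ∂P, ∀ᶠ n in atTop ⊓ 𝓟 V, W n ω ∉ S n := by
  classical
  obtain ⟨N, hN⟩ := eventually_atTop.1 hle
  have hsum : ∑' n, P {ω | N ≤ n ∧ n ∈ V ∧ W n ω ∈ S n} ≠ ⊤ := by
    refine ne_top_of_le_ne_top hu.tsum_ofReal_ne_top (ENNReal.tsum_le_tsum fun n => ?_)
    by_cases hn : N ≤ n ∧ n ∈ V
    · have h1 : {ω | N ≤ n ∧ n ∈ V ∧ W n ω ∈ S n} = {ω | W n ω ∈ S n} := by
        ext ω
        simp [hn.1, hn.2]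
      have hprob : IsProbabilityMeasure (L n) := by
        rw [← (hW n hn.2).map_eq]
        exact Measure.isProbabilityMeasure_map (hW n hn.2).aemeasurable
      rw [h1, (hW n hn.2).measure_eq MeasurableSet.of_discrete,
        ← ofReal_measureReal (measure_ne_top _ _)]
      exact ENNReal.ofReal_le_ofReal (hN n hn.1 hn.2)
    · have h1 : {ω | N ≤ n ∧ n ∈ V ∧ W n ω ∈ S n} = ∅ := by
        ext ω
        simp only [Set.mem_ofPred_eq, Set.mem_empty_iff_false, iff_false]
        tauto
      rw [h1, measure_empty]
      exact zero_le
  filter_upwards [ae_eventually_notMem hsum] with ω hω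
  rw [eventually_inf_principal]
  filter_upwards [hω, eventually_ge_atTop N] with n hn hNn hnV hmem
  exact hn ⟨hNn, hnV, hmem⟩

/-- Almost sure convergence under the conditional laws. -/
lemma ae_tendsto_condLaw {A B : Set ℤ} (hA : 0 < ν A) {ϱ : ℕ → ℕ}
    (hsub : SubexponentialJumpEvents ν A ϱ) {Ω : Type*} [MeasurableSpace Ω] (P : Measure Ω)
    [IsProbabilityMeasure P] (W : ℕ → Ω → FinPath)
    (hW : ∀ n ∈ validTimes ν A ϱ, HasLaw (W n) (condLaw ν A (ϱ n) n) P) :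
    ∀ᵐ ω ∂P, Tendsto (fun n : ℕ => ((W n ω).jumpCount B : ℝ) / (n : ℝ))
      (atTop ⊓ 𝓟 (validTimes ν A ϱ)) (𝓝 (ν.real B / ν.real A)) := by
  have hp : 0 < ν.real A := ENNReal.toReal_pos hA.ne' (measure_ne_top _ _)
  rcases eq_or_ne (ν B) 0 with hB | hB
  -- When `ν(B) = 0`, no jump falls in `B` almost surely, and the ratio `n / J_B` is not available.
  · have hzero : ∀ r n, (condLaw ν A r n).real {w | w.jumpCount B ≠ 0} = 0 := by
      intro r n
      rw [condLaw_real]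
      refine div_eq_zero_iff.2 (Or.inl ?_)
      refine (measureReal_eq_zero_iff (measure_ne_top _ _)).2 ?_
      have hae : ∀ᵐ x ∂(jumpsLaw ν), ∀ i, x i ∉ B := by
        refine ae_all_iff.2 fun i => ?_
        have h1 : ∀ᵐ k ∂ν, k ∉ B := measure_eq_zero_iff_ae_notMem.1 hB
        rw [← map_eval_jumpsLaw ν i] at h1
        exact ae_of_ae_map (measurable_pi_apply i).aemeasurable h1
      refine measure_mono_null (fun x hx => ?_) (ae_iff.1 hae)
      intro hx'
      refine hx.2 ?_
      have := jumpCount_stoppedPath B r x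
      rw [state_snd, Finset.sum_eq_zero fun i _ => by simp [hx' i]] at this
      exact_mod_cast this
    filter_upwards [ae_eventually_notMem_of_hasLaw hW (S := fun _ => {w | w.jumpCount B ≠ 0})
      (u := fun _ => 0) summable_zero
      (Eventually.of_forall fun n _ => (hzero _ n).le)] with ω hω
    refine tendsto_nhds_of_eventually_eq ?_
    filter_upwards [hω] with n hn
    have hn' : (W n ω).jumpCount B = 0 := by simpa using hn
    rw [hn', measureReal_def, hB]
    simp
  · have hB' : 0 < ν B := pos_iff_ne_zero.2 hB
    have hq : 0 < ν.real B := ENNReal.toReal_pos hB (measure_ne_top _ _)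
    obtain ⟨c, hc, C, hC, hle⟩ := exists_condLaw_real_le hA hB' hsub one_pos
    filter_upwards [ae_eventually_notMem_of_hasLaw hW
      ((summable_exp_neg_mul_sqrt hc).mul_left C)
      (Eventually.of_forall hle)] with ω hω
    have hlim : Tendsto (fun n : ℕ => (n : ℝ) / ((W n ω).jumpCount B : ℝ))
        (atTop ⊓ 𝓟 (validTimes ν A ϱ)) (𝓝 (ν.real A / ν.real B)) := by
      rw [tendsto_iff_norm_sub_tendsto_zero]
      have h0 : Tendsto (fun n : ℕ => 1 / (n : ℝ) ^ (1 / 4 : ℝ))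
          (atTop ⊓ 𝓟 (validTimes ν A ϱ)) (𝓝 0) := by
        refine Tendsto.mono_left ?_ inf_le_left
        simp only [one_div]
        exact ((tendsto_rpow_atTop (by norm_num)).comp
          tendsto_natCast_atTop_atTop).inv_tendsto_atTop
      refine squeeze_zero' (Eventually.of_forall fun _ => norm_nonneg _) ?_ h0
      filter_upwards [hω] with n hn
      exact not_lt.1 fun hlt => hn (Or.inr hlt)
    have := hlim.inv₀ (div_pos hp hq).ne'
    rw [inv_div] at this
    exact this.congr fun n => inv_div _ _

/-- The denominators are subexponential in all the regimes considered. -/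
lemma IsCentredJumpLaw.subexponentialJumpEvents (hν : IsCentredJumpLaw ν) {A : Set ℤ}
    (hA : 0 < ν A) {a : ℕ → ℝ} {ϱ : ℕ → ℕ}
    (h : (∃ α ∈ Set.Ioc (1 : ℝ) 2, HTail α ν ∧ IsStableScaling ν α a) ∨
      (HLoc ν ∧ IsCauchyScaling ν a))
    (hϱ : ∀ n, 1 ≤ n → 1 ≤ ϱ n) (hϱa : (fun n => (ϱ n : ℝ)) =O[atTop] a) :
    SubexponentialJumpEvents ν A ϱ := by
  have ha : ∀ n, 1 ≤ n → 0 < a n := by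
    rcases h with ⟨α, -, -, h⟩ | ⟨-, b, h⟩
    · exact h.1
    · exact h.1
  have hleft : LeftTail ν a := by
    rcases h with ⟨α, hα, -, h⟩ | ⟨-, b, h⟩
    · exact h.leftTail (exists_lt_rpow hα.1) (Eventually.of_forall fun _ => le_rfl)
    · exact h.leftTail exists_lt_mul_log (hν.eventually_centring_nonpos h)
  obtain ⟨C, hC⟩ := hϱa.bound
  have hCa : ∀ᶠ n : ℕ in atTop, (ϱ n : ℝ) ≤ (⌈C⌉₊ : ℕ) * a n := by
    filter_upwards [hC, eventually_ge_atTop 1] with n hn hn1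
    rw [Real.norm_of_nonneg (Nat.cast_nonneg _), Real.norm_of_nonneg (ha n hn1).le] at hn
    exact hn.trans (mul_le_mul_of_nonneg_right (Nat.le_ceil C) (ha n hn1).le)
  -- The dichotomy is on the variance, not on `α`: in the infinite variance case each tail
  -- assumption gives dyadic mass.
  by_cases h2 : FiniteVariance ν
  · obtain ⟨K, hK, hKa⟩ := h2.scaling_le_sqrt hν ha hleft
    refine hν.subexponential_of_finiteVariance h2 hA hϱ (C := (⌈C⌉₊ : ℕ) * K) ?_
    filter_upwards [hCa, hKa] with n h1 h2
    calc (ϱ n : ℝ) ≤ _ := h1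
      _ ≤ (⌈C⌉₊ : ℕ) * (K * √n) := by gcongr
      _ = _ := by ring
  · have hd : DyadicMass ν := by
      rcases h with ⟨α, hα, h, -⟩ | ⟨h, -⟩
      · exact h.dyadicMass (by linarith [hα.1]) h2
      · exact h.dyadicMass
    exact hν.subexponential_of_dyadicMass hd hA ha hleft hϱ hCa

end Concentration

/-! ### The walk conditioned to stay non-negative -/

section Tail

set_option linter.unusedSectionVars false

variable {ν : Measure ℤ} [IsProbabilityMeasure ν]

/-- Downward jumps have size one, so the first passage to `(-∞, -r]` occurs exactly at `-r`. -/
lemma exists_walk_eq {r : ℕ} (hr : 1 ≤ r) {x : ℕ → ℤ} (hx : ∀ i, -1 ≤ x i) {n : ℕ}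
    (hn : walk x n ≤ -(r : ℤ)) : ∃ i, 1 ≤ i ∧ walk x i = -(r : ℤ) := by
  classical
  have hex : ∃ i, walk x i ≤ -(r : ℤ) := ⟨n, hn⟩
  have h0 : Nat.find hex ≠ 0 := by
    intro h0
    have := Nat.find_spec hex
    rw [h0] at this
    simp [walk] at this
    omega
  refine ⟨Nat.find hex, Nat.pos_of_ne_zero h0, le_antisymm (Nat.find_spec hex) ?_⟩
  obtain ⟨k, hk⟩ := Nat.exists_eq_succ_of_ne_zero h0
  have h1 := Nat.find_min hex (m := k) (by omega)
  have h2 : walk x (k + 1) = walk x k + x k := Finset.sum_range_succ _ _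
  have h3 := hx k
  rw [hk, Nat.succ_eq_add_one, h2]
  omega

/-- The Laplace transform of a centred jump law is larger than one. -/
lemma IsCentredJumpLaw.one_lt_laplace (hν : IsCentredJumpLaw ν) {θ : ℝ} (hθ : 0 < θ) :
    Integrable (fun k : ℤ => Real.exp (-θ * k)) ν ∧ 1 < ∫ k : ℤ, Real.exp (-θ * k) ∂ν := by
  have hint : Integrable (fun k : ℤ => Real.exp (-θ * k)) ν := by
    refine Integrable.of_bound (measurable_of_countable _).aestronglyMeasurable (Real.exp θ) ?_
    filter_upwards [hν.ae_neg_one_le] with k hk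
    rw [Real.norm_of_nonneg (Real.exp_pos _).le]
    have : (-1 : ℝ) ≤ k := by exact_mod_cast hk
    exact Real.exp_le_exp.2 (by nlinarith)
  refine ⟨hint, ?_⟩
  have hpos : 0 < (Real.exp θ - 1 - θ) * ν.real {-1} := by
    refine mul_pos ?_ (ENNReal.toReal_pos hν.charges (measure_ne_top _ _))
    linarith [Real.add_one_lt_exp hθ.ne']
  have hi1 : Integrable (fun k : ℤ => 1 - θ * (k : ℝ)) ν :=
    (integrable_const _).sub (hν.integrable.const_mul _)
  have hi2 : Integrable (fun k : ℤ => (Real.exp θ - 1 - θ) * ({-1} : Set ℤ).indicator 1 k) ν :=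
    ((integrable_const (1 : ℝ)).indicator MeasurableSet.of_discrete).const_mul _
  -- The tangent bound `exp(-θ k) ≥ 1 - θ k`, with the strict gain at `k = -1` added.
  have h1 : ∫ k : ℤ, ((1 - θ * (k : ℝ)) + (Real.exp θ - 1 - θ) * ({-1} : Set ℤ).indicator 1 k) ∂ν ≤
      ∫ k : ℤ, Real.exp (-θ * k) ∂ν := by
    refine integral_mono (hi1.add hi2) hint fun k => ?_
    by_cases hk : k = -1
    · simp [hk]
    · have := Real.add_one_le_exp (-θ * k)
      simp only [Set.mem_singleton_iff, hk, not_false_eq_true, Set.indicator_of_notMem, mul_zero,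
        add_zero]
      linarith
  rw [integral_add hi1 hi2, integral_sub (integrable_const _) (hν.integrable.const_mul _),
    integral_const_mul, integral_const_mul, hν.mean_zero, integral_indicator_one] at h1
  simp only [integral_const, probReal_univ, smul_eq_mul, mul_one, mul_zero, sub_zero] at h1
  linarith

/-- The event that the walk goes to `-(s + 1)` or below within `n` steps. -/
def fallsWithin (n : ℕ) (s : ℤ) : Set (ℕ → ℤ) := {x | ∃ i ≤ n, walk x i ≤ -(s + 1)}

lemma measurableSet_fallsWithin (n : ℕ) (s : ℤ) : MeasurableSet (fallsWithin n s) := by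
  have : fallsWithin n s = ⋃ i ∈ Set.Iic n, {x | walk x i ≤ -(s + 1)} := by
    ext x
    simp [fallsWithin]
  rw [this]
  exact MeasurableSet.biUnion (Set.to_countable _) fun i _ =>
    measurable_walk i (MeasurableSet.of_discrete (s := Set.Iic (-(s + 1))))

lemma integral_fallsWithin_le (n : ℕ) (s : ℤ) :
    ∫ k, (jumpsLaw ν).real (fallsWithin n (s + k)) ∂ν ≤
      (jumpsLaw ν).real (fallsWithin (n + 1) s) := by
  have hbd : ∀ k, ‖(jumpsLaw ν).real (fallsWithin n (s + k))‖ ≤ 1 := fun k => by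
    rw [Real.norm_of_nonneg measureReal_nonneg]
    exact measureReal_le_one
  have hmeas := measurableSet_fallsWithin (n + 1) s
  rw [← integral_comp_eval ν (fun k => (jumpsLaw ν).real (fallsWithin n (s + k))) 0,
    measureReal_def, jumpsLaw_apply_concat ν 1 hmeas,
    integral_eq_lintegral_of_nonneg_ae (ae_of_all _ fun _ => measureReal_nonneg)
      ((measurable_of_countable fun k => (jumpsLaw ν).real (fallsWithin n (s + k))).comp
        (measurable_pi_apply 0)).aestronglyMeasurable]
  refine ENNReal.toReal_mono ?_ (lintegral_mono fun y => ?_)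
  · rw [← jumpsLaw_apply_concat ν 1 hmeas]
    exact measure_ne_top _ _
  · rw [ofReal_measureReal (measure_ne_top _ _)]
    refine measure_mono fun z hz => ?_
    obtain ⟨i, hi, hz⟩ := hz
    refine ⟨1 + i, by omega, ?_⟩
    rw [walk_concat]
    have : walk y 1 = y 0 := by simp [walk]
    omega

/-- For the walk started at `s`, `exp(-θ S_n) / φ^n` is a martingale. Stopped on reaching `-1` it is
at most `exp θ`, and before that at most `φ^(-n)` at time `n`. The induction is the first-step form
of this argument. -/
lemma IsCentredJumpLaw.exp_le_real_fallsWithin (hν : IsCentredJumpLaw ν) {θ : ℝ} (hθ : 0 < θ)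
    (n : ℕ) : ∀ s : ℤ, -1 ≤ s → Real.exp (-θ * s) ≤
      Real.exp θ * (jumpsLaw ν).real (fallsWithin n s) +
        1 / (∫ k : ℤ, Real.exp (-θ * k) ∂ν) ^ n := by
  obtain ⟨hint, hφ⟩ := hν.one_lt_laplace hθ
  set φ := ∫ k : ℤ, Real.exp (-θ * k) ∂ν with hφdef
  have hφ0 : 0 < φ := by linarith
  have hm1 : ∀ n, Real.exp (-θ * ((-1 : ℤ) : ℝ)) ≤
      Real.exp θ * (jumpsLaw ν).real (fallsWithin n (-1)) + 1 / φ ^ n := by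
    intro n
    -- For `s = -1` the threshold is `0`, already attained at time `0`.
    have : fallsWithin n (-1) = Set.univ := by
      refine Set.eq_univ_of_forall fun x => ⟨0, Nat.zero_le _, ?_⟩
      simp [walk]
    rw [this, probReal_univ]
    have : 0 < 1 / φ ^ n := by positivity
    simpa using this.le
  induction n with
  | zero =>
    intro s hs
    rcases hs.eq_or_lt with rfl | hs
    · exact hm1 0
    · have h0 : (0 : ℝ) ≤ s := by
        have : 0 ≤ s := by omega
        exact_mod_cast this
      have h1 : Real.exp (-θ * s) ≤ 1 := Real.exp_le_one_iff.2 (by nlinarith)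
      have h2 : 0 ≤ Real.exp θ * (jumpsLaw ν).real (fallsWithin 0 s) := by positivity
      rw [pow_zero, div_one]
      linarith
  | succ n ih =>
    intro s hs
    rcases hs.eq_or_lt with rfl | hs
    · exact hm1 _
    set g : ℤ → ℝ := fun k => (jumpsLaw ν).real (fallsWithin n (s + k)) with hg
    have hgi : Integrable g ν := by
      refine Integrable.of_bound (measurable_of_countable _).aestronglyMeasurable 1 (ae_of_all _ ?_)
      intro k
      rw [Real.norm_of_nonneg measureReal_nonneg]
      exact measureReal_le_one
    have h1 : φ * Real.exp (-θ * s) ≤ Real.exp θ * ∫ k, g k ∂ν + 1 / φ ^ n := by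
      have h2 : φ * Real.exp (-θ * s) = ∫ k : ℤ, Real.exp (-θ * k) * Real.exp (-θ * s) ∂ν := by
        rw [integral_mul_const]
      have h3 : Real.exp θ * ∫ k, g k ∂ν + 1 / φ ^ n =
          ∫ k, (Real.exp θ * g k + 1 / φ ^ n) ∂ν := by
        rw [integral_add (hgi.const_mul _) (integrable_const _), integral_const_mul]
        simp
      rw [h2, h3]
      refine integral_mono_ae (hint.mul_const _) ((hgi.const_mul _).add (integrable_const _)) ?_
      filter_upwards [hν.ae_neg_one_le] with k hk
      have h4 := ih (s + k) (by omega)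
      rw [← Real.exp_add]
      refine le_trans (le_of_eq ?_) h4
      congr 1
      push_cast
      ring
    have h5 := integral_fallsWithin_le (ν := ν) n s
    have h6 : φ * Real.exp (-θ * s) ≤
        Real.exp θ * (jumpsLaw ν).real (fallsWithin (n + 1) s) + 1 / φ ^ n :=
      h1.trans (by gcongr)
    have h7 : 0 ≤ Real.exp θ * (jumpsLaw ν).real (fallsWithin (n + 1) s) := by positivity
    have h8 : φ * (1 / φ ^ (n + 1)) = 1 / φ ^ n := by
      rw [pow_succ]
      field_simp
    refine le_of_mul_le_mul_left ?_ hφ0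
    rw [mul_add, h8]
    nlinarith

/-- A centred walk almost surely hits `-1`. -/
lemma IsCentredJumpLaw.ae_exists_walk_eq_neg_one (hν : IsCentredJumpLaw ν) :
    ∀ᵐ x ∂(jumpsLaw ν), ∃ i, 1 ≤ i ∧ walk x i = -((1 : ℕ) : ℤ) := by
  set F : Set (ℕ → ℤ) := ⋃ n, fallsWithin n 0 with hF
  have hFm : MeasurableSet F := MeasurableSet.iUnion fun n => measurableSet_fallsWithin n 0
  -- Letting `n → ∞` at fixed `θ`, then `θ → 0`, forces the hitting probability to be `1`.
  have hθ : ∀ θ : ℝ, 0 < θ → 1 ≤ Real.exp θ * (jumpsLaw ν).real F := by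
    intro θ hθ
    have hφ := (hν.one_lt_laplace hθ).2
    have hlim : Tendsto (fun n : ℕ => Real.exp θ * (jumpsLaw ν).real F +
        1 / (∫ k : ℤ, Real.exp (-θ * k) ∂ν) ^ n) atTop
        (𝓝 (Real.exp θ * (jumpsLaw ν).real F + 0)) := by
      refine tendsto_const_nhds.add ?_
      simp only [one_div]
      exact (tendsto_pow_atTop_atTop_of_one_lt hφ).inv_tendsto_atTop
    rw [add_zero] at hlim
    refine ge_of_tendsto' hlim fun n => ?_
    have h1 := hν.exp_le_real_fallsWithin hθ n 0 (by norm_num)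
    simp only [Int.cast_zero, mul_zero, Real.exp_zero] at h1
    refine h1.trans ?_
    gcongr
    · exact measure_ne_top _ _
    · exact Set.subset_iUnion (fun n => fallsWithin n 0) n
  have hlim : Tendsto (fun θ : ℝ => Real.exp θ * (jumpsLaw ν).real F) (𝓝[>] 0)
      (𝓝 (Real.exp 0 * (jumpsLaw ν).real F)) :=
    Tendsto.mono_left (Continuous.tendsto (by fun_prop) 0) nhdsWithin_le_nhds
  have h1 : 1 ≤ (jumpsLaw ν).real F := by
    have := ge_of_tendsto hlim (eventually_mem_nhdsWithin.mono fun θ h => hθ θ h)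
    simpa using this
  have h2 : ∀ᵐ x ∂(jumpsLaw ν), x ∈ F := by
    refine (mem_ae_iff_prob_eq_one hFm).2 (le_antisymm prob_le_one ?_)
    rw [← ofReal_measureReal (measure_ne_top _ _)]
    exact ENNReal.one_le_ofReal.2 h1
  filter_upwards [h2, hν.ae_forall_neg_one_le] with x hx hx1
  obtain ⟨n, i, -, hi⟩ := Set.mem_iUnion.1 hx
  exact exists_walk_eq le_rfl hx1 (by simpa using hi)

/-- The probability to stay non-negative up to time `n`. -/
lemma IsCentredJumpLaw.real_Ici_le (hν : IsCentredJumpLaw ν) (n : ℕ) :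
    ν.real (Set.Ici (n : ℤ)) ≤ (jumpsLaw ν).real {x | ∀ i ≤ n, 0 ≤ walk x i} := by
  rw [← real_eval_mem ν 0]
  refine ENNReal.toReal_mono (measure_ne_top _ _) (measure_mono_ae ?_)
  filter_upwards [hν.ae_forall_neg_one_le] with x hx hx0 i hi
  have hx0' : (n : ℤ) ≤ x 0 := hx0
  rcases Nat.eq_zero_or_pos i with rfl | hi0
  · simp [walk]
  -- After a first jump of at least `n`, the other `i - 1 < n` steps cannot bring the walk below
  -- zero.
  · have h1 := walk_add_le hx 1 (i - 1)
    rw [Nat.add_sub_cancel' hi0] at h1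
    have h2 : walk x 1 = x 0 := by simp [walk]
    omega

lemma measurableSet_stay (n : ℕ) : MeasurableSet {x : ℕ → ℤ | ∀ i ≤ n, 0 ≤ walk x i} := by
  simp only [Set.ofPred_forall]
  exact MeasurableSet.iInter fun i => MeasurableSet.iInter fun _ =>
    measurable_walk i (MeasurableSet.of_discrete (s := Set.Ici 0))

variable (ν) in
lemma tailLaw_real (n : ℕ) (S : Set FinPath) :
    (tailLaw ν n).real S =
      (jumpsLaw ν).real ({x | ∀ i ≤ n, 0 ≤ walk x i} ∩ stoppedPath 1 ⁻¹' S) /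
        (jumpsLaw ν).real {x | ∀ i ≤ n, 0 ≤ walk x i} := by
  rw [tailLaw, map_measureReal_apply (measurable_stoppedPath 1) MeasurableSet.of_discrete,
    measureReal_def, cond_apply (measurableSet_stay n), ENNReal.toReal_mul, ENNReal.toReal_inv,
    div_eq_inv_mul]
  rfl

lemma state_univ_snd (x : ℕ → ℤ) (N : ℕ) : (state Set.univ x N).2 = N := by
  rw [state_snd]
  simp

-- The length of the path is random but exceeds `n`, so all lengths beyond `n` are treated at once;
-- the Hoeffding errors sum geometrically.
variable (ν) in
lemma real_iUnion_deviation_le (B : Set ℤ) {δ : ℝ} (hδ : 0 < δ) (n : ℕ) :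
    (jumpsLaw ν).real (⋃ k : ℕ, {x | δ * ((n + 1 + k : ℕ) : ℝ) ≤
      |((state B x (n + 1 + k)).2 : ℝ) - ν.real B * ((n + 1 + k : ℕ) : ℝ)|}) ≤
      2 / (1 - Real.exp (-(δ ^ 2 / 2))) * Real.exp (-(δ ^ 2 / 2)) ^ n := by
  set ρ := Real.exp (-(δ ^ 2 / 2)) with hρ
  have hρ0 : 0 < ρ := Real.exp_pos _
  have hρ1 : ρ < 1 := Real.exp_lt_one_iff.2 (neg_neg_of_pos (by positivity))
  have hk : ∀ k : ℕ, (jumpsLaw ν) {x | δ * ((n + 1 + k : ℕ) : ℝ) ≤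
      |((state B x (n + 1 + k)).2 : ℝ) - ν.real B * ((n + 1 + k : ℕ) : ℝ)|} ≤
      ENNReal.ofReal (2 * ρ ^ n * ρ ^ k) := by
    intro k
    have h1 := real_le_abs_count_sub ν Set.univ B (n + 1 + k)
      (t := δ * ((n + 1 + k : ℕ) : ℝ)) (by positivity)
    simp only [probReal_univ, one_mul, state_univ_snd, Int.cast_natCast] at h1
    rw [← ofReal_measureReal (measure_ne_top _ _)]
    refine ENNReal.ofReal_le_ofReal (h1.trans ?_)
    rw [mul_assoc, ← pow_add]
    gcongr
    calc Real.exp (-(δ * ((n + 1 + k : ℕ) : ℝ)) ^ 2 / (2 * ((n + 1 + k : ℕ) : ℝ)))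
        = ρ ^ (n + 1 + k) := by
          rw [hρ, ← Real.exp_nat_mul]
          congr 1
          field_simp
      _ ≤ ρ ^ (n + k) := pow_le_pow_of_le_one hρ0.le hρ1.le (by omega)
  refine ENNReal.toReal_le_of_le_ofReal (by
    have : 0 < 1 - ρ := by linarith
    positivity) ((measure_iUnion_le _).trans ((ENNReal.tsum_le_tsum hk).trans_eq ?_))
  rw [← ENNReal.ofReal_tsum_of_nonneg (fun k => by positivity)
    ((summable_geometric_of_lt_one hρ0.le hρ1).mul_left _), tsum_mul_left,
    tsum_geometric_of_lt_one hρ0.le hρ1]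
  congr 1
  ring

lemma IsCentredJumpLaw.real_stay_inter_le (hν : IsCentredJumpLaw ν) (B : Set ℤ) {δ : ℝ}
    (hδ : 0 < δ) (n : ℕ) :
    (jumpsLaw ν).real ({x | ∀ i ≤ n, 0 ≤ walk x i} ∩ stoppedPath 1 ⁻¹'
      {w | δ < |(w.jumpCount B : ℝ) / (w.numSteps : ℝ) - ν.real B|}) ≤
      2 / (1 - Real.exp (-(δ ^ 2 / 2))) * Real.exp (-(δ ^ 2 / 2)) ^ n := by
  refine le_trans (ENNReal.toReal_mono (measure_ne_top _ _) (measure_mono_ae ?_))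
    (real_iUnion_deviation_le ν B hδ n)
  -- Almost sure hitting rules out the default value `0` of `hitTime`; staying non-negative then
  -- forces it to be at least `n + 1`.
  filter_upwards [hν.ae_exists_walk_eq_neg_one] with x hx hxS
  obtain ⟨hstay, hdev⟩ := hxS
  have hhit : 1 ≤ hitTime 1 x ∧ walk x (hitTime 1 x) = -((1 : ℕ) : ℤ) := Nat.sInf_mem hx
  have hn : n + 1 ≤ hitTime 1 x := by
    by_contra! hlt
    have := hstay (hitTime 1 x) (by omega)
    omega
  obtain ⟨k, hk⟩ := Nat.exists_eq_add_of_le hn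
  refine Set.mem_iUnion.2 ⟨k, ?_⟩
  rw [← hk]
  have hcount : (((stoppedPath 1 x).jumpCount B : ℕ) : ℝ) = (state B x (hitTime 1 x)).2 := by
    rw [← jumpCount_stoppedPath]
    rfl
  have hdev' : δ < |((stoppedPath 1 x).jumpCount B : ℝ) / (hitTime 1 x : ℝ) - ν.real B| := hdev
  have hN : (0 : ℝ) < hitTime 1 x := by exact_mod_cast hhit.1
  rw [hcount] at hdev'
  have heq : ((state B x (hitTime 1 x)).2 : ℝ) - ν.real B * (hitTime 1 x : ℝ) =
      (((state B x (hitTime 1 x)).2 : ℝ) / (hitTime 1 x : ℝ) - ν.real B) * hitTime 1 x := by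
    field_simp
  simp only [Set.mem_ofPred_eq]
  rw [heq, abs_mul, abs_of_pos hN]
  exact mul_le_mul_of_nonneg_right hdev'.le hN.le

/-- Almost sure convergence for the walk conditioned to stay non-negative. -/
lemma IsCentredJumpLaw.ae_tendsto_tailLaw (hν : IsCentredJumpLaw ν) (hd : DyadicMass ν)
    (B : Set ℤ) {Ω : Type*} [MeasurableSpace Ω] (P : Measure Ω) [IsProbabilityMeasure P]
    (W : ℕ → Ω → FinPath) (hW : ∀ n, 1 ≤ n → HasLaw (W n) (tailLaw ν n) P) :
    ∀ᵐ ω ∂P, Tendsto (fun n : ℕ => ((W n ω).jumpCount B : ℝ) / ((W n ω).numSteps : ℝ))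
      atTop (𝓝 (ν.real B)) := by
  obtain ⟨κ, D, hD⟩ := hd.exists_forall_le
  -- The mass of `[n, 4n]` already bounds the probability of a first jump of size at least `n`.
  have hlow : ∀ n : ℕ, 1 ≤ n → D ≤ n →
      1 / (4 * n : ℝ) ^ κ ≤ (jumpsLaw ν).real {x | ∀ i ≤ n, 0 ≤ walk x i} := by
    intro n _ hn
    refine le_trans (le_of_eq ?_) ((hD (4 * n) (by omega)).trans
      (le_trans (measureReal_mono ?_ (measure_ne_top _ _)) (hν.real_Ici_le n)))
    · push_cast
      rfl
    · rintro k ⟨hk, -⟩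
      show (n : ℤ) ≤ k
      omega
  have hdev : ∀ δ : ℝ, 0 < δ → ∀ᵐ ω ∂P, ∀ᶠ n : ℕ in atTop,
      |((W n ω).jumpCount B : ℝ) / ((W n ω).numSteps : ℝ) - ν.real B| ≤ δ := by
    intro δ hδ
    set ρ := Real.exp (-(δ ^ 2 / 2)) with hρ
    have hρ0 : 0 < ρ := Real.exp_pos _
    have hρ1 : ρ < 1 := Real.exp_lt_one_iff.2 (neg_neg_of_pos (by positivity))
    have hsum₀ : Summable fun n : ℕ => (n : ℝ) ^ κ * ρ ^ n :=
      summable_pow_mul_geometric_of_norm_lt_one κ (by rwa [Real.norm_of_nonneg hρ0.le])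
    have hsum : Summable fun n : ℕ => 2 / (1 - ρ) * 4 ^ κ * ((n : ℝ) ^ κ * ρ ^ n) :=
      hsum₀.mul_left _
    have hV : atTop ⊓ 𝓟 {n : ℕ | 1 ≤ n} = atTop :=
      inf_of_le_left (le_principal_iff.2 (eventually_ge_atTop 1))
    have h1 := ae_eventually_notMem_of_hasLaw (V := {n : ℕ | 1 ≤ n}) hW
      (S := fun _ => {w | δ < |(w.jumpCount B : ℝ) / (w.numSteps : ℝ) - ν.real B|}) hsum (by
        filter_upwards [eventually_ge_atTop D] with n hn hn1
        have h2 := hlow n hn1 hn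
        have hn0 : (0 : ℝ) < n := by exact_mod_cast (show 1 ≤ n from hn1)
        rw [tailLaw_real, div_le_iff₀ (lt_of_lt_of_le (by positivity) h2)]
        refine (hν.real_stay_inter_le B hδ n).trans ?_
        have h3 : 0 < 1 - ρ := by linarith
        calc 2 / (1 - ρ) * ρ ^ n
            = 2 / (1 - ρ) * 4 ^ κ * ((n : ℝ) ^ κ * ρ ^ n) * (1 / (4 * n : ℝ) ^ κ) := by
              rw [mul_pow]
              field_simp
          _ ≤ _ := by gcongr)
    rw [hV] at h1
    filter_upwards [h1] with ω hω
    exact hω.mono fun n hn => not_lt.1 hn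
  have hall : ∀ᵐ ω ∂P, ∀ m : ℕ, ∀ᶠ n : ℕ in atTop,
      |((W n ω).jumpCount B : ℝ) / ((W n ω).numSteps : ℝ) - ν.real B| ≤ 1 / ((m : ℝ) + 1) :=
    ae_all_iff.2 fun m => hdev _ (by positivity)
  filter_upwards [hall] with ω hω
  refine Metric.tendsto_nhds.2 fun ε hε => ?_
  obtain ⟨m, hm⟩ := exists_nat_one_div_lt hε
  exact (hω m).mono fun n hn => hn.trans_lt hm

end Tail

end LukaPath

end

/-! ### The two conditionings combined -/

open LukaPath in
theorem mainTheorem12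
    (ν : Measure ℤ) [IsProbabilityMeasure ν] (hν : IsCentredJumpLaw ν)
    (B : Set ℤ) (hB : B ⊆ Set.Ici (-1)) :
    -- conditioning on the number of jumps in `A`
    (∀ A ∈ Admissible ν, ∀ (a : ℕ → ℝ) (ϱ : ℕ → ℕ),
      ((∃ α ∈ Set.Ioc (1 : ℝ) 2, HTail α ν ∧ IsStableScaling ν α a) ∨
        (HLoc ν ∧ IsCauchyScaling ν a)) →
      (∀ n, 1 ≤ n → 1 ≤ ϱ n) →
      (fun n => (ϱ n : ℝ)) =O[atTop] a →
      -- almost sure convergence, however the paths are coupled on one probability space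
      (∀ {Ω : Type*} [MeasurableSpace Ω] (P : Measure Ω) [IsProbabilityMeasure P]
        (W : ℕ → Ω → FinPath),
        (∀ n ∈ validTimes ν A ϱ, HasLaw (W n) (condLaw ν A (ϱ n) n) P) →
        ∀ᵐ ω ∂P, Tendsto (fun n : ℕ => ((W n ω).jumpCount B : ℝ) / (n : ℝ))
          (atTop ⊓ 𝓟 (validTimes ν A ϱ)) (𝓝 (ν.real B / ν.real A))) ∧
      -- exponential concentration; `n / 0` counts as `∞`
      (0 < ν B → ∀ δ : ℝ, 0 < δ → ∃ c : ℝ, 0 < c ∧ ∃ C : ℝ, 0 < C ∧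
        ∀ n ∈ validTimes ν A ϱ,
          (condLaw ν A (ϱ n) n).real
            {w | w.jumpCount B = 0 ∨
              δ / (n : ℝ) ^ (1 / 4 : ℝ) <
                |(n : ℝ) / (w.jumpCount B : ℝ) - ν.real A / ν.real B|}
            ≤ C * Real.exp (-c * (n : ℝ) ^ (1 / 2 : ℝ)))) ∧
    -- conditioning on staying non-negative
    (HTail 1 ν →
      ∀ {Ω : Type*} [MeasurableSpace Ω] (P : Measure Ω) [IsProbabilityMeasure P]
        (W : ℕ → Ω → FinPath),
        (∀ n, 1 ≤ n → HasLaw (W n) (tailLaw ν n) P) →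
        ∀ᵐ ω ∂P, Tendsto (fun n : ℕ => ((W n ω).jumpCount B : ℝ) / ((W n ω).numSteps : ℝ))
          atTop (𝓝 (ν.real B))) := by
  refine ⟨fun A hA a ϱ h hϱ hϱa => ?_, fun h Ω _ P _ W hW => ?_⟩
  · have hA0 : 0 < ν A := hA.2.1
    have hsub := hν.subexponentialJumpEvents hA0 h hϱ hϱa
    exact ⟨fun P _ W hW => ae_tendsto_condLaw hA0 hsub P W hW,
      fun hB0 δ hδ => exists_condLaw_real_le hA0 hB0 hsub hδ⟩
  · refine hν.ae_tendsto_tailLaw ?_ B P W hW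
    rcases h with ⟨l, hl, hνl⟩ | ⟨h, -⟩
    · exact dyadicMass_of_tail one_pos hl hνl
    · norm_num at h
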